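/- There are constants $C,K$ and one deterministic algorithm, consisting of the routines preprocess, query and report, on a real RAM (reals may only be copied, added, subtracted and compared, besides the constant $0$; integers are bounded by $(n+h)^{K}$, i.e. machine words have $O(\log (n+h))$ bits), with the following properties for all integers $n,h\ge 1$ and every directed graph $G=(V,E)$ with $n$ vertices, real edge weights $\omega$ and a set $F\subseteq E$ of edges called negative that contains all edges of negative weight. Conventions. A vertex with an outgoing edge in $F$ is a negative vertex. Paths may repeat vertices and edges, and a single vertex is a path. An $h$-hop path is a path with at most $h$ edges in $F$, counted with multiplicity, and $d^h(s,t)$ is the minimum weight of an $h$-hop path from $s$ to $t$ ($\infty$ if there is none). A path uses every vertex it visits, its two ends included. The algorithm receives $G$ (adjacency matrix with weights, edges in $F$ marked) and $h$. After preprocessing, any sequence of queries and reports, each for any negative vertex, may follow. A query for a negative vertex $r$ outputs a real number $\Delta_r$ and two sets $\tilde V_r^{out},\tilde V_r^{in}\subseteq V$ such that 1. for every $v\in\tilde V_r^{out}$ there is an $(h+1)$-hop path starting at $r$ and using $v$ of weight $\le-\Delta_r$; 2. for every $v\notin\tilde V_r^{out}$, all $(h+1)$-hop paths starting at $r$ and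 using $v$ have weight $\ge-\Delta_r$; 3. for every $v\in\tilde V_r^{in}$ there is an $h$-hop path ending at $r$ and using $v$ of weight $\le\Delta_r$; 4. for every $v\notin\tilde V_r^{in}$, all $h$-hop paths ending at $r$ and using $v$ have weight $\ge\Delta_r$; 5. property 1 holds with strict inequality for all $v\in\tilde V_r^{out}$, or property 3 holds with strict inequality for all $v\in\tilde V_r^{in}$; 6. $\big||\tilde V_r^{out}|-|\tilde V_r^{in}|\big|\le 1$. Preprocessing takes at most $C\,h\,n^2(1+\log n)^{K}$ steps, that is $\tilde O(hn^2)$. A query for $r$ takes at most $$C\Big(\big(|\tilde V_r^{out}|+|\tilde V_r^{in}|\big)^2h^2+\big(|\tilde V_r^{out}|+|\tilde V_r^{in}|\big)\,h\log n\Big)$$ steps. Within this time the query also outputs the value $d^{h+1}(r,v)$ for every $v$ with $d^{h+1}(r,v)<-\Delta_r$ (such $v$ lie in $\tilde V_r^{out}$) and the value $d^h(v,r)$ for every $v$ with $d^h(v,r)<\Delta_r$ (such $v$ lie in $\tilde V_r^{in}$). A report for $r$ takes at most $C\,h\,n^2(1+\log n)^{K}$ steps and outputs $d^{h+1}(r,v)$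 and $d^h(v,r)$ for every $v\in V$ for which they are finite, in particular for all $v\in\tilde V_r^{out}$ and all $v\in\tilde V_r^{in}$ respectively. -/

import Mathlib

/-! ### A real RAM with step count

The machine has a constant number of arrays of integers (machine words) and a constant number of
arrays of real numbers, each addressed by integers; a scalar variable is a fixed cell of an array.
On integers it has the usual word operations.  Real numbers can only be copied, added, subtracted
and compared. Programs are finite objects that know nothing of the input except through memory. -/

namespace RealRAM

/-- Memory: cell `i` of the integer array `a` is `s.nat a i`, and similarly for real arrays. -/
structure Mem where
  nat : ℕ → ℕ → ℕ
  real : ℕ → ℕ → ℝ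

/-- Write `x` to cell `i` of the integer array `a`. -/
def Mem.setNat (s : Mem) (a i x : ℕ) : Mem :=
  { s with nat := Function.update s.nat a (Function.update (s.nat a) i x) }

/-- Write `x` to cell `i` of the real array `a`. -/
noncomputable def Mem.setReal (s : Mem) (a i : ℕ) (x : ℝ) : Mem :=
  { s with real := Function.update s.real a (Function.update (s.real a) i x) }

/-- Integer expressions; `get a i` reads cell `i` of the integer array `a`. -/
inductive NExp where
  | const (k : ℕ)
  | get (a : ℕ) (i : NExp)
  | add (x y : NExp)
  | sub (x y : NExp)
  | mul (x y : NExp)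
  | div (x y : NExp)

def NExp.eval (s : Mem) : NExp → ℕ
  | const k => k
  | get a i => s.nat a (i.eval s)
  | add x y => x.eval s + y.eval s
  | sub x y => x.eval s - y.eval s
  | mul x y => x.eval s * y.eval s
  | div x y => x.eval s / y.eval s

/-- Number of elementary operations in the evaluation of an expression. -/
def NExp.cost : NExp → ℕ
  | const _ => 1
  | get _ i => i.cost + 1
  | add x y => x.cost + y.cost + 1
  | sub x y => x.cost + y.cost + 1
  | mul x y => x.cost + y.cost + 1
  | div x y => x.cost + y.cost + 1

/-- Real expressions; `get a i` reads cell `i` of the real array `a`. -/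
inductive RExp where
  | zero
  | get (a : ℕ) (i : NExp)
  | add (x y : RExp)
  | sub (x y : RExp)

noncomputable def RExp.eval (s : Mem) : RExp → ℝ
  | zero => 0
  | get a i => s.real a (i.eval s)
  | add x y => x.eval s + y.eval s
  | sub x y => x.eval s - y.eval s

def RExp.cost : RExp → ℕ
  | zero => 1
  | get _ i => i.cost + 1
  | add x y => x.cost + y.cost + 1
  | sub x y => x.cost + y.cost + 1

/-- Tests. -/
inductive BExp where
  | natLE (x y : NExp)
  | realLE (x y : RExp)
  | neg (b : BExp)
  | conj (b c : BExp)

def BExp.eval (s : Mem) : BExp → Prop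
  | natLE x y => x.eval s ≤ y.eval s
  | realLE x y => x.eval s ≤ y.eval s
  | neg b => ¬ b.eval s
  | conj b c => b.eval s ∧ c.eval s

def BExp.cost : BExp → ℕ
  | natLE x y => x.cost + y.cost + 1
  | realLE x y => x.cost + y.cost + 1
  | neg b => b.cost + 1
  | conj b c => b.cost + c.cost + 1

/-- Programs; `setNat a i e` writes the value of `e` to cell `i` of the integer array `a`. -/
inductive Prog where
  | skip
  | setNat (a : ℕ) (i e : NExp)
  | setReal (a : ℕ) (i : NExp) (e : RExp)
  | seq (p q : Prog)
  | cond (b : BExp) (p q : Prog)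
  | loop (b : BExp) (p : Prog)

/-- `Exec W p s t s'`: started in memory `s`, the program `p` halts after `t` steps in memory `s'`,
and on the way every integer that it stores and every address that it writes to is at most `W`
(so that integers occupy words of `O(log W)` bits; the expressions of a fixed program have
constant size, so the intermediate values inside an expression also fit in `O(1)` words). -/
inductive Exec (W : ℕ) : Prog → Mem → ℕ → Mem → Prop where
  | skip (s : Mem) : Exec W Prog.skip s 1 s
  | setNat (a : ℕ) (i e : NExp) (s : Mem) (hi : i.eval s ≤ W) (he : e.eval s ≤ W) :
      Exec W (Prog.setNat a i e) s (i.cost + e.cost + 1) (s.setNat a (i.eval s) (e.eval s))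
  | setReal (a : ℕ) (i : NExp) (e : RExp) (s : Mem) (hi : i.eval s ≤ W) :
      Exec W (Prog.setReal a i e) s (i.cost + e.cost + 1) (s.setReal a (i.eval s) (e.eval s))
  | seq {p q : Prog} {s₀ s₁ s₂ : Mem} {t₁ t₂ : ℕ}
      (hp : Exec W p s₀ t₁ s₁) (hq : Exec W q s₁ t₂ s₂) :
      Exec W (Prog.seq p q) s₀ (t₁ + t₂) s₂
  | condTrue {b : BExp} {p q : Prog} {s s' : Mem} {t : ℕ}
      (hb : b.eval s) (hp : Exec W p s t s') :
      Exec W (Prog.cond b p q) s (b.cost + 1 + t) s'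
  | condFalse {b : BExp} {p q : Prog} {s s' : Mem} {t : ℕ}
      (hb : ¬ b.eval s) (hq : Exec W q s t s') :
      Exec W (Prog.cond b p q) s (b.cost + 1 + t) s'
  | loopStop {b : BExp} {p : Prog} {s : Mem} (hb : ¬ b.eval s) :
      Exec W (Prog.loop b p) s (b.cost + 1) s
  | loopStep {b : BExp} {p : Prog} {s₀ s₁ s₂ : Mem} {t₁ t₂ : ℕ}
      (hb : b.eval s₀) (hp : Exec W p s₀ t₁ s₁) (hl : Exec W (Prog.loop b p) s₁ t₂ s₂) :
      Exec W (Prog.loop b p) s₀ (b.cost + 1 + t₁ + t₂) s₂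

end RealRAM

/-! ### Weighted directed graphs with a frozen set of negative edges -/

/-- A directed graph on `n` vertices with real edge weights, together with the set of edges that are
called negative. Every edge of negative weight is in this set. An edge that is called negative may
nevertheless have a nonnegative weight: the set of negative edges stays frozen when the graph is
reweighted by a potential. Without freezing, `Neg u v` is `Adj u v ∧ weight u v < 0`. -/
structure FrozenGraph (n : ℕ) where
  Adj : Fin n → Fin n → Prop
  weight : Fin n → Fin n → ℝ
  Neg : Fin n → Fin n → Prop
  adj_of_neg : ∀ u v, Neg u v → Adj u v
  neg_of_weight_neg : ∀ u v, Adj u v → weight u v < 0 → Neg u v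

namespace FrozenGraph

variable {n : ℕ}

/-- A negative vertex is a vertex with a negative outgoing edge. -/
def IsNegVertex (G : FrozenGraph n) (r : Fin n) : Prop := ∃ v, G.Neg r v

/-- Directed paths; vertices and edges may repeat. -/
inductive Walk (G : FrozenGraph n) : Fin n → Fin n → Type where
  | nil (u : Fin n) : Walk G u u
  | cons {u v w : Fin n} (e : G.Adj u v) (p : Walk G v w) : Walk G u w

namespace Walk

variable {G : FrozenGraph n}

/-- Total weight of the edges. -/
def weight : {u v : Fin n} → G.Walk u v → ℝ
  | _, _, nil _ => 0
  | _, _, cons (u := u) (v := v) _ p => G.weight u v + p.weight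

open Classical in
/-- Number of negative edges, with multiplicity. -/
noncomputable def hops : {u v : Fin n} → G.Walk u v → ℕ
  | _, _, nil _ => 0
  | _, _, cons (u := u) (v := v) _ p => (if G.Neg u v then 1 else 0) + p.hops

/-- The vertices visited, including both ends. -/
def support : {u v : Fin n} → G.Walk u v → List (Fin n)
  | _, _, nil u => [u]
  | _, _, cons (u := u) _ p => u :: p.support

end Walk

/-- The weights of the `h`-hop paths (at most `h` negative edges) that start at `r` and use `v`. -/
def outWeights (G : FrozenGraph n) (h : ℕ) (r v : Fin n) : Set ℝ :=
  {x | ∃ (t : Fin n) (p : G.Walk r t), v ∈ p.support ∧ p.hops ≤ h ∧ p.weight = x}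

/-- The weights of the `h`-hop paths that end at `r` and use `v`. -/
def inWeights (G : FrozenGraph n) (h : ℕ) (r v : Fin n) : Set ℝ :=
  {x | ∃ (s : Fin n) (p : G.Walk s r), v ∈ p.support ∧ p.hops ≤ h ∧ p.weight = x}

/-- The weights of the `h`-hop paths from `s` to `t`. -/
def pathWeights (G : FrozenGraph n) (h : ℕ) (s t : Fin n) : Set ℝ :=
  {x | ∃ p : G.Walk s t, p.hops ≤ h ∧ p.weight = x}

/-- The `h`-hop distance `d^h(s, t)` exists (is not `∞`) and equals `x`. -/
def IsHopDist (G : FrozenGraph n) (h : ℕ) (s t : Fin n) (x : ℝ) : Prop :=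
  IsLeast (G.pathWeights h s t) x

open Classical in
/-- The memory `s` contains the input `(G, h)`: `n` and `h` in cells `0` and `1` of the integer
array `0`; the adjacency matrix, row by row, in the integer array `1`
(`0`: no edge, `1`: edge that is not negative, `2`: negative edge); the weights of the edges, in the
same order, in the real array `0`. All other cells may hold anything. -/
def IsInput (G : FrozenGraph n) (h : ℕ) (s : RealRAM.Mem) : Prop :=
  s.nat 0 0 = n ∧ s.nat 0 1 = h ∧
  (∀ u v : Fin n, s.nat 1 (u.val * n + v.val) =
    if G.Neg u v then 2 else if G.Adj u v then 1 else 0) ∧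
  (∀ u v : Fin n, G.Adj u v → s.real 0 (u.val * n + v.val) = G.weight u v)

end FrozenGraph

/-- The integer array `a` of the memory `s` lists the set `A` without repetition: its size in
cell `0`, its elements in cells `1, …, |A|`. -/
def ListsSet {n : ℕ} (s : RealRAM.Mem) (a : ℕ) (A : Finset (Fin n)) : Prop :=
  s.nat a 0 = A.card ∧
  (Finset.range A.card).image (fun j => s.nat a (j + 1)) = A.image (fun v => v.val)

/-- The number `Δ` and the sets `Vout`, `Vin` are correct forward and backward searches
from `r` with hop bound `h`. -/
structure IsForwardBackward {n : ℕ} (G : FrozenGraph n) (h : ℕ) (r : Fin n)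
    (Δ : ℝ) (Vout Vin : Finset (Fin n)) : Prop where
  out_le : ∀ v ∈ Vout, ∃ x ∈ G.outWeights (h + 1) r v, x ≤ -Δ
  out_ge : ∀ v ∉ Vout, ∀ x ∈ G.outWeights (h + 1) r v, -Δ ≤ x
  in_le : ∀ v ∈ Vin, ∃ x ∈ G.inWeights h r v, x ≤ Δ
  in_ge : ∀ v ∉ Vin, ∀ x ∈ G.inWeights h r v, Δ ≤ x
  strict : (∀ v ∈ Vout, ∃ x ∈ G.outWeights (h + 1) r v, x < -Δ) ∨
    (∀ v ∈ Vin, ∃ x ∈ G.inWeights h r v, x < Δ)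
  card_out_le : Vout.card ≤ Vin.card + 1
  card_in_le : Vin.card ≤ Vout.card + 1

/-! ### A program logic for the real RAM -/

namespace RealRAM

/-! Both searches are the same search, run once in `G` with hop bound `H = h + 1` and once in
`G.rev` with `H = h`, since reversing walks preserves weight, hops and visited vertices
(`inWeights_eq_rev`). A state is a pair of a vertex `v` and a number `j ≤ H` of hops already used.
The preprocessing computes, for every state, the least weight `q` of a continuation by a walk with
at most `H - j` hops and arbitrary end. This takes one dense Dijkstra search per level over the
edges outside `F`, which have nonnegative weight, with one relaxation of the edges in `F` between
consecutive levels (`zeroClosure_negStep`, `run_levels`).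

The function `q` is a consistent potential: `q c ≤ w + q t` for every edge of weight `w` from state
`c` to state `t` (`LayerEdge.potential_le`). Hence best-first search by the value `D + q`, where `D`
is the label of a state, is Dijkstra's algorithm for nonnegative reduced weights, although weights
may be negative. Values of explored states never decrease, and the value of a state is the least
weight of an `H`-hop walk that extends the walk found to it. So vertices are discovered in the order
of the least weight of an `H`-hop walk from the root that uses them, every walk through an
undiscovered vertex weighs at least the next value (`SearchInv.outWeights_ge`), and all hop
distances below the next value are already known (`SearchInv.isHopDist`).

To make a query independent of the degrees, the preprocessing also sorts the edges out of every
state by `w + q t`, with a tournament tree. A query then keeps one pointer into the list of each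
explored state and moves it past explored targets. The entries passed are distinct explored states,
so a pointer never exceeds the number `k` of explored states, and exploring `k` states costs `O(k²)`
(`spent`, `SideInv.spent_le`). As `k ≤ |V| (H + 1)` for the set `V` of discovered vertices
(`SideInv.cnt_le`), this is the claimed query time. Marks are erased through the list of explored
states, so cleaning up is no more expensive.

A query lets the two searches add vertices alternately, forward first, as long as the last values of
the two sides have negative sum. When the next addition would break this, the last value of the
other side, up to sign, is a suitable `Δ`: last values bound the walks of discovered vertices, next
values bound all others, and one side is strict (`run_alternate`, `Balanced.isForwardBackward`). A
report reruns the level computation with the root as the only permitted end.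

All of this is carried out for concrete programs: `Run` is a total-correctness judgement with a
postcondition on the number of steps, and `Frame` provides that arrays a program does not write are
unchanged. -/

instance : Add NExp := ⟨NExp.add⟩
instance : Sub NExp := ⟨NExp.sub⟩
instance : Mul NExp := ⟨NExp.mul⟩
instance : Div NExp := ⟨NExp.div⟩
instance (k : ℕ) : OfNat NExp k := ⟨NExp.const k⟩
instance : Add RExp := ⟨RExp.add⟩
instance : Sub RExp := ⟨RExp.sub⟩
instance : Zero RExp := ⟨RExp.zero⟩

/-- The scalar integer variable stored in array `a`. -/
def NExp.var (a : ℕ) : NExp := NExp.get a 0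

/-- The scalar real variable stored in array `a`. -/
def RExp.var (a : ℕ) : RExp := RExp.get a 0

/-- The test `x < y`. -/
def BExp.natLT (x y : NExp) : BExp := BExp.natLE (x + 1) y

/-- The test `x < y`. -/
def BExp.realLT (x y : RExp) : BExp := BExp.neg (BExp.realLE y x)

/-- The test `x = y`. -/
def BExp.natEq (x y : NExp) : BExp := BExp.conj (BExp.natLE x y) (BExp.natLE y x)

/-- Disjunction of tests. -/
def BExp.disj (b c : BExp) : BExp := BExp.neg (BExp.conj (BExp.neg b) (BExp.neg c))

infixr:60 " ;; " => Prog.seq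

/-! ### Evaluation, cost and memory updates as rewriting rules. -/

section Eval

variable (s : Mem)

@[simp] theorem NExp.eval_ofNat (k : ℕ) :
    (ofNat(k) : NExp).eval s = ofNat(k) := rfl
@[simp] theorem NExp.eval_add (x y : NExp) : (x + y).eval s = x.eval s + y.eval s := rfl
@[simp] theorem NExp.eval_sub (x y : NExp) : (x - y).eval s = x.eval s - y.eval s := rfl
@[simp] theorem NExp.eval_mul (x y : NExp) : (x * y).eval s = x.eval s * y.eval s := rfl
@[simp] theorem NExp.eval_div (x y : NExp) : (x / y).eval s = x.eval s / y.eval s := rfl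
@[simp] theorem NExp.eval_get (a : ℕ) (i : NExp) :
    (NExp.get a i).eval s = s.nat a (i.eval s) := rfl
@[simp] theorem NExp.eval_var (a : ℕ) : (NExp.var a).eval s = s.nat a 0 := rfl
@[simp] theorem RExp.eval_zero : (0 : RExp).eval s = 0 := rfl
@[simp] theorem RExp.eval_add (x y : RExp) : (x + y).eval s = x.eval s + y.eval s := rfl
@[simp] theorem RExp.eval_sub (x y : RExp) : (x - y).eval s = x.eval s - y.eval s := rfl
@[simp] theorem RExp.eval_get (a : ℕ) (i : NExp) :
    (RExp.get a i).eval s = s.real a (i.eval s) := rfl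
@[simp] theorem RExp.eval_var (a : ℕ) : (RExp.var a).eval s = s.real a 0 := rfl
@[simp] theorem BExp.eval_natLE (x y : NExp) :
    (BExp.natLE x y).eval s ↔ x.eval s ≤ y.eval s := Iff.rfl
@[simp] theorem BExp.eval_natLT (x y : NExp) :
    (BExp.natLT x y).eval s ↔ x.eval s < y.eval s := Iff.rfl
@[simp] theorem BExp.eval_realLE (x y : RExp) :
    (BExp.realLE x y).eval s ↔ x.eval s ≤ y.eval s := Iff.rfl
@[simp] theorem BExp.eval_realLT (x y : RExp) :
    (BExp.realLT x y).eval s ↔ x.eval s < y.eval s := not_le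
@[simp] theorem BExp.eval_neg (b : BExp) : (BExp.neg b).eval s ↔ ¬ b.eval s := Iff.rfl
@[simp] theorem BExp.eval_conj (b c : BExp) :
    (BExp.conj b c).eval s ↔ b.eval s ∧ c.eval s := Iff.rfl
@[simp] theorem BExp.eval_natEq (x y : NExp) :
    (BExp.natEq x y).eval s ↔ x.eval s = y.eval s := le_antisymm_iff.symm
@[simp] theorem BExp.eval_disj (b c : BExp) :
    (BExp.disj b c).eval s ↔ b.eval s ∨ c.eval s := by
  simp only [BExp.disj, BExp.eval_neg, BExp.eval_conj]
  tauto

end Eval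

@[simp] theorem NExp.cost_ofNat (k : ℕ) : (ofNat(k) : NExp).cost = 1 := rfl
@[simp] theorem NExp.cost_add (x y : NExp) : (x + y).cost = x.cost + y.cost + 1 := rfl
@[simp] theorem NExp.cost_sub (x y : NExp) : (x - y).cost = x.cost + y.cost + 1 := rfl
@[simp] theorem NExp.cost_mul (x y : NExp) : (x * y).cost = x.cost + y.cost + 1 := rfl
@[simp] theorem NExp.cost_div (x y : NExp) : (x / y).cost = x.cost + y.cost + 1 := rfl
@[simp] theorem NExp.cost_get (a : ℕ) (i : NExp) : (NExp.get a i).cost = i.cost + 1 := rfl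
@[simp] theorem NExp.cost_var (a : ℕ) : (NExp.var a).cost = 2 := rfl
@[simp] theorem RExp.cost_zero : (0 : RExp).cost = 1 := rfl
@[simp] theorem RExp.cost_add (x y : RExp) : (x + y).cost = x.cost + y.cost + 1 := rfl
@[simp] theorem RExp.cost_sub (x y : RExp) : (x - y).cost = x.cost + y.cost + 1 := rfl
@[simp] theorem RExp.cost_get (a : ℕ) (i : NExp) : (RExp.get a i).cost = i.cost + 1 := rfl
@[simp] theorem RExp.cost_var (a : ℕ) : (RExp.var a).cost = 2 := rfl
@[simp] theorem BExp.cost_natLE (x y : NExp) :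
    (BExp.natLE x y).cost = x.cost + y.cost + 1 := rfl
@[simp] theorem BExp.cost_natLT (x y : NExp) :
    (BExp.natLT x y).cost = x.cost + 1 + 1 + y.cost + 1 := rfl
@[simp] theorem BExp.cost_realLE (x y : RExp) :
    (BExp.realLE x y).cost = x.cost + y.cost + 1 := rfl
@[simp] theorem BExp.cost_realLT (x y : RExp) :
    (BExp.realLT x y).cost = y.cost + x.cost + 1 + 1 := rfl
@[simp] theorem BExp.cost_neg (b : BExp) : (BExp.neg b).cost = b.cost + 1 := rfl
@[simp] theorem BExp.cost_conj (b c : BExp) :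
    (BExp.conj b c).cost = b.cost + c.cost + 1 := rfl

@[simp] theorem BExp.cost_natEq (x y : NExp) :
    (BExp.natEq x y).cost = x.cost + y.cost + 1 + (y.cost + x.cost + 1) + 1 := rfl
@[simp] theorem BExp.cost_disj (b c : BExp) :
    (BExp.disj b c).cost = b.cost + 1 + (c.cost + 1) + 1 + 1 := rfl

@[simp] theorem Mem.nat_setNat (s : Mem) (a i x b : ℕ) :
    (s.setNat a i x).nat b = if b = a then Function.update (s.nat a) i x else s.nat b := by
  by_cases h : b = a
  · subst h; simp [Mem.setNat]
  · simp [Mem.setNat, h]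

@[simp] theorem Mem.real_setNat (s : Mem) (a i x : ℕ) : (s.setNat a i x).real = s.real := rfl

@[simp] theorem Mem.real_setReal (s : Mem) (a i b : ℕ) (x : ℝ) :
    (s.setReal a i x).real b = if b = a then Function.update (s.real a) i x else s.real b := by
  by_cases h : b = a
  · subst h; simp [Mem.setReal]
  · simp [Mem.setReal, h]

@[simp] theorem Mem.nat_setReal (s : Mem) (a i : ℕ) (x : ℝ) : (s.setReal a i x).nat = s.nat := rfl

@[simp] theorem Mem.setNat_setNat (s : Mem) (a i x y : ℕ) :
    (s.setNat a i x).setNat a i y = s.setNat a i y := by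
  simp [Mem.setNat]

theorem Mem.setNat_self (s : Mem) (a i : ℕ) : s.setNat a i (s.nat a i) = s := by
  simp [Mem.setNat]

/-- The program `p` halts from `s`, with a number of steps and a final memory that satisfy `Q`. -/
def Run (W : ℕ) (p : Prog) (s : Mem) (Q : ℕ → Mem → Prop) : Prop :=
  ∃ t s', Exec W p s t s' ∧ Q t s'

/-! ### Rules of the program logic: composition, frames and loops. -/

theorem Run.mono {W : ℕ} {p : Prog} {s : Mem} {Q Q' : ℕ → Mem → Prop} (h : Run W p s Q)
    (hQ : ∀ t s', Q t s' → Q' t s') : Run W p s Q' := by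
  obtain ⟨t, s', he, hq⟩ := h
  exact ⟨t, s', he, hQ _ _ hq⟩

theorem Run.seq {W : ℕ} {p q : Prog} {s : Mem} {Q Q' : ℕ → Mem → Prop} (h : Run W p s Q)
    (hq : ∀ t s', Q t s' → Run W q s' (fun t' s'' => Q' (t + t') s'')) :
    Run W (p ;; q) s Q' := by
  obtain ⟨t, s', he, h1⟩ := h
  obtain ⟨t', s'', he', h2⟩ := hq _ _ h1
  exact ⟨_, _, he.seq he', h2⟩

@[simp] theorem run_skip {W : ℕ} {s : Mem} {Q : ℕ → Mem → Prop} :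
    Run W Prog.skip s Q ↔ Q 1 s := by
  constructor
  · rintro ⟨t, s', h, hq⟩; cases h; exact hq
  · exact fun h => ⟨_, _, Exec.skip s, h⟩

@[simp] theorem run_seq {W : ℕ} {p q : Prog} {s : Mem} {Q : ℕ → Mem → Prop} :
    Run W (p ;; q) s Q ↔ Run W p s (fun t s' => Run W q s' (fun t' s'' => Q (t + t') s'')) := by
  constructor
  · rintro ⟨t, s', h, hq⟩
    cases h with
    | seq h1 h2 => exact ⟨_, _, h1, _, _, h2, hq⟩
  · exact fun h => h.seq (fun _ _ h => h)

@[simp] theorem run_setNat {W a : ℕ} {i e : NExp} {s : Mem} {Q : ℕ → Mem → Prop} :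
    Run W (Prog.setNat a i e) s Q ↔ i.eval s ≤ W ∧ e.eval s ≤ W ∧
      Q (i.cost + e.cost + 1) (s.setNat a (i.eval s) (e.eval s)) := by
  constructor
  · rintro ⟨t, s', h, hq⟩; cases h; exact ⟨‹_›, ‹_›, hq⟩
  · exact fun h => ⟨_, _, Exec.setNat a i e s h.1 h.2.1, h.2.2⟩

@[simp] theorem run_setReal {W a : ℕ} {i : NExp} {e : RExp} {s : Mem} {Q : ℕ → Mem → Prop} :
    Run W (Prog.setReal a i e) s Q ↔ i.eval s ≤ W ∧
      Q (i.cost + e.cost + 1) (s.setReal a (i.eval s) (e.eval s)) := by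
  constructor
  · rintro ⟨t, s', h, hq⟩; cases h; exact ⟨‹_›, hq⟩
  · exact fun h => ⟨_, _, Exec.setReal a i e s h.1, h.2⟩

@[simp] theorem run_cond {W : ℕ} {b : BExp} {p q : Prog} {s : Mem} {Q : ℕ → Mem → Prop} :
    Run W (Prog.cond b p q) s Q ↔ (b.eval s → Run W p s (fun t s' => Q (b.cost + 1 + t) s')) ∧
      (¬ b.eval s → Run W q s (fun t s' => Q (b.cost + 1 + t) s')) := by
  constructor
  · rintro ⟨t, s', h, hq⟩
    cases h with
    | condTrue hb hp => exact ⟨fun _ => ⟨_, _, hp, hq⟩, fun h => absurd hb h⟩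
    | condFalse hb hp => exact ⟨fun h => absurd h hb, fun _ => ⟨_, _, hp, hq⟩⟩
  · intro h
    by_cases hb : b.eval s
    · obtain ⟨t, s', he, hq⟩ := h.1 hb
      exact ⟨_, _, Exec.condTrue hb he, hq⟩
    · obtain ⟨t, s', he, hq⟩ := h.2 hb
      exact ⟨_, _, Exec.condFalse hb he, hq⟩

/-- The integer arrays that a program may write to. -/
def Prog.natWrites : Prog → List ℕ
  | Prog.setNat a _ _ => [a]
  | Prog.seq p q => p.natWrites ++ q.natWrites
  | Prog.cond _ p q => p.natWrites ++ q.natWrites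
  | Prog.loop _ p => p.natWrites
  | _ => []

/-- The real arrays that a program may write to. -/
def Prog.realWrites : Prog → List ℕ
  | Prog.setReal a _ _ => [a]
  | Prog.seq p q => p.realWrites ++ q.realWrites
  | Prog.cond _ p q => p.realWrites ++ q.realWrites
  | Prog.loop _ p => p.realWrites
  | _ => []

/-- Two memories agree on all arrays to which `p` does not write. -/
structure Frame (p : Prog) (s s' : Mem) : Prop where
  nat : ∀ a, a ∉ p.natWrites → s'.nat a = s.nat a
  real : ∀ a, a ∉ p.realWrites → s'.real a = s.real a

theorem Frame.refl (p : Prog) (s : Mem) : Frame p s s := ⟨fun _ _ => rfl, fun _ _ => rfl⟩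

theorem Frame.trans {p : Prog} {s s' s'' : Mem} (h : Frame p s s') (h' : Frame p s' s'') :
    Frame p s s'' :=
  ⟨fun a ha => (h'.nat a ha).trans (h.nat a ha), fun a ha => (h'.real a ha).trans (h.real a ha)⟩

theorem Frame.weaken {p q : Prog} {s s' : Mem} (h : Frame p s s')
    (hn : p.natWrites ⊆ q.natWrites) (hr : p.realWrites ⊆ q.realWrites) : Frame q s s' :=
  ⟨fun a ha => h.nat a (fun h' => ha (hn h')), fun a ha => h.real a (fun h' => ha (hr h'))⟩

/-- The write sets are syntactic, so non-interference of two programs is settled by `simp` or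
`decide` on lists of array numbers. Specifications and loop invariants can thus be confined to the
arrays that change. -/
theorem Exec.frame {W : ℕ} {p : Prog} {s s' : Mem} {t : ℕ} (h : Exec W p s t s') :
    Frame p s s' := by
  induction h with
  | skip s => exact Frame.refl _ s
  | setNat a i e s hi he =>
    constructor
    · intro b hb
      have : b ≠ a := by simpa [Prog.natWrites] using hb
      simp [this]
    · intro b _; rfl
  | setReal a i e s hi =>
    constructor
    · intro b _; rfl
    · intro b hb
      have : b ≠ a := by simpa [Prog.realWrites] using hb
      simp [this]
  | seq hp hq ih1 ih2 =>
    exact (ih1.weaken (by simp [Prog.natWrites]) (by simp [Prog.realWrites])).trans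
      (ih2.weaken (by simp [Prog.natWrites]) (by simp [Prog.realWrites]))
  | condTrue hb hp ih => exact ih.weaken (by simp [Prog.natWrites]) (by simp [Prog.realWrites])
  | condFalse hb hp ih => exact ih.weaken (by simp [Prog.natWrites]) (by simp [Prog.realWrites])
  | loopStop hb => exact Frame.refl _ _
  | loopStep hb hp hl ih1 ih2 =>
    exact (ih1.weaken (by simp [Prog.natWrites]) (by simp [Prog.realWrites])).trans ih2

theorem Run.frame {W : ℕ} {p : Prog} {s : Mem} {Q : ℕ → Mem → Prop} (h : Run W p s Q) :
    Run W p s (fun t s' => Q t s' ∧ Frame p s s') := by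
  obtain ⟨t, s', he, hq⟩ := h
  exact ⟨t, s', he, hq, he.frame⟩

/-- Loop rule: `I τ s` is the invariant after `τ` steps, and `m` is the variant. -/
theorem run_loop {W : ℕ} {b : BExp} {p : Prog} {s₀ : Mem} (I : ℕ → Mem → Prop) (m : Mem → ℕ)
    (h0 : I 0 s₀)
    (step : ∀ τ s, I τ s → Frame p s₀ s → b.eval s →
      Run W p s (fun t s' => I (τ + (b.cost + 1 + t)) s' ∧ m s' < m s)) :
    Run W (Prog.loop b p) s₀
      (fun t s' => ∃ τ, I τ s' ∧ ¬ b.eval s' ∧ t = τ + (b.cost + 1)) := by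
  -- Generalizing over the start of the remaining iterations, with `τ` steps already spent, allows
  -- induction on a bound `N` of the variant.
  suffices H : ∀ (N : ℕ) (τ : ℕ) (s : Mem), m s ≤ N → I τ s → Frame p s₀ s →
      Run W (Prog.loop b p) s
        (fun t s' => ∃ τ', I τ' s' ∧ ¬ b.eval s' ∧ τ + t = τ' + (b.cost + 1)) by
    refine (H _ 0 s₀ le_rfl h0 (Frame.refl _ _)).mono ?_
    rintro t s' ⟨τ', h1, h2, h3⟩
    exact ⟨τ', h1, h2, by omega⟩
  intro N
  induction N with
  | zero =>
    intro τ s hm hI hF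
    by_cases hb : b.eval s
    · obtain ⟨t, s', he, hI', hlt⟩ := step τ s hI hF hb
      omega
    · exact ⟨_, _, Exec.loopStop hb, τ, hI, hb, rfl⟩
  | succ N ih =>
    intro τ s hm hI hF
    by_cases hb : b.eval s
    · obtain ⟨t, s', he, hI', hlt⟩ := step τ s hI hF hb
      obtain ⟨t', s'', he', τ', h1, h2, h3⟩ := ih _ s' (by omega) hI' (hF.trans he.frame)
      exact ⟨_, _, Exec.loopStep hb he he', τ', h1, h2, by omega⟩
    · exact ⟨_, _, Exec.loopStop hb, τ, hI, hb, rfl⟩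

/-- `for i = 0, …, m - 1 do body`, with the counter `i` in array `i`. -/
def forN (i : ℕ) (m : NExp) (body : Prog) : Prog :=
  Prog.setNat i 0 0 ;;
    Prog.loop (BExp.natLT (NExp.var i) m) (body ;; Prog.setNat i 0 (NExp.var i + 1))

@[simp] theorem natWrites_forN (i : ℕ) (m : NExp) (body : Prog) :
    (forN i m body).natWrites = i :: (body.natWrites ++ [i]) := rfl

@[simp] theorem realWrites_forN (i : ℕ) (m : NExp) (body : Prog) :
    (forN i m body).realWrites = body.realWrites ++ [] := rfl

/-- Rule for counting loops, with an invariant that records the number of steps. -/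
theorem run_forN {W N i : ℕ} {m : NExp} {body : Prog} {s₀ : Mem} (I : ℕ → ℕ → Mem → Prop)
    (hN : N ≤ W) (hm : ∀ s, Frame (forN i m body) s₀ s → m.eval s = N)
    (hi : i ∉ body.natWrites) (h0 : I 0 0 (s₀.setNat i 0 0))
    (step : ∀ k τ s, k < N → I k τ s → s.nat i 0 = k → Frame (forN i m body) s₀ s →
      Run W body s (fun t s' => I (k + 1) (τ + (t + (m.cost + 12))) (s'.setNat i 0 (k + 1)))) :
    Run W (forN i m body) s₀
      (fun t s' => ∃ τ, I N τ s' ∧ s'.nat i 0 = N ∧ t = τ + (m.cost + 9)) := by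
  have hF0 : Frame (forN i m body) s₀ (s₀.setNat i 0 0) := by
    constructor
    · intro a ha
      have : a ≠ i := by
        rintro rfl; simp at ha
      simp [this]
    · intro a _; rfl
  unfold forN
  rw [run_seq, run_setNat]
  refine ⟨by simp, by simp, ?_⟩
  refine (run_loop (fun τ s => ∃ k ≤ N, I k τ s ∧ s.nat i 0 = k) (fun s => N - s.nat i 0)
    ⟨0, Nat.zero_le _, h0, by simp⟩ ?_).frame.mono ?_
  · rintro τ s ⟨k, hk, hI, hs⟩ hF hb
    have hF' : Frame (forN i m body) s₀ s :=
      hF0.trans (hF.weaken (by simp [Prog.natWrites, forN]) (by simp [Prog.realWrites, forN]))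
    have hkN : k < N := by
      have := hm s hF'
      simpa [this, hs] using hb
    refine (step k τ s hkN hI hs hF').frame.seq ?_
    rintro t s' ⟨hI', hf⟩
    have hk' : s'.nat i 0 = k := by rw [hf.nat i hi, hs]
    simp only [run_setNat, NExp.eval_ofNat, NExp.eval_add, NExp.eval_var, hk', Nat.zero_le,
      true_and]
    refine ⟨by omega, ⟨k + 1, hkN, ?_, by simp⟩, ?_⟩
    -- Overhead of one round: `m.cost + 5` for the guard, `1` for the loop step and `6` for
    -- incrementing the counter.
    · convert hI' using 1
      simp only [BExp.cost_natLT, NExp.cost_var, NExp.cost_ofNat, NExp.cost_add]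
      omega
    · simp [hs]; omega
  · rintro t s' ⟨⟨τ, ⟨k, hk, hI, hs⟩, hb, ht⟩, hF⟩
    have hF' : Frame (forN i m body) s₀ s' :=
      hF0.trans (hF.weaken (by simp [Prog.natWrites, forN]) (by simp [Prog.realWrites, forN]))
    have hkN : k = N := by
      have := hm s' hF'
      simp only [BExp.eval_natLT, NExp.eval_var, hs, this, not_lt] at hb
      omega
    subst hkN
    refine ⟨τ, hI, hs, ?_⟩
    simp only [BExp.cost_natLT, NExp.cost_var, NExp.cost_ofNat] at ht ⊢
    omega

/-- Rule for counting loops in which every round takes at most `T` steps. -/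
theorem run_forN_const {W N T i : ℕ} {m : NExp} {body : Prog} {s₀ : Mem} (I : ℕ → Mem → Prop)
    (hN : N ≤ W) (hm : ∀ s, Frame (forN i m body) s₀ s → m.eval s = N)
    (hi : i ∉ body.natWrites) (h0 : I 0 (s₀.setNat i 0 0))
    (step : ∀ k s, k < N → I k s → s.nat i 0 = k → Frame (forN i m body) s₀ s →
      Run W body s (fun t s' => t ≤ T ∧ I (k + 1) (s'.setNat i 0 (k + 1)))) :
    Run W (forN i m body) s₀
      (fun t s' => I N s' ∧ t ≤ N * (T + (m.cost + 12)) + (m.cost + 9)) := by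
  refine (run_forN (fun k τ s => I k s ∧ τ ≤ k * (T + (m.cost + 12))) hN hm hi ⟨h0, by simp⟩
    ?_).mono ?_
  · rintro k τ s hk ⟨hI, hτ⟩ hs hF
    refine (step k s hk hI hs hF).mono ?_
    rintro t s' ⟨ht, hI'⟩
    refine ⟨hI', ?_⟩
    rw [add_mul, one_mul]
    omega
  · rintro t s' ⟨τ, ⟨hI, hτ⟩, -, ht⟩
    exact ⟨hI, by omega⟩

end RealRAM

/-! ### Walks, hop-bounded distances and the invariant of Dijkstra's algorithm -/

namespace FrozenGraph

variable {n : ℕ}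

/-- The graph with all edges reversed. -/
def rev (G : FrozenGraph n) : FrozenGraph n where
  Adj u v := G.Adj v u
  weight u v := G.weight v u
  Neg u v := G.Neg v u
  adj_of_neg u v := G.adj_of_neg v u
  neg_of_weight_neg u v := G.neg_of_weight_neg v u

theorem weight_nonneg (G : FrozenGraph n) {u v : Fin n} (e : G.Adj u v) (h : ¬ G.Neg u v) :
    0 ≤ G.weight u v :=
  not_lt.mp fun h' => h (G.neg_of_weight_neg u v e h')

/-! ### Concatenation and reversal of walks. -/

namespace Walk

variable {G : FrozenGraph n}

/-- Concatenation of walks. -/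
def append : {u v w : Fin n} → G.Walk u v → G.Walk v w → G.Walk u w
  | _, _, _, nil _, q => q
  | _, _, _, cons e p, q => cons e (p.append q)

@[simp] theorem weight_append {u v w : Fin n} (p : G.Walk u v) (q : G.Walk v w) :
    (p.append q).weight = p.weight + q.weight := by
  induction p with
  | nil u => simp [append, weight]
  | cons e p ih => simp [append, weight, ih, add_assoc]

@[simp] theorem hops_append {u v w : Fin n} (p : G.Walk u v) (q : G.Walk v w) :
    (p.append q).hops = p.hops + q.hops := by
  induction p with
  | nil u => simp [append, hops]
  | cons e p ih => simp [append, hops, ih, add_assoc]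

theorem start_mem_support {u v : Fin n} (p : G.Walk u v) : u ∈ p.support := by
  cases p <;> simp [support]

theorem end_mem_support {u v : Fin n} (p : G.Walk u v) : v ∈ p.support := by
  induction p with
  | nil u => simp [support]
  | cons e p ih => simp [support, ih]

@[simp] theorem mem_support_append {u v w x : Fin n} (p : G.Walk u v) (q : G.Walk v w) :
    x ∈ (p.append q).support ↔ x ∈ p.support ∨ x ∈ q.support := by
  induction p with
  | nil u =>
    simp only [append, support, List.mem_singleton]
    constructor
    · exact Or.inr
    · rintro (rfl | h)
      · exact q.start_mem_support
      · exact h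
  | cons e p ih => simp [append, support, ih, or_assoc]

/-- The reversed walk. -/
def reverse : {u v : Fin n} → G.Walk u v → G.rev.Walk v u
  | _, _, nil u => nil u
  | u, _, cons (v := v) e p => p.reverse.append (cons (G := G.rev) (u := v) (v := u) e (nil u))

@[simp] theorem weight_reverse {u v : Fin n} (p : G.Walk u v) : p.reverse.weight = p.weight := by
  induction p with
  | nil u => rfl
  | @cons u v w e p ih =>
    rw [reverse, weight_append, ih]
    change p.weight + (G.weight u v + 0) = G.weight u v + p.weight
    ring

open Classical in
@[simp] theorem hops_reverse {u v : Fin n} (p : G.Walk u v) : p.reverse.hops = p.hops := by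
  induction p with
  | nil u => rfl
  | @cons u v w e p ih =>
    rw [reverse, hops_append, ih]
    change p.hops + ((if G.Neg u v then 1 else 0) + 0) = (if G.Neg u v then 1 else 0) + p.hops
    ring

@[simp] theorem mem_support_reverse {u v x : Fin n} (p : G.Walk u v) :
    x ∈ p.reverse.support ↔ x ∈ p.support := by
  induction p with
  | nil u => rfl
  | cons e p ih =>
    simp only [reverse, mem_support_append, ih, support, List.mem_cons, List.not_mem_nil, or_false]
    constructor
    · rintro (h | rfl | rfl)
      · exact Or.inr h
      · exact Or.inr p.start_mem_support
      · exact Or.inl rfl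
    · rintro (rfl | h)
      · exact Or.inr (Or.inr rfl)
      · exact Or.inl h

end Walk

/-- Reversal of walks turns the backward search into a forward search in `G.rev`, so that one
program serves both directions. -/
theorem inWeights_eq_rev (G : FrozenGraph n) (h : ℕ) (r v : Fin n) :
    G.inWeights h r v = G.rev.outWeights h r v := by
  ext x
  constructor
  · rintro ⟨s, p, h1, h2, h3⟩
    exact ⟨s, p.reverse, p.mem_support_reverse.mpr h1, p.hops_reverse.trans_le h2,
      p.weight_reverse.trans h3⟩
  · rintro ⟨s, p, h1, h2, h3⟩
    exact ⟨s, p.reverse, p.mem_support_reverse.mpr h1, p.hops_reverse.trans_le h2,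
      p.weight_reverse.trans h3⟩

theorem pathWeights_rev (G : FrozenGraph n) (h : ℕ) (s t : Fin n) :
    G.rev.pathWeights h t s = G.pathWeights h s t := by
  ext x
  constructor
  · rintro ⟨p, h2, h3⟩
    exact ⟨p.reverse, p.hops_reverse.trans_le h2, p.weight_reverse.trans h3⟩
  · rintro ⟨p, h2, h3⟩
    exact ⟨p.reverse, p.hops_reverse.trans_le h2, p.weight_reverse.trans h3⟩

/-- The weights of the `k`-hop walks that start at `v` and end in `T`. -/
def termWeights (X : FrozenGraph n) (T : Fin n → Prop) (k : ℕ) (v : Fin n) : Set ℝ :=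
  {x | ∃ t, T t ∧ ∃ p : X.Walk v t, p.hops ≤ k ∧ p.weight = x}

/-- The weights of zero-hop walks from `v`, each increased by a label of its end. -/
def zeroClosure (X : FrozenGraph n) (B : Fin n → Set ℝ) (v : Fin n) : Set ℝ :=
  {x | ∃ u, ∃ p : X.Walk v u, p.hops = 0 ∧ ∃ b ∈ B u, p.weight + b = x}

/-- Labels after at most one negative edge. -/
def negStep (X : FrozenGraph n) (S : Fin n → Set ℝ) (v : Fin n) : Set ℝ :=
  S v ∪ {x | ∃ u, X.Neg v u ∧ ∃ y ∈ S u, X.weight v u + y = x}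

theorem termWeights_all_nonempty (X : FrozenGraph n) (k : ℕ) (v : Fin n) :
    (X.termWeights (fun _ => True) k v).Nonempty :=
  ⟨0, v, trivial, Walk.nil v, by simp [Walk.hops], rfl⟩

theorem termWeights_eq (X : FrozenGraph n) (r : Fin n) (k : ℕ) (v : Fin n) :
    X.termWeights (fun t => t = r) k v = X.pathWeights k v r := by
  ext x
  simp [termWeights, pathWeights]

theorem zeroClosure_indicator (X : FrozenGraph n) (T : Fin n → Prop) (v : Fin n) :
    X.zeroClosure (fun v => {x | T v ∧ x = 0}) v = X.termWeights T 0 v := by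
  ext x
  constructor
  · rintro ⟨u, p, hp, b, ⟨hT, rfl⟩, rfl⟩
    exact ⟨u, hT, p, hp.le, by simp⟩
  · rintro ⟨u, hT, p, hp, rfl⟩
    exact ⟨u, p, by omega, 0, ⟨hT, rfl⟩, by simp⟩

/-- Cut a walk at its first negative edge: the part before it has no hop and the part after it has
one hop less. This is the recursion from one level to the next. -/
theorem zeroClosure_negStep (X : FrozenGraph n) (T : Fin n → Prop) (k : ℕ) (v : Fin n) :
    X.zeroClosure (X.negStep (X.termWeights T k)) v = X.termWeights T (k + 1) v := by
  ext x
  constructor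
  · rintro ⟨u, p, hp, b, hb, rfl⟩
    rcases hb with ⟨t, hT, q, hq, rfl⟩ | ⟨u', hN, y, ⟨t, hT, q, hq, rfl⟩, rfl⟩
    · exact ⟨t, hT, p.append q, by simp; omega, by simp⟩
    · refine ⟨t, hT, p.append (Walk.cons (X.adj_of_neg _ _ hN) q), ?_, by simp [Walk.weight]⟩
      simp [Walk.hops, hN]
      omega
  · rintro ⟨t, hT, p, hp, rfl⟩
    induction p with
    | nil u =>
      exact ⟨u, Walk.nil u, rfl, 0, Or.inl ⟨u, hT, Walk.nil u, by simp [Walk.hops], rfl⟩,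
        by simp [Walk.weight]⟩
    | @cons u v w e p ih =>
      by_cases hN : X.Neg u v
      · refine ⟨u, Walk.nil u, rfl, _, Or.inr ⟨v, hN, _, ⟨w, hT, p, ?_, rfl⟩, rfl⟩,
          by simp [Walk.weight]⟩
        simp [Walk.hops, hN] at hp
        omega
      · obtain ⟨u', p', hp', b, hb, h⟩ := ih hT (by simpa [Walk.hops, hN] using hp)
        exact ⟨u', Walk.cons e p', by simp [Walk.hops, hN, hp'], b, hb,
          by simp [Walk.weight, ← h, add_assoc]⟩

/-- The label `(st, d)` represents the least element of `S`, if there is one; `st = 0` says that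
`S` is empty. -/
structure IsLab (S : Set ℝ) (st : ℕ) (d : ℝ) : Prop where
  least : st ≠ 0 → IsLeast S d
  empty : st = 0 → S = ∅

theorem IsLab.congr {S S' : Set ℝ} {st : ℕ} {d : ℝ} (h : IsLab S st d) (hS : S' = S) :
    IsLab S' st d := hS ▸ h

/-- Update of a label by the labels `w + y`, where the set of all `y` has least element `d'`. -/
theorem IsLab.insert {A S : Set ℝ} {st st' : ℕ} {d d' w : ℝ} (h : IsLab A st d)
    (h' : IsLab S st' d') (h0 : st' ≠ 0) (hlt : st = 0 ∨ w + d' < d) :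
    IsLab (A ∪ {x | ∃ y ∈ S, w + y = x}) 1 (w + d') := by
  obtain ⟨hm, hl⟩ := h'.least h0
  refine ⟨fun _ => ⟨Or.inr ⟨d', hm, rfl⟩, ?_⟩, fun h => absurd h one_ne_zero⟩
  rintro x (hx | ⟨y, hy, rfl⟩)
  · rcases hlt with h1 | h1
    · rw [h.empty h1] at hx
      exact absurd hx (Set.notMem_empty x)
    · have h2 : st ≠ 0 := by
        intro h2
        rw [h.empty h2] at hx
        exact hx
      exact h1.le.trans ((h.least h2).2 hx)
  · have := hl hy
    linarith

theorem IsLab.insert_of_le {A S : Set ℝ} {st st' : ℕ} {d d' w : ℝ} (h : IsLab A st d)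
    (h' : IsLab S st' d') (hle : st' ≠ 0 → st ≠ 0 ∧ d ≤ w + d') :
    IsLab (A ∪ {x | ∃ y ∈ S, w + y = x}) st d := by
  constructor
  · intro h0
    refine ⟨Or.inl (h.least h0).1, ?_⟩
    rintro x (hx | ⟨y, hy, rfl⟩)
    · exact (h.least h0).2 hx
    · have h2 : st' ≠ 0 := by
        intro h2
        rw [h'.empty h2] at hy
        exact hy
      have := (h'.least h2).2 hy
      linarith [(hle h2).2]
  · intro h0
    have h2 : st' = 0 := by
      by_contra h2
      exact (hle h2).1 h0
    rw [h.empty h0, h'.empty h2]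
    simp

/-- The invariant of Dijkstra's algorithm over the edges that are not negative, with initial
labels `B`. The status of a vertex is `0` (no label), `1` (labelled) or `2` (final). -/
structure DijkstraInv (X : FrozenGraph n) (B : Fin n → Set ℝ) (st : Fin n → ℕ) (d : Fin n → ℝ) :
    Prop where
  sound : ∀ v, st v ≠ 0 → d v ∈ X.zeroClosure B v
  dom : ∀ v, ∀ b ∈ B v, st v ≠ 0 ∧ d v ≤ b
  relaxed : ∀ u v, st u = 2 → X.Adj v u → ¬ X.Neg v u → st v ≠ 0 ∧ d v ≤ X.weight v u + d u
  order : ∀ u v, st u = 2 → st v = 1 → d u ≤ d v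
  le_two : ∀ v, st v ≤ 2

theorem DijkstraInv.init {X : FrozenGraph n} {B : Fin n → Set ℝ} {st : Fin n → ℕ} {d : Fin n → ℝ}
    (h : ∀ v, IsLab (B v) (st v) (d v)) (h2 : ∀ v, st v ≤ 1) : X.DijkstraInv B st d where
  sound v hv := ⟨v, Walk.nil v, rfl, d v, ((h v).least hv).1, by simp [Walk.weight]⟩
  dom v b hb := by
    have h0 : st v ≠ 0 := by
      intro h0
      rw [(h v).empty h0] at hb
      exact hb
    exact ⟨h0, ((h v).least h0).2 hb⟩
  relaxed u v hu := by have := h2 u; omega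
  order u v hu := by have := h2 u; omega
  le_two v := (h2 v).trans (by norm_num)

/-- When no vertex is merely labelled, `relaxed` applies to every edge of a zero-hop walk. Induction
from the end of the walk then bounds the label of its start, and `sound` shows that the bound is
attained. -/
theorem DijkstraInv.final {X : FrozenGraph n} {B : Fin n → Set ℝ} {st : Fin n → ℕ}
    {d : Fin n → ℝ} (h : X.DijkstraInv B st d) (hst : ∀ v, st v = 0 ∨ st v = 2) (v : Fin n) :
    IsLab (X.zeroClosure B v) (st v) (d v) := by
  have key : ∀ x ∈ X.zeroClosure B v, st v ≠ 0 ∧ d v ≤ x := by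
    rintro x ⟨u, p, hp, b, hb, rfl⟩
    induction p with
    | nil u => simpa [Walk.weight] using h.dom u b hb
    | @cons u v w e p ih =>
      have hN : ¬ X.Neg u v := by
        intro hN; simp [Walk.hops, hN] at hp
      obtain ⟨h0, hle⟩ := ih (by simpa [Walk.hops, hN] using hp) hb
      obtain ⟨h0', hle'⟩ := h.relaxed v u ((hst v).resolve_left h0) e hN
      refine ⟨h0', ?_⟩
      simp only [Walk.weight]
      linarith
  refine ⟨fun h0 => ⟨h.sound v h0, fun x hx => (key x hx).2⟩, fun h0 => ?_⟩
  rw [Set.eq_empty_iff_forall_notMem]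
  exact fun x hx => (key x hx).1 h0

/-- The vertex `v` gets a new label when `u` becomes final. -/
def Improves (X : FrozenGraph n) (st : Fin n → ℕ) (d : Fin n → ℝ) (u v : Fin n) : Prop :=
  (X.Adj v u ∧ ¬ X.Neg v u) ∧ (st v = 0 ∨ (st v = 1 ∧ X.weight v u + d u < d v))

/-- Edges outside the negative set have nonnegative weight, so every label created while `u` becomes
final is at least `d u`, the least label among the labelled vertices. Final labels therefore stay
below labelled ones and never need correction. -/
theorem DijkstraInv.step {X : FrozenGraph n} {B : Fin n → Set ℝ} {st st' : Fin n → ℕ}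
    {d d' : Fin n → ℝ} (h : X.DijkstraInv B st d) {u : Fin n} (hu : st u = 1)
    (hmin : ∀ v, st v = 1 → d u ≤ d v) (hu' : st' u = 2) (hdu : d' u = d u)
    (hpos : ∀ v, v ≠ u → X.Improves st d u v → st' v = 1 ∧ d' v = X.weight v u + d u)
    (hneg : ∀ v, v ≠ u → ¬ X.Improves st d u v → st' v = st v ∧ d' v = d v) :
    X.DijkstraInv B st' d' := by
  have hle : ∀ v, st v ≠ 0 → st' v ≠ 0 ∧ d' v ≤ d v := by
    intro v hv
    by_cases hvu : v = u
    · subst hvu; exact ⟨by omega, hdu.le⟩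
    by_cases hi : X.Improves st d u v
    · obtain ⟨h1, h2⟩ := hpos v hvu hi
      rcases hi.2 with h3 | h3
      · exact absurd h3 hv
      · exact ⟨by omega, by rw [h2]; exact h3.2.le⟩
    · obtain ⟨h1, h2⟩ := hneg v hvu hi
      exact ⟨by omega, h2.le⟩
  have hd2 : ∀ v, st' v = 2 → (v = u ∨ st v = 2) ∧ d' v = d v := by
    intro v hv
    by_cases hvu : v = u
    · subst hvu; exact ⟨Or.inl rfl, hdu⟩
    by_cases hi : X.Improves st d u v
    · have := hpos v hvu hi; omega
    · obtain ⟨h1, h2⟩ := hneg v hvu hi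
      exact ⟨Or.inr (by omega), h2⟩
  have hule : ∀ v, v ≠ u → st' v = 1 → d u ≤ d' v := by
    intro v hvu hv
    by_cases hi : X.Improves st d u v
    · obtain ⟨h1, h2⟩ := hpos v hvu hi
      have := X.weight_nonneg hi.1.1 hi.1.2
      linarith
    · obtain ⟨h1, h2⟩ := hneg v hvu hi
      rw [h2]
      exact hmin v (by omega)
  constructor
  · intro v hv
    by_cases hvu : v = u
    · subst hvu; rw [hdu]; exact h.sound v (by omega)
    by_cases hi : X.Improves st d u v
    · obtain ⟨h1, h2⟩ := hpos v hvu hi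
      obtain ⟨x, p, hp, b, hb, hx⟩ := h.sound u (by omega)
      exact ⟨x, Walk.cons hi.1.1 p, by simp [Walk.hops, hi.1.2, hp], b, hb,
        by rw [h2]; simp only [Walk.weight]; linarith⟩
    · obtain ⟨h1, h2⟩ := hneg v hvu hi
      rw [h2]; exact h.sound v (by omega)
  · intro v b hb
    obtain ⟨h1, h2⟩ := h.dom v b hb
    obtain ⟨h3, h4⟩ := hle v h1
    exact ⟨h3, h4.trans h2⟩
  · intro x v hx hA hN
    obtain ⟨h1, h2⟩ := hd2 x hx
    rw [h2]
    rcases h1 with rfl | h1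
    · have hw := X.weight_nonneg hA hN
      by_cases hvu : v = x
      · subst hvu; exact ⟨by omega, by linarith⟩
      by_cases hi : X.Improves st d x v
      · obtain ⟨h1, h2⟩ := hpos v hvu hi
        exact ⟨by omega, h2.le⟩
      · obtain ⟨h3, h4⟩ := hneg v hvu hi
        have hi' : ¬ (st v = 0 ∨ (st v = 1 ∧ X.weight v x + d x < d v)) :=
          fun h' => hi ⟨⟨hA, hN⟩, h'⟩
        push Not at hi'
        refine ⟨by omega, ?_⟩
        rw [h4]
        by_cases h1 : st v = 1
        · exact hi'.2 h1
        -- Here `v` is already final: its label is at most that of the labelled vertex `x`, and the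
        -- edge has nonnegative weight.
        · have h5 := h.order v x (by have := h.le_two v; omega) hu
          linarith
    · obtain ⟨h3, h4⟩ := h.relaxed x v h1 hA hN
      obtain ⟨h5, h6⟩ := hle v h3
      exact ⟨h5, h6.trans h4⟩
  · intro x v hx hv
    obtain ⟨h1, h2⟩ := hd2 x hx
    rw [h2]
    have hvu : v ≠ u := by rintro rfl; omega
    have h3 := hule v hvu hv
    rcases h1 with rfl | h1
    · exact h3
    · exact (h.order x u h1 hu).trans h3
  · intro v
    by_cases hvu : v = u
    · subst hvu; omega
    by_cases hi : X.Improves st d u v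
    · have := hpos v hvu hi; omega
    · have := hneg v hvu hi
      have := h.le_two v
      omega

end FrozenGraph

/-! ### Best-first search in the layered graph -/

namespace FrozenGraph

variable {n : ℕ}

theorem code_div {n : ℕ} (j : ℕ) (v : Fin n) : (j * n + v.val) / n = j := by
  have := v.isLt
  rw [mul_comm, Nat.mul_add_div (by omega), Nat.div_eq_of_lt this, add_zero]

theorem code_mod {n : ℕ} (j : ℕ) (v : Fin n) : (j * n + v.val) % n = v.val := by
  rw [mul_comm, Nat.mul_add_mod, Nat.mod_eq_of_lt v.isLt]

theorem code_lt {n : ℕ} {j H : ℕ} (hj : j ≤ H) (v : Fin n) : j * n + v.val < (H + 1) * n := by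
  have h1 : j * n ≤ H * n := Nat.mul_le_mul_right _ hj
  have h2 := v.isLt
  rw [add_mul, one_mul]
  omega

open Classical in
/-- The edges of the layered graph with layers `0, …, H`; the state of the vertex `v` after `j`
negative edges has the code `j * n + v`. -/
def LayerEdge (X : FrozenGraph n) (H c t : ℕ) (w : ℝ) : Prop :=
  ∃ (u v : Fin n) (j : ℕ), X.Adj u v ∧ c = j * n + u.val ∧
    t = (j + if X.Neg u v then 1 else 0) * n + v.val ∧
    (j + if X.Neg u v then 1 else 0) ≤ H ∧ w = X.weight u v

/-- Some walk from `r` leads to the state `c` and has weight `x`. -/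
def Reaches (X : FrozenGraph n) (r : Fin n) (c : ℕ) (x : ℝ) : Prop :=
  ∃ (v : Fin n) (p : X.Walk r v), c = p.hops * n + v.val ∧ p.weight = x

/-- The least weight of a continuation from each state. -/
def IsPotential (X : FrozenGraph n) (H : ℕ) (q : ℕ → ℝ) : Prop :=
  ∀ j ≤ H, ∀ v : Fin n, IsLeast (X.termWeights (fun _ => True) (H - j) v) (q (j * n + v.val))

/-- Prefixing the edge to an optimal continuation from `t` gives a continuation from `c`. This
consistency makes the reduced weights `w + q t - q c` nonnegative. -/
theorem LayerEdge.potential_le {X : FrozenGraph n} {H c t : ℕ} {w : ℝ} {q : ℕ → ℝ}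
    (hq : X.IsPotential H q) (h : X.LayerEdge H c t w) : q c ≤ w + q t := by
  obtain ⟨u, v, j, hA, rfl, rfl, hj, rfl⟩ := h
  obtain ⟨⟨z, -, p, hp, hw⟩, -⟩ := hq _ hj v
  refine (hq j (by omega) u).2 ⟨z, trivial, Walk.cons hA p, ?_, ?_⟩
  · simp only [Walk.hops]; omega
  · simp [Walk.weight, hw]

theorem Reaches.step {X : FrozenGraph n} {H c t : ℕ} {r : Fin n} {w x : ℝ}
    (h : X.Reaches r c x) (he : X.LayerEdge H c t w) : X.Reaches r t (x + w) := by
  obtain ⟨u, v, j, hA, hc, rfl, hj, rfl⟩ := he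
  obtain ⟨u', p, hc', rfl⟩ := h
  obtain rfl : u' = u := by
    have := code_mod j u
    rw [← hc, hc', code_mod] at this
    exact Fin.ext this
  obtain rfl : p.hops = j := by
    have := code_div j u'
    rwa [← hc, hc', code_div] at this
  refine ⟨v, p.append (Walk.cons hA (Walk.nil v)), ?_, by simp [Walk.weight]⟩
  simp [Walk.hops]

/-- The invariant of the search: the states `sc 0, …, sc (cnt - 1)` are explored, with
labels `D`. -/
structure SearchInv (X : FrozenGraph n) (H : ℕ) (r : Fin n) (q : ℕ → ℝ) (cnt : ℕ) (sc : ℕ → ℕ)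
    (D : ℕ → ℝ) : Prop where
  lt : ∀ i < cnt, sc i < (H + 1) * n
  reaches : ∀ i < cnt, X.Reaches r (sc i) (D i)
  inj : ∀ i < cnt, ∀ k < cnt, sc i = sc k → i = k
  root : 0 < cnt → sc 0 = r.val ∧ D 0 = 0
  relaxed : ∀ i < cnt, ∀ k < cnt, ∀ w, X.LayerEdge H (sc i) (sc k) w → D k ≤ D i + w
  order : ∀ i < cnt, ∀ t w, X.LayerEdge H (sc i) t w → (∀ k < cnt, sc k ≠ t) →
    ∀ k < cnt, D k + q (sc k) ≤ D i + (w + q t)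

/-- The state `best` with label `bD` and value `bf` is the next one to be explored; there is none
if `best` is not smaller than the number of states. -/
structure NextInv (X : FrozenGraph n) (H : ℕ) (r : Fin n) (q : ℕ → ℝ) (cnt : ℕ) (sc : ℕ → ℕ)
    (D : ℕ → ℝ) (best : ℕ) (bf bD : ℝ) : Prop where
  start : cnt = 0 → best = r.val ∧ bD = 0
  reaches : best < (H + 1) * n → X.Reaches r best bD
  value : best < (H + 1) * n → bf = bD + q best
  fresh : best < (H + 1) * n → ∀ k < cnt, sc k ≠ best
  ge : best < (H + 1) * n → ∀ k < cnt, D k + q (sc k) ≤ bf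
  min : ∀ i < cnt, ∀ t w, X.LayerEdge H (sc i) t w →
    (∃ k < cnt, sc k = t) ∨ (best < (H + 1) * n ∧ bf ≤ D i + (w + q t))

variable {X : FrozenGraph n} {H : ℕ} {r : Fin n} {q : ℕ → ℝ} {cnt : ℕ} {sc : ℕ → ℕ} {D : ℕ → ℝ}
  {best : ℕ} {bf bD : ℝ}

theorem SearchInv.zero : X.SearchInv H r q 0 sc D := by
  constructor <;> intros <;> omega

theorem NextInv.zero (hbf : bf = q r.val) : X.NextInv H r q 0 sc D r.val bf 0 where
  start _ := ⟨rfl, rfl⟩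
  reaches _ := ⟨r, Walk.nil r, by simp [Walk.hops], rfl⟩
  value _ := by simp [hbf]
  fresh _ := by intros; omega
  ge _ := by intros; omega
  min := by intros; omega

/-- The new state has the largest value so far. By consistency of `q`, its outgoing edges cannot
improve an explored label, nor lead to a value below the explored ones. Explored labels are
therefore never revised. -/
theorem SearchInv.extend (h : X.SearchInv H r q cnt sc D)
    (hn : X.NextInv H r q cnt sc D best bf bD) (hq : X.IsPotential H q)
    (hb : best < (H + 1) * n) :
    X.SearchInv H r q (cnt + 1) (Function.update sc cnt best) (Function.update D cnt bD) := by
  have old : ∀ i < cnt, Function.update sc cnt best i = sc i ∧ Function.update D cnt bD i = D i :=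
    fun i hi => by simp [hi.ne]
  have cases : ∀ i < cnt + 1, i < cnt ∨ i = cnt := fun i hi => by omega
  have hval := hn.value hb
  have hfresh := hn.fresh hb
  have hge : ∀ k < cnt + 1,
      Function.update D cnt bD k + q (Function.update sc cnt best k) ≤ bf := by
    intro k hk
    rcases cases k hk with hk | rfl
    · rw [(old k hk).1, (old k hk).2]; exact hn.ge hb k hk
    · simp [hval]
  constructor
  · intro i hi
    rcases cases i hi with hi | rfl
    · rw [(old i hi).1]; exact h.lt i hi
    · simpa using hb
  · intro i hi
    rcases cases i hi with hi | rfl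
    · rw [(old i hi).1, (old i hi).2]; exact h.reaches i hi
    · simpa using hn.reaches hb
  · intro i hi k hk hik
    rcases cases i hi with hi | rfl <;> rcases cases k hk with hk | rfl
    · rw [(old i hi).1, (old k hk).1] at hik; exact h.inj i hi k hk hik
    · rw [(old i hi).1] at hik; exact absurd (by simpa using hik) (hfresh i hi)
    · rw [(old k hk).1] at hik; exact absurd (by simpa using hik.symm) (hfresh k hk)
    · rfl
  · intro _
    rcases Nat.eq_zero_or_pos cnt with h0 | h0
    · subst h0; simpa using hn.start rfl
    · rw [(old 0 h0).1, (old 0 h0).2]; exact h.root h0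
  · intro i hi k hk w he
    rcases cases i hi with hi | rfl
    · rw [(old i hi).1] at he
      rw [(old i hi).2]
      rcases cases k hk with hk | rfl
      · rw [(old k hk).1] at he
        rw [(old k hk).2]
        exact h.relaxed i hi k hk w he
      · simp only [Function.update_self] at he ⊢
        rcases hn.min i hi _ _ he with ⟨l, hl, hl'⟩ | ⟨-, hle⟩
        · exact absurd hl' (hfresh l hl)
        · linarith
    · have h1 := hge k hk
      have h2 := he.potential_le hq
      simp only [Function.update_self] at h2 ⊢
      linarith
  · intro i hi t w he ht k hk
    refine (hge k hk).trans ?_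
    rcases cases i hi with hi | rfl
    · rw [(old i hi).1] at he
      rw [(old i hi).2]
      rcases hn.min i hi _ _ he with ⟨l, hl, hl'⟩ | ⟨-, hle⟩
      · exact absurd hl' (by simpa [(old l hl).1] using ht l (by omega))
      · exact hle
    · have h2 := he.potential_le hq
      simp only [Function.update_self] at h2 ⊢
      linarith

/-- The candidate comes from an edge that leaves the explored set, so `order` bounds all values
explored earlier by its value. What remains to be checked is minimality, which is supplied by the
scan of the pointers. -/
theorem SearchInv.next (h : X.SearchInv H r q cnt sc D) (h0 : 0 < cnt)
    (hb : best < (H + 1) * n → (∀ k < cnt, sc k ≠ best) ∧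
      ∃ i < cnt, ∃ w, X.LayerEdge H (sc i) best w ∧ bD = D i + w ∧ bf = D i + (w + q best))
    (hmin : ∀ i < cnt, ∀ t w, X.LayerEdge H (sc i) t w →
      (∃ k < cnt, sc k = t) ∨ (best < (H + 1) * n ∧ bf ≤ D i + (w + q t))) :
    X.NextInv H r q cnt sc D best bf bD where
  start h' := by omega
  reaches hlt := by
    obtain ⟨-, i, hi, w, he, rfl, -⟩ := hb hlt
    exact (h.reaches i hi).step he
  value hlt := by
    obtain ⟨-, i, hi, w, he, rfl, rfl⟩ := hb hlt
    ring
  fresh hlt := (hb hlt).1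
  ge hlt k hk := by
    obtain ⟨hf, i, hi, w, he, rfl, rfl⟩ := hb hlt
    exact h.order i hi _ _ he hf k hk
  min := hmin

/-- Follow the walk as long as its states are explored; `relaxed` keeps the labels below the
weights. At the first edge to an unexplored state, `min` bounds the next value by label plus `w + q
t`, and `q t` is at most the weight of the rest of the walk. -/
theorem SearchInv.walk (h : X.SearchInv H r q cnt sc D)
    (hn : X.NextInv H r q cnt sc D best bf bD) (hq : X.IsPotential H q) {u z : Fin n}
    (p : X.Walk u z) : ∀ (i j : ℕ), i < cnt → sc i = j * n + u.val → j + p.hops ≤ H →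
      (best < (H + 1) * n ∧ bf ≤ D i + p.weight) ∨
      ((∀ x ∈ p.support, ∃ k < cnt, sc k % n = x.val) ∧
        ∃ k < cnt, sc k % n = z.val ∧ D k ≤ D i + p.weight) := by
  induction p with
  | nil u =>
    intro i j hi hc hj
    refine Or.inr ⟨?_, i, hi, by rw [hc, code_mod], by simp [Walk.weight]⟩
    intro x hx
    obtain rfl : x = u := by simpa [Walk.support] using hx
    exact ⟨i, hi, by rw [hc, code_mod]⟩
  | @cons u v z e p ih =>
    intro i j hi hc hj
    classical
    simp only [Walk.hops] at hj
    have he : X.LayerEdge H (sc i) ((j + if X.Neg u v then 1 else 0) * n + v.val)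
        (X.weight u v) := ⟨u, v, j, e, hc, by congr, by convert (by omega : (j + if X.Neg u v then 1 else 0) ≤ H), rfl⟩
    rcases hn.min i hi _ _ he with ⟨k, hk, hk'⟩ | ⟨hb, hle⟩
    · have hD : D k ≤ D i + X.weight u v := h.relaxed i hi k hk _ (by rwa [hk'])
      rcases ih k _ hk hk' (by convert (by omega : (j + if X.Neg u v then 1 else 0) + p.hops ≤ H)) with ⟨hb, hle⟩ | ⟨hs, l, hl, hz, hle⟩
      · exact Or.inl ⟨hb, by simp only [Walk.weight]; linarith⟩
      · refine Or.inr ⟨?_, l, hl, hz, by simp only [Walk.weight]; linarith⟩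
        intro x hx
        rcases List.mem_cons.mp hx with rfl | hx
        · exact ⟨i, hi, by rw [hc, code_mod]⟩
        · exact hs x hx
    · refine Or.inl ⟨hb, hle.trans ?_⟩
      have : q ((j + if X.Neg u v then 1 else 0) * n + v.val) ≤ p.weight :=
        (hq (j + if X.Neg u v then 1 else 0) (by omega) v).2 ⟨z, trivial, p, by omega, rfl⟩
      simp only [Walk.weight]
      linarith

/-- Before the first exploration the next value is `q` at the root, the least weight of all `H`-hop
walks from it. -/
theorem NextInv.start_le (hn : X.NextInv H r q 0 sc D best bf bD) (hq : X.IsPotential H q)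
    {t : Fin n} (p : X.Walk r t) (hp : p.hops ≤ H) : best < (H + 1) * n ∧ bf ≤ p.weight := by
  obtain ⟨hb, hD⟩ := hn.start rfl
  have hlt : best < (H + 1) * n := by
    have := code_lt (Nat.zero_le H) r
    rw [hb]; simpa using this
  refine ⟨hlt, ?_⟩
  rw [hn.value hlt, hD, hb]
  have := (hq 0 (Nat.zero_le _) r).2 ⟨t, trivial, p, hp, rfl⟩
  simpa using this

/-- A walk through a vertex without explored state is at least as heavy as the next value. -/
theorem SearchInv.outWeights_ge (h : X.SearchInv H r q cnt sc D)
    (hn : X.NextInv H r q cnt sc D best bf bD) (hq : X.IsPotential H q)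
    {v : Fin n} (hv : ∀ k < cnt, sc k % n ≠ v.val) {x : ℝ} (hx : x ∈ X.outWeights H r v) :
    best < (H + 1) * n ∧ bf ≤ x := by
  obtain ⟨t, p, hp, hh, rfl⟩ := hx
  rcases Nat.eq_zero_or_pos cnt with rfl | h0
  · exact hn.start_le hq p hh
  obtain ⟨hr, hD⟩ := h.root h0
  rcases h.walk hn hq p 0 0 h0 (by simpa using hr) (by simpa using hh) with h1 | ⟨h1, -⟩
  · simpa [hD] using h1
  · obtain ⟨k, hk, hk'⟩ := h1 v hp
    exact absurd hk' (hv k hk)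

/-- Every explored state lies on a walk whose weight is the value of the state. -/
theorem Reaches.mem_outWeights (hq : X.IsPotential H q) {c : ℕ} {x : ℝ} (h : X.Reaches r c x)
    (hc : c < (H + 1) * n) :
    ∃ v : Fin n, c % n = v.val ∧ x + q c ∈ X.outWeights H r v ∧ x ∈ X.pathWeights H r v := by
  obtain ⟨v, p, rfl, rfl⟩ := h
  have hH : p.hops ≤ H := by
    rw [mul_comm (H + 1)] at hc
    have := Nat.div_lt_of_lt_mul hc
    rw [code_div] at this
    omega
  obtain ⟨⟨t, -, p', hp', hw⟩, -⟩ := hq p.hops hH v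
  refine ⟨v, code_mod _ _, ⟨t, p.append p', ?_, ?_, ?_⟩, p, hH, rfl⟩
  · simp [p.end_mem_support]
  · simp; omega
  · simp [hw]

/-- The labels of the explored states determine all hop distances below the next value. -/
theorem SearchInv.isHopDist (h : X.SearchInv H r q cnt sc D)
    (hn : X.NextInv H r q cnt sc D best bf bD) (hq : X.IsPotential H q)
    {v : Fin n} {x : ℝ} (hx : X.IsHopDist H r v x) (hlt : best < (H + 1) * n → x < bf) :
    (∃ k < cnt, sc k % n = v.val ∧ D k ≤ x) ∧ ∀ k < cnt, sc k % n = v.val → x ≤ D k := by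
  constructor
  · obtain ⟨p, hh, rfl⟩ := hx.1
    rcases Nat.eq_zero_or_pos cnt with rfl | h0
    · obtain ⟨h1, h2⟩ := hn.start_le hq p hh
      exact absurd (hlt h1) (not_lt.mpr h2)
    obtain ⟨hr, hD⟩ := h.root h0
    rcases h.walk hn hq p 0 0 h0 (by simpa using hr) (by simpa using hh) with ⟨h1, h2⟩ | ⟨-, h1⟩
    · have := hlt h1
      rw [hD] at h2
      linarith
    · simpa [hD] using h1
  · intro k hk hv
    obtain ⟨v', hv', -, hm⟩ := (h.reaches k hk).mem_outWeights hq (h.lt k hk)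
    obtain rfl : v' = v := Fin.ext (hv'.symm.trans hv)
    exact hx.2 hm

theorem SearchInv.card_le (h : X.SearchInv H r q cnt sc D) : cnt ≤ (H + 1) * n := by
  have := Finset.card_le_card_of_injOn (s := Finset.range cnt) (t := Finset.range ((H + 1) * n)) sc
    (fun i hi => by simpa using h.lt i (by simpa using hi))
    (fun i hi k hk => h.inj i (by simpa using hi) k (by simpa using hk))
  simpa using this

end FrozenGraph

/-! ### Hop-bounded distances by dense Dijkstra searches

The programs below are written for one side of the search. A side `o` owns the arrays
`o, o + 2, o + 4, …`, and the two sides are `o = 2` and `o = 3`. Its integer arrays hold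
`o`: the listed vertices, `o + 2`: the adjacency matrix, `o + 4`: `n`, `o + 6`: the hop bound,
`o + 8`: the number of states, `o + 10`: the status of the labels of all levels,
`o + 12` to `o + 18`: loop variables, `o + 20`: a tournament tree, `o + 22`: a position in it,
`o + 24`: the sorted lists of targets, `o + 26`: marks of states, `o + 28`: marks of vertices,
`o + 30`: explored states, `o + 32`: list pointers, `o + 34`: the number of explored states,
`o + 36`: the next state, `o + 38` to `o + 44`: local variables, `o + 46`: the offset of the
current level, `o + 48`: the number of levels to be computed.
Its real arrays hold `o`: distances from the root, `o + 2`: edge weights, `o + 4`: labels of all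
levels, `o + 6`: sorting keys, `o + 8`: sorted keys, `o + 10`: weights in the order of the keys,
`o + 12`: labels of explored states, `o + 14` and `o + 16`: value and label of the next state,
`o + 18`: the value of the last vertex, `o + 20`: the values of the start states. -/

namespace RealRAM

open FrozenGraph

open Classical in
/-- The entry of the adjacency matrix. -/
noncomputable def edgeCode {n : ℕ} (X : FrozenGraph n) (u v : Fin n) : ℕ :=
  if X.Neg u v then 2 else if X.Adj u v then 1 else 0

theorem edgeCode_eq_one {n : ℕ} {X : FrozenGraph n} {u v : Fin n} :
    edgeCode X u v = 1 ↔ X.Adj u v ∧ ¬ X.Neg u v := by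
  unfold edgeCode
  split_ifs <;> simp_all

theorem edgeCode_eq_two {n : ℕ} {X : FrozenGraph n} {u v : Fin n} :
    edgeCode X u v = 2 ↔ X.Neg u v := by
  unfold edgeCode
  split_ifs <;> simp_all

theorem edgeCode_pos {n : ℕ} {X : FrozenGraph n} {u v : Fin n} :
    1 ≤ edgeCode X u v ↔ X.Adj u v := by
  have := X.adj_of_neg u v
  unfold edgeCode
  split_ifs <;> simp_all

open Classical in
theorem edgeCode_div_two {n : ℕ} {X : FrozenGraph n} {u v : Fin n} :
    edgeCode X u v / 2 = if X.Neg u v then 1 else 0 := by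
  unfold edgeCode
  split_ifs <;> simp_all

/-- The memory holds the graph `X` on side `o`. -/
structure HasGraph {n : ℕ} (o : ℕ) (X : FrozenGraph n) (s : Mem) : Prop where
  size : s.nat (o + 4) 0 = n
  adj : ∀ u v : Fin n, s.nat (o + 2) (u.val * n + v.val) = edgeCode X u v
  weight : ∀ u v : Fin n, X.Adj u v → s.real (o + 2) (u.val * n + v.val) = X.weight u v

theorem HasGraph.congr {n o : ℕ} {X : FrozenGraph n} {s s' : Mem} (h : HasGraph o X s)
    (h4 : s'.nat (o + 4) = s.nat (o + 4)) (h2 : s'.nat (o + 2) = s.nat (o + 2))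
    (hw : s'.real (o + 2) = s.real (o + 2)) : HasGraph o X s' :=
  ⟨by rw [h4, h.size], by rw [h2]; exact h.adj, by rw [hw]; exact h.weight⟩

/-- Find a labelled vertex with the least label; `n` stands for none. -/
def scanMin (o : ℕ) : Prog :=
  Prog.setNat (o + 18) 0 (.var (o + 4)) ;;
  forN (o + 16) (.var (o + 4))
    (Prog.cond
      (.conj (.natEq (.get (o + 10) (.var (o + 46) + .var (o + 16))) 1)
        (.disj (.natLE (.var (o + 4)) (.var (o + 18)))
          (.realLT (.get (o + 4) (.var (o + 46) + .var (o + 16)))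
            (.get (o + 4) (.var (o + 46) + .var (o + 18))))))
      (Prog.setNat (o + 18) 0 (.var (o + 16)))
      Prog.skip)

theorem run_scanMin {W n o b : ℕ} {s : Mem} (hn : s.nat (o + 4) 0 = n) (hb : s.nat (o + 46) 0 = b)
    (hW : n ≤ W) :
    Run W (scanMin o) s (fun t s' => t ≤ 120 * n + 20 ∧
      ((∃ u : Fin n, s'.nat (o + 18) 0 = u.val ∧ s.nat (o + 10) (b + u.val) = 1 ∧
        ∀ v : Fin n, s.nat (o + 10) (b + v.val) = 1 →
          s.real (o + 4) (b + u.val) ≤ s.real (o + 4) (b + v.val)) ∨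
      (s'.nat (o + 18) 0 = n ∧ ∀ v : Fin n, s.nat (o + 10) (b + v.val) ≠ 1))) := by
  unfold scanMin
  rw [run_seq, run_setNat]
  refine ⟨by simp, by simpa [hn], ?_⟩
  refine (run_forN_const (N := n) (T := 100) (fun k s' =>
    ((∃ u : Fin n, s'.nat (o + 18) 0 = u.val ∧ s.nat (o + 10) (b + u.val) = 1 ∧
        ∀ v : Fin n, v.val < k → s.nat (o + 10) (b + v.val) = 1 →
          s.real (o + 4) (b + u.val) ≤ s.real (o + 4) (b + v.val)) ∨
      (s'.nat (o + 18) 0 = n ∧ ∀ v : Fin n, v.val < k → s.nat (o + 10) (b + v.val) ≠ 1)))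
    hW ?_ ?_ ?_ ?_).mono ?_
  · intro s' hF
    have := hF.nat (o + 4) (by simp [Prog.natWrites])
    simp [this, hn]
  · simp [Prog.natWrites]
  · simp [hn]
  · intro k s' hk hI hk' hF
    have h4 := hF.nat (o + 4) (by simp [Prog.natWrites])
    have h10 := hF.nat (o + 10) (by simp [Prog.natWrites])
    have h46 := hF.nat (o + 46) (by simp [Prog.natWrites])
    have hr := hF.real (o + 4) (by simp [Prog.realWrites])
    simp at h4 h10 h46 hr
    simp [h4, h10, h46, hr, hn, hb, hk']
    constructor
    · intro h1 h2
      refine ⟨by omega, Or.inl ⟨⟨k, hk⟩, rfl, h1, ?_⟩⟩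
      intro v hv hv1
      rcases hv.eq_or_lt with hv | hv
      · simp [← hv]
      · rcases hI with ⟨u, hu, hu1, hu2⟩ | ⟨-, hu2⟩
        · rw [hu] at h2
          have := hu2 v hv hv1
          rcases h2 with h2 | h2
          · have := u.isLt; omega
          · exact h2.le.trans this
        · exact absurd hv1 (hu2 v hv)
    · intro h1
      rcases hI with ⟨u, hu, hu1, hu2⟩ | ⟨hu, hu2⟩
      · refine Or.inl ⟨u, hu, hu1, ?_⟩
        intro v hv hv1
        rcases hv.eq_or_lt with hv | hv
        · rw [← hu, hv]
          exact (h1 (by rw [← hv, hv1])).2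
        · exact hu2 v hv hv1
      · refine Or.inr ⟨hu, ?_⟩
        intro v hv hv1
        rcases hv.eq_or_lt with hv | hv
        · have := (h1 (by rw [← hv, hv1])).1
          omega
        · exact hu2 v hv hv1
  · rintro t s' ⟨hI, ht⟩
    simp only [NExp.cost_ofNat, NExp.cost_var] at ht ⊢
    refine ⟨by omega, ?_⟩
    rcases hI with ⟨u, hu, hu1, hu2⟩ | ⟨hu, hu2⟩
    · exact Or.inl ⟨u, hu, hu1, fun v => hu2 v v.isLt⟩
    · exact Or.inr ⟨hu, fun v => hu2 v v.isLt⟩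

/-- Make the selected vertex final and relax its incoming edges that are not negative. -/
def relax (o : ℕ) : Prog :=
  Prog.setNat (o + 10) (.var (o + 46) + .var (o + 18)) 2 ;;
  forN (o + 16) (.var (o + 4))
    (Prog.cond
      (.conj (.natEq (.get (o + 2) (.var (o + 16) * .var (o + 4) + .var (o + 18))) 1)
        (.disj (.natEq (.get (o + 10) (.var (o + 46) + .var (o + 16))) 0)
          (.conj (.natEq (.get (o + 10) (.var (o + 46) + .var (o + 16))) 1)
            (.realLT (.get (o + 2) (.var (o + 16) * .var (o + 4) + .var (o + 18)) +
                .get (o + 4) (.var (o + 46) + .var (o + 18)))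
              (.get (o + 4) (.var (o + 46) + .var (o + 16)))))))
      (Prog.setNat (o + 10) (.var (o + 46) + .var (o + 16)) 1 ;;
        Prog.setReal (o + 4) (.var (o + 46) + .var (o + 16))
          (.get (o + 2) (.var (o + 16) * .var (o + 4) + .var (o + 18)) +
            .get (o + 4) (.var (o + 46) + .var (o + 18))))
      Prog.skip)

/-- The middle clauses are the hypotheses of `DijkstraInv.step`. The last one protects the other
levels, which share the arrays at different offsets. -/
theorem run_relax {W n o b : ℕ} {X : FrozenGraph n} {s : Mem} (hG : HasGraph o X s)
    (hb : s.nat (o + 46) 0 = b) (hW : b + n ≤ W) (hW2 : 2 ≤ W) {u : Fin n}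
    (hu : s.nat (o + 18) 0 = u.val) :
    Run W (relax o) s (fun t s' => t ≤ 200 * n + 30 ∧
      s'.nat (o + 10) (b + u.val) = 2 ∧
      s'.real (o + 4) (b + u.val) = s.real (o + 4) (b + u.val) ∧
      (∀ v : Fin n, v ≠ u →
        X.Improves (fun v => s.nat (o + 10) (b + v.val)) (fun v => s.real (o + 4) (b + v.val)) u v →
        s'.nat (o + 10) (b + v.val) = 1 ∧
        s'.real (o + 4) (b + v.val) = X.weight v u + s.real (o + 4) (b + u.val)) ∧
      (∀ v : Fin n, v ≠ u →
        ¬ X.Improves (fun v => s.nat (o + 10) (b + v.val)) (fun v => s.real (o + 4) (b + v.val))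
          u v →
        s'.nat (o + 10) (b + v.val) = s.nat (o + 10) (b + v.val) ∧
        s'.real (o + 4) (b + v.val) = s.real (o + 4) (b + v.val)) ∧
      ∀ i, (i < b ∨ b + n ≤ i) →
        s'.nat (o + 10) i = s.nat (o + 10) i ∧ s'.real (o + 4) i = s.real (o + 4) i) := by
  have hn := hG.size
  have hu' := u.isLt
  unfold relax
  rw [run_seq, run_setNat]
  refine ⟨by simp [hu, hb]; omega, by simpa, ?_⟩
  refine (run_forN_const (N := n) (T := 150) (fun k s' =>
      s'.nat (o + 10) (b + u.val) = 2 ∧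
      s'.real (o + 4) (b + u.val) = s.real (o + 4) (b + u.val) ∧
      (∀ v : Fin n, v.val < k → v ≠ u →
        X.Improves (fun v => s.nat (o + 10) (b + v.val)) (fun v => s.real (o + 4) (b + v.val)) u v →
        s'.nat (o + 10) (b + v.val) = 1 ∧
        s'.real (o + 4) (b + v.val) = X.weight v u + s.real (o + 4) (b + u.val)) ∧
      (∀ v : Fin n, v ≠ u → (k ≤ v.val ∨
        ¬ X.Improves (fun v => s.nat (o + 10) (b + v.val)) (fun v => s.real (o + 4) (b + v.val))
          u v) →
        s'.nat (o + 10) (b + v.val) = s.nat (o + 10) (b + v.val) ∧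
        s'.real (o + 4) (b + v.val) = s.real (o + 4) (b + v.val)) ∧
      ∀ i, (i < b ∨ b + n ≤ i) →
        s'.nat (o + 10) i = s.nat (o + 10) i ∧ s'.real (o + 4) i = s.real (o + 4) i)
    (by omega) ?_ ?_ ?_ ?_).mono ?_
  · intro s' hF
    have := hF.nat (o + 4) (by simp [Prog.natWrites])
    simp [this, hn]
  · simp [Prog.natWrites]
  · simp only [NExp.eval_add, NExp.eval_var, hb, hu, NExp.eval_ofNat, Mem.nat_setNat,
      Mem.real_setNat]
    refine ⟨by simp, by simp, by simp, ?_, ?_⟩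
    · intro v hv _
      simp [Fin.val_ne_of_ne hv]
    · intro i hi
      have : i ≠ b + u.val := by omega
      simp [this]
  · rintro k s' hk ⟨I1, I2, I3, I4, I5⟩ hk' hF
    have h4 := hF.nat (o + 4) (by simp [Prog.natWrites])
    have h2 := hF.nat (o + 2) (by simp [Prog.natWrites])
    have h18 := hF.nat (o + 18) (by simp [Prog.natWrites])
    have h46 := hF.nat (o + 46) (by simp [Prog.natWrites])
    have hr := hF.real (o + 2) (by simp [Prog.realWrites])
    simp at h4 h2 h46 hr h18
    obtain ⟨v, rfl⟩ : ∃ v : Fin n, v.val = k := ⟨⟨k, hk⟩, rfl⟩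
    have hadj := hG.adj v u
    have himp : X.Improves (fun v => s.nat (o + 10) (b + v.val))
        (fun v => s.real (o + 4) (b + v.val)) u v ↔ (X.Adj v u ∧ ¬ X.Neg v u) ∧
        (s.nat (o + 10) (b + v.val) = 0 ∨ (s.nat (o + 10) (b + v.val) = 1 ∧
          X.weight v u + s.real (o + 4) (b + u.val) < s.real (o + 4) (b + v.val))) := Iff.rfl
    by_cases hvu : v = u
    -- The selected vertex already has status `2`, so the test fails even if there is a loop at it.
    · subst hvu
      simp [h4, h2, h46, h18, hn, hb, hu, hk', hadj, edgeCode_eq_one, hr, I1, I2]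
      refine ⟨?_, ?_, I5⟩
      · intro x hx hxu
        have : x.val < v.val := lt_of_le_of_ne hx (Fin.val_ne_of_ne hxu)
        exact I3 x this hxu
      · intro x hxu hx
        exact I4 x hxu (hx.imp (fun h => h.le) id)
    have hvv := Fin.val_ne_of_ne hvu
    obtain ⟨hs1, hs2⟩ := I4 v hvu (Or.inl le_rfl)
    simp [h4, h2, h46, h18, hn, hb, hu, hk', hadj, edgeCode_eq_one, hr, hs1, hs2]
    constructor
    · intro hA hN h'
      rw [hG.weight v u hA, I2] at h' ⊢
      have himp' := himp.mpr ⟨⟨hA, hN⟩, h'⟩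
      have hW' : b + v.val ≤ W := by omega
      simp [Ne.symm hvv, I1, hW']
      refine ⟨by omega, I2, ?_, ?_, ?_⟩
      · intro x hx hxu hi
        by_cases hxv : x.val = v.val
        · obtain rfl := Fin.ext hxv
          simp
        · simp [hxv]
          exact I3 x (by rw [Fin.le_def] at hx; omega) hxu hi
      · intro x hxu hx
        by_cases hxv : x.val = v.val
        · obtain rfl := Fin.ext hxv
          rcases hx with hx | hx
          · exact absurd hx (lt_irrefl _)
          · exact absurd himp' hx
        · simp [hxv]
          exact I4 x hxu (hx.imp (fun h => by rw [Fin.lt_def] at h; omega) id)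
      · intro i hi
        have : i ≠ b + v.val := by omega
        simp [this]
        exact I5 i hi
    · intro h'
      have himp' : ¬ X.Improves (fun v => s.nat (o + 10) (b + v.val))
          (fun v => s.real (o + 4) (b + v.val)) u v := by
        rw [himp]
        rintro ⟨⟨hA, hN⟩, h1⟩
        have h2 := h' hA hN
        rw [hG.weight v u hA, I2] at h2
        rcases h1 with h1 | ⟨h1, h3⟩
        · exact h2.1 h1
        · exact absurd h3 (not_lt.mpr (h2.2 h1))
      refine ⟨I1, I2, ?_, ?_, I5⟩
      · intro x hx hxu hi
        by_cases hxv : x.val = v.val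
        · obtain rfl := Fin.ext hxv
          exact absurd hi himp'
        · exact I3 x (by rw [Fin.le_def] at hx; omega) hxu hi
      · intro x hxu hx
        by_cases hxv : x.val = v.val
        · obtain rfl := Fin.ext hxv
          exact ⟨hs1, hs2⟩
        · exact I4 x hxu (hx.imp (fun h => by rw [Fin.lt_def] at h; omega) id)
  · rintro t s' ⟨⟨I1, I2, I3, I4, I5⟩, ht⟩
    simp only [NExp.cost_ofNat, NExp.cost_var, NExp.cost_add] at ht ⊢
    exact ⟨by omega, I1, I2, fun v => I3 v v.isLt, fun v hv hi => I4 v hv (Or.inr hi), I5⟩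

end RealRAM

/-! ### Dijkstra's algorithm on a level and the passage to the next level. -/

namespace RealRAM

open FrozenGraph

@[simp] theorem natWrites_scanMin (o : ℕ) :
    (scanMin o).natWrites = [o + 18, o + 16, o + 18, o + 16] := rfl
@[simp] theorem realWrites_scanMin (o : ℕ) : (scanMin o).realWrites = [] := rfl
@[simp] theorem natWrites_relax (o : ℕ) :
    (relax o).natWrites = [o + 10, o + 16, o + 10, o + 16] := rfl
@[simp] theorem realWrites_relax (o : ℕ) : (relax o).realWrites = [o + 4] := rfl

/-- Dijkstra's algorithm on one level, over the edges that are not negative. -/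
def dijkstra (o : ℕ) : Prog :=
  forN (o + 14) (.var (o + 4))
    (scanMin o ;; Prog.cond (.natLT (.var (o + 18)) (.var (o + 4))) (relax o) Prog.skip)

@[simp] theorem natWrites_dijkstra (o : ℕ) :
    (dijkstra o).natWrites = [o + 14, o + 18, o + 16, o + 18, o + 16, o + 10, o + 16, o + 10,
      o + 16, o + 14] := rfl
@[simp] theorem realWrites_dijkstra (o : ℕ) : (dijkstra o).realWrites = [o + 4] := rfl

/-- Each of the `n` rounds makes a further vertex final unless no labelled vertex is left, in which
case nothing changes any more. In both cases no vertex has status `1` at the end, and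
`DijkstraInv.final` applies. -/
theorem run_dijkstra {W n o b : ℕ} {X : FrozenGraph n} {s : Mem} (hG : HasGraph o X s)
    (hb : s.nat (o + 46) 0 = b) (hW : b + n ≤ W) (hW2 : 2 ≤ W) {B : Fin n → Set ℝ}
    (hB : ∀ v : Fin n, IsLab (B v) (s.nat (o + 10) (b + v.val)) (s.real (o + 4) (b + v.val)))
    (hB1 : ∀ v : Fin n, s.nat (o + 10) (b + v.val) ≤ 1) :
    Run W (dijkstra o) s (fun t s' => t ≤ 400 * (n + 1) ^ 2 ∧
      (∀ v : Fin n, IsLab (X.zeroClosure B v) (s'.nat (o + 10) (b + v.val))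
        (s'.real (o + 4) (b + v.val))) ∧
      ∀ i, (i < b ∨ b + n ≤ i) →
        s'.nat (o + 10) i = s.nat (o + 10) i ∧ s'.real (o + 4) i = s.real (o + 4) i) := by
  have hn := hG.size
  unfold dijkstra
  refine (run_forN_const (N := n) (T := 320 * n + 70) (fun k s' =>
      X.DijkstraInv B (fun v => s'.nat (o + 10) (b + v.val)) (fun v => s'.real (o + 4) (b + v.val)) ∧
      (k ≤ (Finset.univ.filter fun v : Fin n => s'.nat (o + 10) (b + v.val) = 2).card ∨
        ∀ v : Fin n, s'.nat (o + 10) (b + v.val) ≠ 1) ∧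
      ∀ i, (i < b ∨ b + n ≤ i) →
        s'.nat (o + 10) i = s.nat (o + 10) i ∧ s'.real (o + 4) i = s.real (o + 4) i)
    (by omega) ?_ ?_ ?_ ?_).mono ?_
  · intro s' hF
    have := hF.nat (o + 4) (by simp [Prog.natWrites])
    simp [this, hn]
  · simp [Prog.natWrites]
  · simp
    exact DijkstraInv.init hB hB1
  · rintro k s' hk ⟨hI, hc, ho⟩ hk' hF
    have h4 := hF.nat (o + 4) (by simp [Prog.natWrites])
    have h2 := hF.nat (o + 2) (by simp [Prog.natWrites])
    have h46 := hF.nat (o + 46) (by simp [Prog.natWrites])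
    have hr := hF.real (o + 2) (by simp [Prog.realWrites])
    have hG' : HasGraph o X s' := hG.congr h4 h2 hr
    have hb' : s'.nat (o + 46) 0 = b := by rw [h46, hb]
    refine (run_scanMin hG'.size hb' (by omega)).frame.seq ?_
    rintro t1 s1 ⟨⟨ht1, hS⟩, hF1⟩
    have h4 := hF1.nat (o + 4) (by simp)
    have h2 := hF1.nat (o + 2) (by simp)
    have h10 := hF1.nat (o + 10) (by simp)
    have h46 := hF1.nat (o + 46) (by simp)
    have hr := hF1.real (o + 2) (by simp)
    have hr4 := hF1.real (o + 4) (by simp)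
    have hG1 : HasGraph o X s1 := hG'.congr h4 h2 hr
    have hb1 : s1.nat (o + 46) 0 = b := by rw [h46, hb']
    simp only [run_cond, BExp.eval_natLT, NExp.eval_var, hG1.size, run_skip]
    rcases hS with ⟨u, hu, hu1, hmin⟩ | ⟨hu, hnone⟩
    · refine ⟨fun _ => ?_, fun h => absurd (hu ▸ u.isLt) h⟩
      refine (run_relax hG1 hb1 hW hW2 hu).mono ?_
      rintro t2 s2 ⟨ht2, I1, I2, I3, I4, I5⟩
      simp only [h10, hr4] at I2 I3 I4 I5
      simp only [BExp.cost_natLT, NExp.cost_var, Mem.nat_setNat, Mem.real_setNat,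
        Nat.add_left_cancel_iff, Nat.reduceEqDiff, if_false]
      have hstep := hI.step (u := u) hu1 hmin (st' := fun v => s2.nat (o + 10) (b + v.val))
        (d' := fun v => s2.real (o + 4) (b + v.val)) I1 I2 I3 I4
      refine ⟨by omega, hstep, Or.inl ?_, fun i hi => ?_⟩
      · have hk : k ≤ (Finset.univ.filter
            fun v : Fin n => s'.nat (o + 10) (b + v.val) = 2).card := by
          rcases hc with hc | hc
          · exact hc
          · exact absurd hu1 (hc u)
        have hlt : (Finset.univ.filter fun v : Fin n => s'.nat (o + 10) (b + v.val) = 2).card <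
            (Finset.univ.filter fun v : Fin n => s2.nat (o + 10) (b + v.val) = 2).card := by
          apply Finset.card_lt_card
          rw [Finset.ssubset_iff_of_subset]
          · exact ⟨u, by simp [I1], by simp [hu1]⟩
          · intro v hv
            simp only [Finset.mem_filter, Finset.mem_univ, true_and] at hv ⊢
            have hvu : v ≠ u := by rintro rfl; omega
            rw [(I4 v hvu ?_).1, hv]
            rintro ⟨-, h | h⟩ <;> simp only at h <;> omega
        omega
      · exact ⟨(I5 i hi).1.trans (ho i hi).1, (I5 i hi).2.trans (ho i hi).2⟩
    · refine ⟨fun h => absurd h (by omega), fun _ => ?_⟩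
      simp only [BExp.cost_natLT, NExp.cost_var, Mem.nat_setNat, Mem.real_setNat,
        Nat.add_left_cancel_iff, Nat.reduceEqDiff, if_false, h10, hr4]
      exact ⟨by omega, hI, Or.inr hnone, ho⟩
  · rintro t s' ⟨⟨hI, hc, ho⟩, ht⟩
    simp only [NExp.cost_var] at ht
    refine ⟨by nlinarith, ?_, ho⟩
    apply hI.final
    intro v
    have h2 := hI.le_two v
    have h1 : s'.nat (o + 10) (b + v.val) ≠ 1 := by
      rcases hc with hc | hc
      · have hcard : (Finset.univ.filter
            fun v : Fin n => s'.nat (o + 10) (b + v.val) = 2) = Finset.univ := by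
          apply Finset.eq_univ_of_card
          refine le_antisymm (Finset.card_le_univ _) (by simpa using hc)
        have := Finset.mem_univ v
        rw [← hcard] at this
        simp only [Finset.mem_filter] at this
        omega
      · exact hc v
    omega

/-- Initialize the labels of the next level by at most one negative edge. -/
def negRelax (o : ℕ) : Prog :=
  forN (o + 16) (.var (o + 4))
    (Prog.cond (.natLE 1 (.get (o + 10) (.var (o + 46) + .var (o + 16))))
      (Prog.setNat (o + 10) (.var (o + 46) + .var (o + 4) + .var (o + 16)) 1)
      (Prog.setNat (o + 10) (.var (o + 46) + .var (o + 4) + .var (o + 16)) 0) ;;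
    Prog.setReal (o + 4) (.var (o + 46) + .var (o + 4) + .var (o + 16))
      (.get (o + 4) (.var (o + 46) + .var (o + 16))) ;;
    forN (o + 18) (.var (o + 4))
      (Prog.cond
        (.conj (.natEq (.get (o + 2) (.var (o + 16) * .var (o + 4) + .var (o + 18))) 2)
          (.conj (.natLE 1 (.get (o + 10) (.var (o + 46) + .var (o + 18))))
            (.disj (.natEq (.get (o + 10) (.var (o + 46) + .var (o + 4) + .var (o + 16))) 0)
              (.realLT (.get (o + 2) (.var (o + 16) * .var (o + 4) + .var (o + 18)) +
                  .get (o + 4) (.var (o + 46) + .var (o + 18)))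
                (.get (o + 4) (.var (o + 46) + .var (o + 4) + .var (o + 16)))))))
        (Prog.setNat (o + 10) (.var (o + 46) + .var (o + 4) + .var (o + 16)) 1 ;;
          Prog.setReal (o + 4) (.var (o + 46) + .var (o + 4) + .var (o + 16))
            (.get (o + 2) (.var (o + 16) * .var (o + 4) + .var (o + 18)) +
              .get (o + 4) (.var (o + 46) + .var (o + 18))))
        Prog.skip))

@[simp] theorem natWrites_negRelax (o : ℕ) :
    (negRelax o).natWrites = [o + 16, o + 10, o + 10, o + 18, o + 10, o + 18, o + 16] := rfl
@[simp] theorem realWrites_negRelax (o : ℕ) :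
    (negRelax o).realWrites = [o + 4, o + 4] := rfl

/-- The level at offset `b` is only read; the next one starts as a copy of it, with status reduced
to at most `1`, and is then minimized over the negative edges. The inner invariant restricts the
second part of `negStep` to the heads `u < j`. -/
theorem run_negRelax {W n o b : ℕ} {X : FrozenGraph n} {s : Mem} (hG : HasGraph o X s)
    (hb : s.nat (o + 46) 0 = b) (hW : b + n + n ≤ W) (hW2 : 2 ≤ W) {S : Fin n → Set ℝ}
    (hS : ∀ v : Fin n, IsLab (S v) (s.nat (o + 10) (b + v.val)) (s.real (o + 4) (b + v.val))) :
    Run W (negRelax o) s (fun t s' => t ≤ 400 * (n + 1) ^ 2 ∧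
      (∀ v : Fin n, IsLab (X.negStep S v) (s'.nat (o + 10) (b + n + v.val))
        (s'.real (o + 4) (b + n + v.val)) ∧ s'.nat (o + 10) (b + n + v.val) ≤ 1) ∧
      ∀ i, i < b + n →
        s'.nat (o + 10) i = s.nat (o + 10) i ∧ s'.real (o + 4) i = s.real (o + 4) i) := by
  have hn := hG.size
  unfold negRelax
  refine (run_forN_const (N := n) (T := 250 * n + 100) (fun k s' =>
      (∀ v : Fin n, v.val < k → IsLab (X.negStep S v) (s'.nat (o + 10) (b + n + v.val))
        (s'.real (o + 4) (b + n + v.val)) ∧ s'.nat (o + 10) (b + n + v.val) ≤ 1) ∧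
      ∀ i, i < b + n →
        s'.nat (o + 10) i = s.nat (o + 10) i ∧ s'.real (o + 4) i = s.real (o + 4) i)
    (by omega) ?_ ?_ ?_ ?_).mono ?_
  · intro s' hF
    have := hF.nat (o + 4) (by simp [Prog.natWrites])
    simp [this, hn]
  · simp [Prog.natWrites]
  · simp
  · rintro k s' hk ⟨hI, ho⟩ hk' hF
    have h4 := hF.nat (o + 4) (by simp [Prog.natWrites])
    have h2 := hF.nat (o + 2) (by simp [Prog.natWrites])
    have h46 := hF.nat (o + 46) (by simp [Prog.natWrites])
    have hr := hF.real (o + 2) (by simp [Prog.realWrites])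
    have hG' : HasGraph o X s' := hG.congr h4 h2 hr
    have hb' : s'.nat (o + 46) 0 = b := by rw [h46, hb]
    have hn' := hG'.size
    obtain ⟨v, rfl⟩ : ∃ v : Fin n, v.val = k := ⟨⟨k, hk⟩, rfl⟩
    have hSv := hS v
    rw [← (ho _ (by omega : b + v.val < b + n)).1, ← (ho _ (by omega : b + v.val < b + n)).2]
      at hSv
    -- Both branches write the same cell, so the memory after the conditional is described by a
    -- single update and the rest is verified only once.
    refine Run.seq (Q := fun t s1 => t ≤ 60 ∧ IsLab (S v) (s1.nat (o + 10) (b + n + v.val))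
        (s'.real (o + 4) (b + v.val)) ∧ s1.nat (o + 10) (b + n + v.val) ≤ 1 ∧
        (∃ x, s1 = s'.setNat (o + 10) (b + n + v.val) x)) ?_ ?_
    · have hW' : b + n + v.val ≤ W := by omega
      have hW1 : 1 ≤ W := by omega
      simp [hb', hn', hk', hW', hW1]
      constructor
      · intro h1
        exact ⟨fun _ => hSv.least (by omega), by simp⟩
      · intro h1
        exact ⟨by simp, fun _ => hSv.empty h1⟩
    rintro t1 s1 ⟨ht1, hl1, hle1, x1, rfl⟩
    have hW' : b + n + v.val ≤ W := by omega
    simp only [Mem.nat_setNat, if_true] at hl1 hle1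
    simp only [Function.update_self] at hl1 hle1
    simp only [run_seq, run_setReal]
    refine ⟨by simp [hb', hn', hk']; omega, ?_⟩
    refine (run_forN_const (N := n) (T := 200) (fun j s2 =>
      IsLab (S v ∪ {x | ∃ u : Fin n, u.val < j ∧ X.Neg v u ∧ ∃ y ∈ S u, X.weight v u + y = x})
        (s2.nat (o + 10) (b + n + v.val)) (s2.real (o + 4) (b + n + v.val)) ∧
      s2.nat (o + 10) (b + n + v.val) ≤ 1 ∧
      ∀ i, i ≠ b + n + v.val →
        s2.nat (o + 10) i = s'.nat (o + 10) i ∧ s2.real (o + 4) i = s'.real (o + 4) i)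
      (by omega) ?_ ?_ ?_ ?_).mono ?_
    · intro s2 hF
      have := hF.nat (o + 4) (by simp [Prog.natWrites])
      simp [this, hn']
    · simp [Prog.natWrites]
    · simp [hb', hn', hk', hl1, hle1]
      intro i hi
      simp [hi]
    · rintro j s2 hj ⟨J1, J2, J3⟩ hj' hF2
      have h4 := hF2.nat (o + 4) (by simp [Prog.natWrites])
      have h2 := hF2.nat (o + 2) (by simp [Prog.natWrites])
      have h46 := hF2.nat (o + 46) (by simp [Prog.natWrites])
      have h16 := hF2.nat (o + 16) (by simp [Prog.natWrites])
      have hr := hF2.real (o + 2) (by simp [Prog.realWrites])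
      simp at h4 h2 h46 h16 hr
      obtain ⟨u, rfl⟩ : ∃ u : Fin n, u.val = j := ⟨⟨j, hj⟩, rfl⟩
      have hadj := hG'.adj v u
      have hu1 := J3 (b + u.val) (by omega)
      rw [(ho (b + u.val) (by omega)).1, (ho (b + u.val) (by omega)).2] at hu1
      have hSu := hS u
      have hset : (S v ∪ {x | ∃ u' : Fin n, u'.val < u.val + 1 ∧ X.Neg v u' ∧
            ∃ y ∈ S u', X.weight v u' + y = x}) =
          (S v ∪ {x | ∃ u' : Fin n, u'.val < u.val ∧ X.Neg v u' ∧
            ∃ y ∈ S u', X.weight v u' + y = x}) ∪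
          {x | X.Neg v u ∧ ∃ y ∈ S u, X.weight v u + y = x} := by
        ext x
        simp only [Set.mem_union, Set.mem_ofPred_eq, or_assoc]
        refine or_congr_right ?_
        constructor
        · rintro ⟨u', hu', h⟩
          rcases Nat.lt_succ_iff_lt_or_eq.mp hu' with hu' | hu'
          · exact Or.inl ⟨u', hu', h⟩
          · obtain rfl := Fin.ext hu'
            exact Or.inr h
        · rintro (⟨u', hu', h⟩ | h)
          · exact ⟨u', by omega, h⟩
          · exact ⟨u, by omega, h⟩
      rw [run_cond]
      have hcond : (BExp.conj (.natEq (.get (o + 2) (.var (o + 16) * .var (o + 4) +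
              .var (o + 18))) 2)
          (.conj (.natLE 1 (.get (o + 10) (.var (o + 46) + .var (o + 18))))
            (.disj (.natEq (.get (o + 10) (.var (o + 46) + .var (o + 4) + .var (o + 16))) 0)
              (.realLT (.get (o + 2) (.var (o + 16) * .var (o + 4) + .var (o + 18)) +
                  .get (o + 4) (.var (o + 46) + .var (o + 18)))
                (.get (o + 4) (.var (o + 46) + .var (o + 4) + .var (o + 16))))))).eval s2 ↔
          X.Neg v u ∧ s.nat (o + 10) (b + u.val) ≠ 0 ∧ (s2.nat (o + 10) (b + n + v.val) = 0 ∨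
            X.weight v u + s.real (o + 4) (b + u.val) < s2.real (o + 4) (b + n + v.val)) := by
        simp [h4, h2, h46, h16, hr, hb', hn', hk', hj', hadj, edgeCode_eq_two, hu1,
          Nat.one_le_iff_ne_zero]
        intro hN _
        rw [hG'.weight v u (X.adj_of_neg _ _ hN)]
      constructor
      · intro hc
        obtain ⟨hN, h0, hlt⟩ := hcond.mp hc
        have hw := hG'.weight v u (X.adj_of_neg _ _ hN)
        have hW1 : 1 ≤ W := by omega
        simp [h4, h46, h16, hr, hb', hn', hk', hj', hW', hW1]
        refine ⟨?_, ?_⟩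
        · have := (J1.insert hSu h0 hlt).congr
            (S' := S v ∪ {x | ∃ u' : Fin n, u'.val < u.val + 1 ∧ X.Neg v u' ∧
            ∃ y ∈ S u', X.weight v u' + y = x}) (by rw [hset]; simp [hN])
          simpa [Order.lt_add_one_iff, hw, hu1.2] using this
        · intro i hi
          simp [hi]
          exact J3 i hi
      · intro hc
        rw [hcond] at hc
        simp
        refine ⟨?_, J2, J3⟩
        by_cases hN : X.Neg v u
        · have := (J1.insert_of_le (w := X.weight v u) hSu (fun h0 => ?_)).congr
            (S' := S v ∪ {x | ∃ u' : Fin n, u'.val < u.val + 1 ∧ X.Neg v u' ∧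
            ∃ y ∈ S u', X.weight v u' + y = x}) (by rw [hset]; simp [hN])
          · simpa [Order.lt_add_one_iff] using this
          · by_contra h3
            apply hc
            refine ⟨hN, h0, ?_⟩
            by_contra h5
            push Not at h5
            exact h3 h5
        · have := J1.congr (S' := S v ∪ {x | ∃ u' : Fin n, u'.val < u.val + 1 ∧ X.Neg v u' ∧
            ∃ y ∈ S u', X.weight v u' + y = x}) (by rw [hset]; simp [hN])
          simpa [Order.lt_add_one_iff] using this
    · rintro t2 s2 ⟨⟨J1, J2, J3⟩, ht2⟩
      simp only [NExp.cost_var, NExp.cost_add, RExp.cost_get] at ht2 ⊢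
      simp
      have hset : (S v ∪ {x | ∃ u' : Fin n, u'.val < n ∧ X.Neg v u' ∧
          ∃ y ∈ S u', X.weight v u' + y = x}) = X.negStep S v := by
        simp [negStep]
      rw [hset] at J1
      refine ⟨by nlinarith, ?_, ?_⟩
      · intro x hx
        rcases hx.eq_or_lt with rfl | hx
        · exact ⟨J1, J2⟩
        · rw [(J3 _ _).1, (J3 _ _).2]
          · exact hI x hx
          · have := Fin.val_ne_of_ne hx.ne; omega
          · have := Fin.val_ne_of_ne hx.ne; omega
      · intro i hi
        rw [(J3 _ _).1, (J3 _ _).2]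
        · exact ho i hi
        · omega
        · omega
  · rintro t s' ⟨⟨hI, ho⟩, ht⟩
    simp only [NExp.cost_var] at ht
    exact ⟨by nlinarith, fun v => hI v v.isLt, ho⟩

/-- Compute the hop-bounded distances of all levels; level `k` is stored from offset `k * n` on. -/
def levels (o : ℕ) : Prog :=
  Prog.setNat (o + 46) 0 0 ;; dijkstra o ;;
  forN (o + 12) (.var (o + 48))
    (negRelax o ;; Prog.setNat (o + 46) 0 (.var (o + 46) + .var (o + 4)) ;; dijkstra o)

@[simp] theorem natWrites_levels (o : ℕ) :
    (levels o).natWrites = [o + 46] ++ (dijkstra o).natWrites ++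
      (o + 12) :: (((negRelax o).natWrites ++ ([o + 46] ++ (dijkstra o).natWrites)) ++ [o + 12]) :=
  rfl
@[simp] theorem realWrites_levels (o : ℕ) :
    (levels o).realWrites = [o + 4, o + 4, o + 4, o + 4] := rfl

/-- The level after `k` rounds is `termWeights T k`: `zeroClosure_indicator` starts the recursion
and `zeroClosure_negStep` continues it. The terminal set `T` is arbitrary because potentials need
all vertices and reports need a single one. -/
theorem run_levels {W n o K : ℕ} {X : FrozenGraph n} {s : Mem} (hG : HasGraph o X s)
    (hK : s.nat (o + 48) 0 = K) (hW : (K + 2) * (n + 1) ≤ W) (hW2 : 2 ≤ W) (T : Fin n → Prop)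
    (hT : ∀ v : Fin n, IsLab {x : ℝ | T v ∧ x = 0} (s.nat (o + 10) v.val) (s.real (o + 4) v.val))
    (hT1 : ∀ v : Fin n, s.nat (o + 10) v.val ≤ 1) :
    Run W (levels o) s (fun t s' => t ≤ 1000 * ((K + 1) * (n + 1) ^ 2) ∧
      ∀ k ≤ K, ∀ v : Fin n, IsLab (X.termWeights T k v) (s'.nat (o + 10) (k * n + v.val))
        (s'.real (o + 4) (k * n + v.val))) := by
  have hn := hG.size
  have hK' : K * n + n + n ≤ W := by nlinarith
  unfold levels
  simp only [run_seq, run_setNat]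
  refine ⟨by simp, by simp, ?_⟩
  refine (run_dijkstra (W := W) (b := 0) (B := fun v => {x : ℝ | T v ∧ x = 0})
    (hG.congr (by simp) (by simp) (by simp)) (by simp) (by omega) hW2 (by simpa using hT)
    (by simpa using hT1)).frame.mono ?_
  rintro t1 s1 ⟨⟨ht1, hl, -⟩, hF1⟩
  have h4 := hF1.nat (o + 4) (by simp)
  have h2 := hF1.nat (o + 2) (by simp)
  have h46 := hF1.nat (o + 46) (by simp)
  have h48 := hF1.nat (o + 48) (by simp)
  have hr := hF1.real (o + 2) (by simp)
  simp at h4 h2 h46 h48 hr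
  simp only [zeroClosure_indicator, zero_add] at hl
  refine (run_forN_const (N := K) (T := 900 * (n + 1) ^ 2) (fun k s' =>
      s'.nat (o + 46) 0 = k * n ∧
      ∀ j ≤ k, ∀ v : Fin n, IsLab (X.termWeights T j v) (s'.nat (o + 10) (j * n + v.val))
        (s'.real (o + 4) (j * n + v.val)))
    (by nlinarith) ?_ ?_ ?_ ?_).mono ?_
  · intro s' hF
    have := hF.nat (o + 48) (by simp [Prog.natWrites])
    simp [this, h48, hK]
  · simp [Prog.natWrites]
  · simp [h46]
    exact hl
  · rintro k s' hk ⟨hb, hI⟩ hk' hF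
    have h4' := hF.nat (o + 4) (by simp [Prog.natWrites])
    have h2' := hF.nat (o + 2) (by simp [Prog.natWrites])
    have hr' := hF.real (o + 2) (by simp [Prog.realWrites])
    have hkK : (k + 1) * n ≤ K * n := Nat.mul_le_mul_right _ hk
    rw [add_mul, one_mul] at hkK
    have hG' : HasGraph o X s' := hG.congr (h4'.trans h4) (h2'.trans h2) (hr'.trans hr)
    refine (run_negRelax hG' hb (by omega) hW2 (hI k le_rfl)).frame.seq ?_
    rintro t2 s2 ⟨⟨ht2, hl2, ho2⟩, hF2⟩
    have h4'' := hF2.nat (o + 4) (by simp)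
    have h2'' := hF2.nat (o + 2) (by simp)
    have h46'' := hF2.nat (o + 46) (by simp)
    have hr'' := hF2.real (o + 2) (by simp)
    have hG2 : HasGraph o X s2 := hG'.congr h4'' h2'' hr''
    have hn2 := hG2.size
    simp only [run_seq, run_setNat]
    refine ⟨by simp, by simp [h46'', hb, hn2]; omega, ?_⟩
    refine (run_dijkstra (W := W) (b := k * n + n) (B := X.negStep (X.termWeights T k))
      (hG2.congr (by simp) (by simp) (by simp)) (by simp [h46'', hb, hn2]) (by omega) hW2 ?_
      ?_).frame.mono ?_
    · intro v; simpa using (hl2 v).1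
    · intro v; simpa using (hl2 v).2
    rintro t3 s3 ⟨⟨ht3, hl3, ho3⟩, hF3⟩
    have h46''' := hF3.nat (o + 46) (by simp)
    simp [h46'', hb, hn2] at h46'''
    simp only [NExp.cost_ofNat, NExp.cost_var, NExp.cost_add]
    have hpos : 1 ≤ (n + 1) ^ 2 := Nat.one_le_pow _ _ (by omega)
    refine ⟨by nlinarith, by simp [h46''']; ring, ?_⟩
    intro j hj v
    simp only [Mem.nat_setNat, Mem.real_setNat, Nat.add_left_cancel_iff, Nat.reduceEqDiff, if_false]
    rcases hj.eq_or_lt with rfl | hj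
    · have := hl3 v
      rw [zeroClosure_negStep] at this
      rwa [add_mul, one_mul]
    · have hjk : j * n ≤ k * n := Nat.mul_le_mul_right _ (by omega)
      have hlt : j * n + v.val < k * n + n := by omega
      have h3 := ho3 _ (Or.inl hlt)
      have h2 := ho2 _ hlt
      simp at h3
      rw [h3.1, h3.2, h2.1, h2.2]
      exact hI j (by omega) v
  · rintro t s' ⟨⟨hb, hI⟩, ht⟩
    simp only [NExp.cost_var, NExp.cost_ofNat] at ht ⊢
    have hpos : 1 ≤ (n + 1) ^ 2 := Nat.one_le_pow _ _ (by omega)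
    exact ⟨by nlinarith, hI⟩

end RealRAM

/-! ### Sorting by a tournament tree -/

namespace RealRAM

open FrozenGraph

open Classical in
/-- The winner of `a` and `b`: the one with the smaller key; numbers that are at least `n` stand for
no competitor. -/
noncomputable def winner (n : ℕ) (key : ℕ → ℝ) (a b : ℕ) : ℕ :=
  if a < n ∧ (n ≤ b ∨ key a ≤ key b) then a else b

/-- The nodes of the tree `t` except those in `E` hold the winner of their children. -/
def IsTree (n : ℕ) (key : ℕ → ℝ) (t : ℕ → ℕ) (E : ℕ → Prop) : Prop :=
  ∀ y, 1 ≤ y → y < n → ¬ E y → t y = winner n key (t (2 * y)) (t (2 * y + 1))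

theorem winner_eq (n : ℕ) (key : ℕ → ℝ) (a b : ℕ) :
    winner n key a b = a ∨ winner n key a b = b := by
  unfold winner
  split_ifs <;> simp

theorem winner_left {n : ℕ} {key : ℕ → ℝ} {a b : ℕ} (h : a < n) :
    winner n key a b < n ∧ key (winner n key a b) ≤ key a := by
  unfold winner
  split_ifs with h1
  · exact ⟨h, le_rfl⟩
  · push Not at h1
    have := h1 h
    exact ⟨this.1, this.2.le⟩

theorem winner_right {n : ℕ} {key : ℕ → ℝ} {a b : ℕ} (h : b < n) :
    winner n key a b < n ∧ key (winner n key a b) ≤ key b := by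
  unfold winner
  split_ifs with h1
  · exact ⟨h1.1, h1.2.resolve_left (by omega)⟩
  · exact ⟨h, le_rfl⟩

/-- Climb from `x` by halving: every parent holds a competitor whose key is at most that of the
child. -/
theorem IsTree.root_le {n : ℕ} {key : ℕ → ℝ} {t : ℕ → ℕ} (h : IsTree n key t fun _ => False)
    {x : ℕ} (hx1 : 1 ≤ x) (hx : x < 2 * n) (ht : t x < n) : t 1 < n ∧ key (t 1) ≤ key (t x) := by
  induction x using Nat.strong_induction_on with
  | _ x ih =>
    rcases hx1.eq_or_lt with rfl | hx2
    · exact ⟨ht, le_rfl⟩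
    have hp := h (x / 2) (by omega) (by omega) not_false
    have key2 : t (x / 2) < n ∧ key (t (x / 2)) ≤ key (t x) := by
      rw [hp]
      rcases Nat.even_or_odd' x with ⟨m, rfl | rfl⟩
      · rw [show 2 * m / 2 = m by omega]
        exact winner_left ht
      · rw [show (2 * m + 1) / 2 = m by omega]
        exact winner_right ht
    obtain ⟨h1, h2⟩ := ih (x / 2) (by omega) (by omega) (by omega) key2.1
    exact ⟨h1, h2.trans key2.2⟩

/-- Descend to the child whose entry won until a leaf is reached. The nodes `1, …, n - 1` are
internal and `n, …, 2 * n - 1` are leaves, for any `n`, not only for powers of two. -/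
theorem IsTree.exists_leaf {n : ℕ} {key : ℕ → ℝ} {t : ℕ → ℕ} (h : IsTree n key t fun _ => False)
    {x : ℕ} (hx1 : 1 ≤ x) (hx : x < 2 * n) : ∃ v < n, t (n + v) = t x := by
  by_cases hxn : n ≤ x
  · exact ⟨x - n, by omega, by rw [show n + (x - n) = x by omega]⟩
  · rcases winner_eq n key (t (2 * x)) (t (2 * x + 1)) with h1 | h1
    · obtain ⟨v, hv, hv'⟩ := h.exists_leaf (x := 2 * x) (by omega) (by omega)
      exact ⟨v, hv, by rw [hv', h x hx1 (by omega) not_false, h1]⟩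
    · obtain ⟨v, hv, hv'⟩ := h.exists_leaf (x := 2 * x + 1) (by omega) (by omega)
      exact ⟨v, hv, by rw [hv', h x hx1 (by omega) not_false, h1]⟩
termination_by 2 * n - x

/-- Restore the tree on the way from the position in array `o + 22` to the root. -/
def climb (o : ℕ) : Prog :=
  Prog.loop (.natLE 1 (.var (o + 22)))
    (Prog.cond
      (.conj (.natLT (.get (o + 20) (2 * .var (o + 22))) (.var (o + 4)))
        (.disj (.natLE (.var (o + 4)) (.get (o + 20) (2 * .var (o + 22) + 1)))
          (.realLE (.get (o + 6) (.get (o + 20) (2 * .var (o + 22))))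
            (.get (o + 6) (.get (o + 20) (2 * .var (o + 22) + 1))))))
      (Prog.setNat (o + 20) (.var (o + 22)) (.get (o + 20) (2 * .var (o + 22))))
      (Prog.setNat (o + 20) (.var (o + 22)) (.get (o + 20) (2 * .var (o + 22) + 1))) ;;
    Prog.setNat (o + 22) 0 (.var (o + 22) / 2))

/-- Only the ancestors `x / 2 ^ i` of the changed leaf can be wrong. A round repairs the lowest of
them and halves the position, so the number of rounds is at most the depth `L`. -/
theorem run_climb {W n o L : ℕ} {s : Mem} (hn : s.nat (o + 4) 0 = n) (hW : n ≤ W)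
    (hL : n ≤ 2 ^ L) (hx : s.nat (o + 22) 0 < n)
    (hle : ∀ i < 2 * n, s.nat (o + 20) i ≤ n)
    (hT : IsTree n (s.real (o + 6)) (s.nat (o + 20)) fun y => ∃ i, y = s.nat (o + 22) 0 / 2 ^ i) :
    Run W (climb o) s (fun t s' => t ≤ 100 * L + 10 ∧
      IsTree n (s.real (o + 6)) (s'.nat (o + 20)) (fun _ => False) ∧
      (∀ i < 2 * n, s'.nat (o + 20) i ≤ n) ∧
      ∀ i, n ≤ i → s'.nat (o + 20) i = s.nat (o + 20) i) := by
  unfold climb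
  refine (run_loop (fun τ s' => s'.nat (o + 22) 0 < n ∧ (∀ i < 2 * n, s'.nat (o + 20) i ≤ n) ∧
      IsTree n (s.real (o + 6)) (s'.nat (o + 20)) (fun y => ∃ i, y = s'.nat (o + 22) 0 / 2 ^ i) ∧
      (∀ i, n ≤ i → s'.nat (o + 20) i = s.nat (o + 20) i) ∧
      ∃ l, s'.nat (o + 22) 0 < 2 ^ l ∧ τ + 100 * l ≤ 100 * L)
    (fun s' => s'.nat (o + 22) 0) ⟨hx, hle, hT, fun _ _ => rfl, L, by omega, by omega⟩ ?_).mono ?_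
  · rintro τ s' ⟨I1, I2, I3, I4, l, hl, hτ⟩ hF hb
    have h4 := hF.nat (o + 4) (by simp [Prog.natWrites])
    have h6 := hF.real (o + 6) (by simp [Prog.realWrites])
    generalize hxx : s'.nat (o + 22) 0 = x at *
    have hx1 : 1 ≤ x := by simpa [hxx] using hb
    have hl0 : l ≠ 0 := by rintro rfl; simp at hl; omega
    obtain ⟨l, rfl⟩ := Nat.exists_eq_succ_of_ne_zero hl0
    have hx2 : x / 2 < 2 ^ l := by
      rw [pow_succ] at hl; omega
    -- Both branches write the winner of the two children, so the invariant is restored once for a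
    -- generic winner `z`.
    have main : ∀ z, z = winner n (s.real (o + 6)) (s'.nat (o + 20) (2 * x))
        (s'.nat (o + 20) (2 * x + 1)) → z ≤ n ∧
        (∀ i < 2 * n, Function.update (s'.nat (o + 20)) x z i ≤ n) ∧
        IsTree n (s.real (o + 6)) (Function.update (s'.nat (o + 20)) x z)
          (fun y => ∃ i, y = x / 2 / 2 ^ i) ∧
        ∀ i, n ≤ i → Function.update (s'.nat (o + 20)) x z i = s.nat (o + 20) i := by
      intro z hz
      have hzn : z ≤ n := by
        rcases winner_eq n (s.real (o + 6)) (s'.nat (o + 20) (2 * x))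
          (s'.nat (o + 20) (2 * x + 1)) with h | h
        · rw [hz, h]; exact I2 _ (by omega)
        · rw [hz, h]; exact I2 _ (by omega)
      refine ⟨hzn, ?_, ?_, ?_⟩
      · intro i hi
        by_cases hix : i = x
        · subst hix; simpa using hzn
        · simpa [hix] using I2 i hi
      · intro y hy1 hy hE
        have hE' : ∀ i, y ≠ x / 2 / 2 ^ i := fun i h => hE ⟨i, h⟩
        -- The case `i = 0` excludes the parent of `x`, the only node one of whose children has just
        -- changed.
        have h2 : 2 * y ≠ x := fun h => hE' 0 (by simp; omega)
        have h3 : 2 * y + 1 ≠ x := fun h => hE' 0 (by simp; omega)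
        by_cases hyx : y = x
        · subst hyx
          have h4 : 2 * y ≠ y := by omega
          have h5 : 2 * y + 1 ≠ y := by omega
          simpa [h4, h5] using hz
        · simp only [Function.update_of_ne hyx, Function.update_of_ne h2, Function.update_of_ne h3]
          refine I3 y hy1 hy ?_
          rintro ⟨i, hi⟩
          cases i with
          | zero => simp at hi; exact hyx hi
          | succ i =>
            refine hE' i ?_
            rw [hi, pow_succ', Nat.div_div_eq_div_mul]
      · intro i hi
        rw [Function.update_of_ne (by omega)]
        exact I4 i hi
    have hw : (s'.nat (o + 20) (2 * x) < n ∧ (n ≤ s'.nat (o + 20) (2 * x + 1) ∨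
        s.real (o + 6) (s'.nat (o + 20) (2 * x)) ≤ s.real (o + 6) (s'.nat (o + 20) (2 * x + 1))) →
        s'.nat (o + 20) (2 * x) = winner n (s.real (o + 6)) (s'.nat (o + 20) (2 * x))
        (s'.nat (o + 20) (2 * x + 1))) ∧ (¬ (s'.nat (o + 20) (2 * x) < n ∧
        (n ≤ s'.nat (o + 20) (2 * x + 1) ∨
        s.real (o + 6) (s'.nat (o + 20) (2 * x)) ≤ s.real (o + 6) (s'.nat (o + 20) (2 * x + 1)))) →
        s'.nat (o + 20) (2 * x + 1) = winner n (s.real (o + 6)) (s'.nat (o + 20) (2 * x))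
        (s'.nat (o + 20) (2 * x + 1))) := by
      exact ⟨fun h => by rw [winner, if_pos h], fun h => by rw [winner, if_neg h]⟩
    simp only [run_seq, run_cond, run_setNat, BExp.eval_conj, BExp.eval_disj, BExp.eval_natLT,
      BExp.eval_natLE, BExp.eval_realLE, NExp.eval_get, NExp.eval_mul, NExp.eval_ofNat,
      NExp.eval_var, NExp.eval_add, NExp.eval_div, RExp.eval_get, h4, h6, hn, hxx]
    constructor
    · intro hc
      obtain ⟨m1, m2, m3, m4⟩ := main _ (hw.1 hc)
      simp [hxx]
      exact ⟨by omega, by omega, by omega, ⟨by omega, by simpa using m2, m3, m4, l, hx2, by omega⟩,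
        by omega⟩
    · intro hc
      obtain ⟨m1, m2, m3, m4⟩ := main _ (hw.2 hc)
      simp [hxx]
      exact ⟨by omega, by omega, by omega, ⟨by omega, by simpa using m2, m3, m4, l, hx2, by omega⟩,
        by omega⟩
  · rintro t s' ⟨τ, ⟨I1, I2, I3, I4, l, hl, hτ⟩, hb, ht⟩
    simp at hb ht
    refine ⟨by omega, ?_, I2, I4⟩
    intro y hy1 hy _
    refine I3 y hy1 hy ?_
    rintro ⟨i, hi⟩
    rw [hb, Nat.zero_div] at hi
    omega

/-- Write the value of `e` to the leaf of the vertex in array `o + 16`. -/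
def setLeaf (o : ℕ) (e : NExp) : Prog :=
  Prog.setNat (o + 20) (.var (o + 4) + .var (o + 16)) e ;;
  Prog.setNat (o + 22) 0 ((.var (o + 4) + .var (o + 16)) / 2) ;;
  climb o

@[simp] theorem natWrites_setLeaf (o : ℕ) (e : NExp) :
    (setLeaf o e).natWrites = [o + 20, o + 22, o + 20, o + 20, o + 22] := rfl
@[simp] theorem realWrites_setLeaf (o : ℕ) (e : NExp) : (setLeaf o e).realWrites = [] := rfl

theorem run_setLeaf {W n o L v x : ℕ} {e : NExp} {s : Mem} (hn : s.nat (o + 4) 0 = n)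
    (hW : 2 * n ≤ W) (hL : n ≤ 2 ^ L) (hv : s.nat (o + 16) 0 = v) (hvn : v < n)
    (he : e.eval s = x) (hx : x ≤ n) (hec : e.cost ≤ 10)
    (hle : ∀ i < 2 * n, s.nat (o + 20) i ≤ n)
    (hT : IsTree n (s.real (o + 6)) (s.nat (o + 20)) fun _ => False) :
    Run W (setLeaf o e) s (fun t s' => t ≤ 100 * L + 50 ∧
      IsTree n (s.real (o + 6)) (s'.nat (o + 20)) (fun _ => False) ∧
      (∀ i < 2 * n, s'.nat (o + 20) i ≤ n) ∧
      s'.nat (o + 20) (n + v) = x ∧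
      ∀ i, n ≤ i → i ≠ n + v → s'.nat (o + 20) i = s.nat (o + 20) i) := by
  unfold setLeaf
  have hW1 : n + v ≤ W := by omega
  have hW2 : (n + v) / 2 ≤ W := by omega
  have hW3 : x ≤ W := by omega
  simp only [run_seq, run_setNat]
  simp [hn, hv, he, hW1, hW2, hW3]
  refine (run_climb (n := n) (L := L) (by simpa) (by omega) hL (by simp; omega) ?_ ?_).mono ?_
  · intro i hi
    by_cases hix : i = n + v
    · subst hix; simpa using hx
    · simpa [hix] using hle i hi
  · intro y hy1 hy hE
    simp at hE ⊢
    have h0 := hE 0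
    simp at h0
    have h1 : y ≠ n + v := by omega
    have h2 : 2 * y ≠ n + v := by omega
    have h3 : 2 * y + 1 ≠ n + v := by omega
    simpa [h1, h2, h3] using hT y hy1 hy not_false
  · rintro t s' ⟨ht, I1, I2, I3⟩
    simp at I1 I3
    refine ⟨by omega, I1, I2, ?_, ?_⟩
    · rw [I3 _ (by omega)]; simp
    · intro i hi hiv
      rw [I3 _ hi]; simp [hiv]

end RealRAM

/-! ### Targets of a state and their keys in the tournament tree. -/

namespace RealRAM

open FrozenGraph

/-- The code of the state that is reached from the state `(u, j)` along the edge to `v`. -/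
noncomputable def targetCode {n : ℕ} (X : FrozenGraph n) (j : ℕ) (u v : Fin n) : ℕ :=
  (j + edgeCode X u v / 2) * n + v.val

/-- The edge from `u` to `v` leads from layer `j` to one of the layers `0, …, H`. -/
def IsTarget {n : ℕ} (X : FrozenGraph n) (H j : ℕ) (u v : Fin n) : Prop :=
  X.Adj u v ∧ j + edgeCode X u v / 2 ≤ H

/-- The codes `1` and `2` of edges become `0` and `1` on division by two, so `edgeCode / 2` is the
number of hops of an edge and the program needs no case distinction. -/
theorem layerEdge_iff {n : ℕ} {X : FrozenGraph n} {H j t : ℕ} {u : Fin n} {w : ℝ} :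
    X.LayerEdge H (j * n + u.val) t w ↔
      ∃ v, IsTarget X H j u v ∧ t = targetCode X j u v ∧ w = X.weight u v := by
  unfold LayerEdge IsTarget targetCode
  constructor
  · rintro ⟨u', v, j', hA, hc, rfl, hj, rfl⟩
    obtain rfl : u' = u := by
      have := code_mod j' u'
      rw [← hc, code_mod] at this
      exact Fin.ext this.symm
    obtain rfl : j' = j := by
      have := code_div j' u'
      rw [← hc, code_div] at this
      exact this.symm
    exact ⟨v, ⟨hA, by rw [edgeCode_div_two]; exact hj⟩, by rw [edgeCode_div_two], rfl⟩
  · rintro ⟨v, ⟨hA, hj⟩, rfl, rfl⟩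
    rw [edgeCode_div_two] at hj ⊢
    exact ⟨u, v, j, hA, rfl, rfl, hj, rfl⟩

theorem targetCode_inj {n : ℕ} {X : FrozenGraph n} {j : ℕ} {u v v' : Fin n}
    (h : targetCode X j u v = targetCode X j u v') : v = v' := by
  have := code_mod (j + edgeCode X u v / 2) v
  unfold targetCode at h
  rw [h, code_mod] at this
  exact Fin.ext this.symm

theorem IsTarget.code_lt {n : ℕ} {X : FrozenGraph n} {H j : ℕ} {u v : Fin n}
    (h : IsTarget X H j u v) : targetCode X j u v < (H + 1) * n :=
  FrozenGraph.code_lt h.2 v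

/-- The local variables that determine the state `(u, j)` whose targets are sorted. -/
structure AtState {n : ℕ} (o : ℕ) (X : FrozenGraph n) (H j : ℕ) (u : Fin n) (s : Mem) : Prop where
  graph : HasGraph o X s
  hop : s.nat (o + 6) 0 = H
  states : s.nat (o + 8) 0 = (H + 1) * n
  vertex : s.nat (o + 14) 0 = u.val
  layer : s.nat (o + 42) 0 = j
  code : s.nat (o + 40) 0 = j * n + u.val

theorem AtState.congr {n o : ℕ} {X : FrozenGraph n} {H j : ℕ} {u : Fin n} {s s' : Mem}
    (h : AtState o X H j u s) (h4 : s'.nat (o + 4) = s.nat (o + 4))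
    (h2 : s'.nat (o + 2) = s.nat (o + 2)) (hw : s'.real (o + 2) = s.real (o + 2))
    (h6 : s'.nat (o + 6) = s.nat (o + 6)) (h8 : s'.nat (o + 8) = s.nat (o + 8))
    (h14 : s'.nat (o + 14) = s.nat (o + 14)) (h42 : s'.nat (o + 42) = s.nat (o + 42))
    (h40 : s'.nat (o + 40) = s.nat (o + 40)) : AtState o X H j u s' :=
  ⟨h.graph.congr h4 h2 hw, by rw [h6, h.hop], by rw [h8, h.states], by rw [h14, h.vertex],
    by rw [h42, h.layer], by rw [h40, h.code]⟩

/-- The index of the edge from the current vertex to the vertex in array `o + 16`. -/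
def edgeIndex (o : ℕ) : NExp := .var (o + 14) * .var (o + 4) + .var (o + 16)

/-- The layer that is reached along that edge. -/
def nextLayer (o : ℕ) : NExp := .var (o + 42) + .get (o + 2) (edgeIndex o) / 2

/-- Empty the tree and compute the keys. -/
def initKeys (o : ℕ) : Prog :=
  forN (o + 16) (.var (o + 4) + .var (o + 4))
    (Prog.setNat (o + 20) (.var (o + 16)) (.var (o + 4))) ;;
  forN (o + 16) (.var (o + 4))
    (Prog.setReal (o + 6) (.var (o + 16)) (.get (o + 2) (edgeIndex o) +
      .get (o + 4) ((.var (o + 6) - nextLayer o) * .var (o + 4) + .var (o + 16))))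

@[simp] theorem natWrites_initKeys (o : ℕ) :
    (initKeys o).natWrites = [o + 16, o + 20, o + 16, o + 16, o + 16] := rfl
@[simp] theorem realWrites_initKeys (o : ℕ) : (initKeys o).realWrites = [o + 6] := rfl

/-- The key of `v` is `w + q t`, where `q t` is the label with `H` minus the layer of `t` many hops.
Keys are also written for vertices that are not targets. If the next layer exceeds `H`, the
truncated difference selects level `0`; this is harmless because such vertices are never inserted.
-/
theorem run_initKeys {W n o H j : ℕ} {X : FrozenGraph n} {u : Fin n} {s : Mem}
    (hs : AtState o X H j u s) (hW : 2 * n ≤ W) :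
    Run W (initKeys o) s (fun t s' => t ≤ 130 * n + 40 ∧
      (∀ i < 2 * n, s'.nat (o + 20) i = n) ∧
      ∀ v : Fin n, X.Adj u v → s'.real (o + 6) v.val = X.weight u v +
        s.real (o + 4) ((H - (j + edgeCode X u v / 2)) * n + v.val)) := by
  have hn := hs.graph.size
  unfold initKeys
  rw [run_seq]
  refine (run_forN_const (N := 2 * n) (T := 10) (fun k s' => ∀ i < k, s'.nat (o + 20) i = n)
    hW ?_ ?_ ?_ ?_).frame.mono ?_
  · intro s' hF
    have := hF.nat (o + 4) (by simp [Prog.natWrites])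
    simp [this, hn]; omega
  · simp [Prog.natWrites]
  · simp
  · rintro k s' hk hI hk' hF
    have h4 := hF.nat (o + 4) (by simp [Prog.natWrites])
    have h1 : k ≤ W := by omega
    have h2 : n ≤ W := by omega
    simp [h4, hn, hk', h1, h2]
    intro i hi
    rcases hi.eq_or_lt with rfl | hi
    · simp
    · simp [hi.ne, hI i hi]
  · rintro t s1 ⟨⟨hI, ht⟩, hF⟩
    have hs1 : AtState o X H j u s1 := hs.congr (hF.nat _ (by simp [Prog.natWrites]))
      (hF.nat _ (by simp [Prog.natWrites])) (hF.real _ (by simp [Prog.realWrites]))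
      (hF.nat _ (by simp [Prog.natWrites])) (hF.nat _ (by simp [Prog.natWrites]))
      (hF.nat _ (by simp [Prog.natWrites])) (hF.nat _ (by simp [Prog.natWrites]))
      (hF.nat _ (by simp [Prog.natWrites]))
    have hr4 := hF.real (o + 4) (by simp [Prog.realWrites])
    have hn1 := hs1.graph.size
    refine (run_forN_const (N := n) (T := 50) (fun k s' => ∀ v : Fin n, v.val < k → X.Adj u v →
        s'.real (o + 6) v.val = X.weight u v +
          s.real (o + 4) ((H - (j + edgeCode X u v / 2)) * n + v.val))
      (by omega) ?_ ?_ ?_ ?_).frame.mono ?_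
    · intro s' hF
      have := hF.nat (o + 4) (by simp [Prog.natWrites])
      simp [this, hn1]
    · simp [Prog.natWrites]
    · simp
    · rintro k s' hk hI' hk' hF
      have hs' : AtState o X H j u s' := hs1.congr (hF.nat _ (by simp [Prog.natWrites]))
        (hF.nat _ (by simp [Prog.natWrites])) (hF.real _ (by simp [Prog.realWrites]))
        (hF.nat _ (by simp [Prog.natWrites])) (hF.nat _ (by simp [Prog.natWrites]))
        (hF.nat _ (by simp [Prog.natWrites])) (hF.nat _ (by simp [Prog.natWrites]))
        (hF.nat _ (by simp [Prog.natWrites]))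
      have hr4' := hF.real (o + 4) (by simp [Prog.realWrites])
      obtain ⟨v, rfl⟩ : ∃ v : Fin n, v.val = k := ⟨⟨k, hk⟩, rfl⟩
      have h1 : v.val ≤ W := by omega
      simp [edgeIndex, nextLayer, hs'.graph.size, hs'.vertex, hs'.hop, hs'.layer, hs'.graph.adj,
        hk', hr4', hr4, h1]
      intro x hx hA
      rcases hx.eq_or_lt with rfl | hx
      · simp [hs'.graph.weight u x hA]
      · have : x.val ≠ v.val := Fin.val_ne_of_ne hx.ne
        simp [this]
        exact hI' x hx hA
    · rintro t' s' ⟨⟨hI', ht'⟩, hF'⟩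
      have h20 := hF'.nat (o + 20) (by simp [Prog.natWrites])
      simp only [NExp.cost_var, NExp.cost_add] at ht ht'
      refine ⟨by omega, ?_, fun v => hI' v v.isLt⟩
      rw [h20]
      exact hI

/-- Insert all targets into the tree. -/
def insertLeaves (o : ℕ) : Prog :=
  forN (o + 16) (.var (o + 4))
    (Prog.cond
      (.conj (.natLE 1 (.get (o + 2) (edgeIndex o))) (.natLE (nextLayer o) (.var (o + 6))))
      (setLeaf o (.var (o + 16))) Prog.skip)

@[simp] theorem natWrites_insertLeaves (o : ℕ) : (insertLeaves o).natWrites =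
    [o + 16, o + 20, o + 22, o + 20, o + 20, o + 22, o + 16] := rfl
@[simp] theorem realWrites_insertLeaves (o : ℕ) : (insertLeaves o).realWrites = [] := rfl

theorem run_insertLeaves {W n o H j L : ℕ} {X : FrozenGraph n} {u : Fin n} {s : Mem}
    (hs : AtState o X H j u s) (hW : 2 * n ≤ W) (hL : n ≤ 2 ^ L)
    (ht : ∀ i < 2 * n, s.nat (o + 20) i = n) :
    Run W (insertLeaves o) s (fun t s' => t ≤ n * (100 * L + 120) + 20 ∧
      (∀ i < 2 * n, s'.nat (o + 20) i ≤ n) ∧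
      IsTree n (s.real (o + 6)) (s'.nat (o + 20)) (fun _ => False) ∧
      (∀ v : Fin n, IsTarget X H j u v → s'.nat (o + 20) (n + v.val) = v.val) ∧
      ∀ v : Fin n, ¬ IsTarget X H j u v → s'.nat (o + 20) (n + v.val) = n) := by
  have hn := hs.graph.size
  unfold insertLeaves
  refine (run_forN_const (N := n) (T := 100 * L + 90) (fun k s' =>
      (∀ i < 2 * n, s'.nat (o + 20) i ≤ n) ∧
      IsTree n (s.real (o + 6)) (s'.nat (o + 20)) (fun _ => False) ∧
      (∀ v : Fin n, v.val < k → IsTarget X H j u v → s'.nat (o + 20) (n + v.val) = v.val) ∧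
      ∀ v : Fin n, (k ≤ v.val ∨ ¬ IsTarget X H j u v) → s'.nat (o + 20) (n + v.val) = n)
    (by omega) ?_ ?_ ?_ ?_).mono ?_
  · intro s' hF
    have := hF.nat (o + 4) (by simp [Prog.natWrites])
    simp [this, hn]
  · simp [Prog.natWrites]
  · simp
    refine ⟨fun i hi => (ht i hi).le, ?_, fun v => ht _ (by omega)⟩
    intro y hy1 hy _
    rw [ht y (by omega), ht _ (by omega), ht _ (by omega)]
    simp [winner]
  · rintro k s' hk ⟨I1, I2, I3, I4⟩ hk' hF
    have hs' : AtState o X H j u s' := hs.congr (hF.nat _ (by simp [Prog.natWrites]))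
        (hF.nat _ (by simp [Prog.natWrites])) (hF.real _ (by simp [Prog.realWrites]))
        (hF.nat _ (by simp [Prog.natWrites])) (hF.nat _ (by simp [Prog.natWrites]))
        (hF.nat _ (by simp [Prog.natWrites])) (hF.nat _ (by simp [Prog.natWrites]))
        (hF.nat _ (by simp [Prog.natWrites]))
    have hr6 := hF.real (o + 6) (by simp [Prog.realWrites])
    obtain ⟨v, rfl⟩ : ∃ v : Fin n, v.val = k := ⟨⟨k, hk⟩, rfl⟩
    have hcond : (BExp.conj (.natLE 1 (.get (o + 2) (edgeIndex o)))
        (.natLE (nextLayer o) (.var (o + 6)))).eval s' ↔ IsTarget X H j u v := by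
      simp [edgeIndex, nextLayer, hs'.graph.size, hs'.vertex, hs'.hop, hs'.layer, hs'.graph.adj,
        hk', IsTarget, edgeCode_pos]
    rw [run_cond, hcond]
    constructor
    · intro hv
      refine (run_setLeaf (v := v) (x := v) hs'.graph.size hW hL hk' hk (by simp [hk']) hk.le
        (by simp) I1 (by rw [hr6]; exact I2)).mono ?_
      rintro t1 s1 ⟨ht1, J1, J2, J3, J4⟩
      rw [hr6] at J1
      simp [edgeIndex, nextLayer]
      refine ⟨by omega, J2, J1, ?_, ?_⟩
      · intro x hx hxt
        rcases hx.eq_or_lt with rfl | hx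
        · exact J3
        · rw [J4 _ (by omega) (by have := Fin.val_ne_of_ne hx.ne; omega)]
          exact I3 x hx hxt
      · intro x hx
        have hxv : x ≠ v := by
          rintro rfl
          rcases hx with hx | hx
          · exact lt_irrefl _ hx
          · exact hx hv
        rw [J4 _ (by omega) (by have := Fin.val_ne_of_ne hxv; omega)]
        exact I4 x (hx.imp (fun h => h.le) id)
    · intro hv
      simp [edgeIndex, nextLayer]
      refine ⟨I1, I2, ?_, ?_⟩
      · intro x hx hxt
        rcases hx.eq_or_lt with rfl | hx
        · exact absurd hxt hv
        · exact I3 x hx hxt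
      · intro x hx
        exact I4 x (hx.imp (fun h => h.le) id)
  · rintro t s' ⟨⟨I1, I2, I3, I4⟩, ht⟩
    simp only [NExp.cost_var] at ht
    exact ⟨by nlinarith, I1, I2, fun v => I3 v v.isLt, fun v hv => I4 v (Or.inr hv)⟩

end RealRAM

/-! ### Extraction of the sorted list of targets. -/

namespace RealRAM

open FrozenGraph

/-- The list `ord 0, …, ord n` contains the targets of the state `c` in the order of the keys
`w + q t`, and is filled up with the number of states. -/
structure SortedTargets {n : ℕ} (X : FrozenGraph n) (H : ℕ) (q : ℕ → ℝ) (c : ℕ) (ord : ℕ → ℕ)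
    (skey sw : ℕ → ℝ) : Prop where
  valid : ∀ p ≤ n, ord p = (H + 1) * n ∨
    (ord p < (H + 1) * n ∧ X.LayerEdge H c (ord p) (sw p) ∧ skey p = sw p + q (ord p))
  cover : ∀ p ≤ n, ∀ t w, X.LayerEdge H c t w →
    (∃ p' < p, ord p' = t) ∨ (ord p < (H + 1) * n ∧ skey p ≤ w + q t)
  inj : ∀ p p', p < p' → p' ≤ n → ord p = ord p' → ord p' = (H + 1) * n
  last : ord n = (H + 1) * n

/-- The invariant of the extraction of the sorted list from the tree, after `k` rounds. -/
structure ExtractInv {n : ℕ} (X : FrozenGraph n) (H j : ℕ) (u : Fin n) (key : ℕ → ℝ) (k : ℕ)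
    (t ord : ℕ → ℕ) (skey sw : ℕ → ℝ) : Prop where
  leaf : ∀ v : Fin n, t (n + v.val) = v.val ∨ t (n + v.val) = n
  out : ∀ v : Fin n, t (n + v.val) = n ↔
    ¬ IsTarget X H j u v ∨ ∃ p < k, ord p = targetCode X j u v
  card : k ≤ (Finset.univ.filter fun v : Fin n => t (n + v.val) = n).card
  valid : ∀ p < k, ord p = (H + 1) * n ∨ ∃ v : Fin n, IsTarget X H j u v ∧
    ord p = targetCode X j u v ∧ sw p = X.weight u v ∧ skey p = key v.val
  cover : ∀ p < k, ∀ v : Fin n, IsTarget X H j u v →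
    (∃ p' < p, ord p' = targetCode X j u v) ∨ (ord p < (H + 1) * n ∧ skey p ≤ key v.val)
  inj : ∀ p p', p < p' → p' < k → ord p = ord p' → ord p' = (H + 1) * n

section Extract

variable {n : ℕ} {X : FrozenGraph n} {H j : ℕ} {u : Fin n} {key : ℕ → ℝ} {k : ℕ}
  {t t' ord ord' : ℕ → ℕ} {skey skey' sw sw' : ℕ → ℝ}

/-- The root `r` of the tree has the least key of all targets that are still in the tree, so it may
be the next entry; every other target is either still a leaf or an earlier entry. -/
theorem ExtractInv.found (h : ExtractInv X H j u key k t ord skey sw) {r : Fin n}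
    (hr : t (n + r.val) = r.val) (hmin : ∀ v : Fin n, t (n + v.val) < n → key r.val ≤ key v.val)
    (ht : t' (n + r.val) = n) (ht' : ∀ v : Fin n, v ≠ r → t' (n + v.val) = t (n + v.val))
    (ho : ∀ p < k, ord' p = ord p ∧ skey' p = skey p ∧ sw' p = sw p)
    (hk : ord' k = targetCode X j u r) (hk' : skey' k = key r.val)
    (hk'' : sw' k = X.weight u r) : ExtractInv X H j u key (k + 1) t' ord' skey' sw' := by
  have hrn : t (n + r.val) ≠ n := by have := r.isLt; omega
  have hro := (h.out r).not.mp hrn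
  push Not at hro
  obtain ⟨hrt, hrp⟩ := hro
  constructor
  · intro v
    by_cases hv : v = r
    · subst hv; exact Or.inr ht
    · rw [ht' v hv]; exact h.leaf v
  · intro v
    by_cases hv : v = r
    · subst hv
      simp only [ht, true_iff]
      exact Or.inr ⟨k, by omega, hk⟩
    · rw [ht' v hv, h.out v]
      refine or_congr_right ⟨?_, ?_⟩
      · rintro ⟨p, hp, hp'⟩
        exact ⟨p, by omega, by rw [(ho p hp).1, hp']⟩
      · rintro ⟨p, hp, hp'⟩
        rcases Nat.lt_succ_iff_lt_or_eq.mp hp with hp | rfl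
        · exact ⟨p, hp, by rw [← (ho p hp).1, hp']⟩
        · rw [hk] at hp'
          exact absurd (targetCode_inj hp').symm hv
  · refine Nat.succ_le_of_lt (h.card.trans_lt (Finset.card_lt_card ?_))
    rw [Finset.ssubset_iff_of_subset]
    · exact ⟨r, by simp [ht], by simp [hrn]⟩
    · intro v hv
      simp only [Finset.mem_filter, Finset.mem_univ, true_and] at hv ⊢
      by_cases hvr : v = r
      · subst hvr; exact ht
      · rw [ht' v hvr, hv]
  · intro p hp
    rcases Nat.lt_succ_iff_lt_or_eq.mp hp with hp | rfl
    · rw [(ho p hp).1, (ho p hp).2.1, (ho p hp).2.2]; exact h.valid p hp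
    · exact Or.inr ⟨r, hrt, hk, hk'', hk'⟩
  · intro p hp v hv
    rcases Nat.lt_succ_iff_lt_or_eq.mp hp with hp | rfl
    · rcases h.cover p hp v hv with ⟨p', hp', h'⟩ | h'
      · exact Or.inl ⟨p', hp', by rw [(ho p' (by omega)).1, h']⟩
      · rw [(ho p hp).1, (ho p hp).2.1]; exact Or.inr h'
    · rcases h.leaf v with hl | hl
      · right
        rw [hk, hk']
        exact ⟨hrt.code_lt, hmin v (by have := v.isLt; omega)⟩
      · rcases (h.out v).mp hl with h' | ⟨p', hp', h'⟩
        · exact absurd hv h'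
        · exact Or.inl ⟨p', hp', by rw [(ho p' hp').1, h']⟩
  · intro p p' hpp hp' heq
    rcases Nat.lt_succ_iff_lt_or_eq.mp hp' with hp' | rfl
    · rw [(ho p (by omega)).1, (ho p' hp').1] at heq
      rw [(ho p' hp').1]
      exact h.inj p p' hpp hp' heq
    · rw [(ho p hpp).1, hk] at heq
      exact absurd heq (hrp p hpp)

/-- Once the tree is empty all targets are listed, so the padding entry satisfies `cover` by the
earlier entries. -/
theorem ExtractInv.none (h : ExtractInv X H j u key k t ord skey sw) (hkn : k < n)
    (hn : ∀ v : Fin n, t (n + v.val) = n)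
    (ho : ∀ p < k, ord' p = ord p ∧ skey' p = skey p ∧ sw' p = sw p)
    (hk : ord' k = (H + 1) * n) : ExtractInv X H j u key (k + 1) t ord' skey' sw' := by
  have hall : ∀ v : Fin n, IsTarget X H j u v → ∃ p < k, ord' p = targetCode X j u v := by
    intro v hv
    rcases (h.out v).mp (hn v) with h' | ⟨p, hp, hp'⟩
    · exact absurd hv h'
    · exact ⟨p, hp, by rw [(ho p hp).1, hp']⟩
  constructor
  · exact h.leaf
  · intro v
    simp only [hn v, true_iff]
    by_cases hv : IsTarget X H j u v
    · obtain ⟨p, hp, hp'⟩ := hall v hv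
      exact Or.inr ⟨p, by omega, hp'⟩
    · exact Or.inl hv
  · simp [hn]; omega
  · intro p hp
    rcases Nat.lt_succ_iff_lt_or_eq.mp hp with hp | rfl
    · rw [(ho p hp).1, (ho p hp).2.1, (ho p hp).2.2]; exact h.valid p hp
    · exact Or.inl hk
  · intro p hp v hv
    rcases Nat.lt_succ_iff_lt_or_eq.mp hp with hp | rfl
    · rcases h.cover p hp v hv with ⟨p', hp', h'⟩ | h'
      · exact Or.inl ⟨p', hp', by rw [(ho p' (by omega)).1, h']⟩
      · rw [(ho p hp).1, (ho p hp).2.1]; exact Or.inr h'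
    · exact Or.inl (hall v hv)
  · intro p p' hpp hp' heq
    rcases Nat.lt_succ_iff_lt_or_eq.mp hp' with hp' | rfl
    · rw [(ho p (by omega)).1, (ho p' hp').1] at heq
      rw [(ho p' hp').1]
      exact h.inj p p' hpp hp' heq
    · exact hk

/-- After `n` rounds at least `n` of the `n` leaves are empty. Hence every target is in the list,
which is what `cover` asks for at the last position `n`. -/
theorem ExtractInv.sorted (h : ExtractInv X H j u key n t ord skey sw) {q : ℕ → ℝ}
    (hkey : ∀ v : Fin n, IsTarget X H j u v →
      key v.val = X.weight u v + q (targetCode X j u v))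
    (hlast : ord n = (H + 1) * n) : SortedTargets X H q (j * n + u.val) ord skey sw where
  valid p hp := by
    rcases hp.eq_or_lt with rfl | hp
    · exact Or.inl hlast
    · rcases h.valid p hp with h' | ⟨v, hv, ho, hw, hk⟩
      · exact Or.inl h'
      · refine Or.inr ⟨ho ▸ hv.code_lt, layerEdge_iff.mpr ⟨v, hv, ho, hw⟩, ?_⟩
        rw [hk, hw, ho, hkey v hv]
  cover p hp t' w he := by
    obtain ⟨v, hv, rfl, rfl⟩ := layerEdge_iff.mp he
    rw [← hkey v hv]
    rcases hp.eq_or_lt with rfl | hp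
    · left
      have hall : (Finset.univ.filter fun v : Fin p => t (p + v.val) = p) = Finset.univ := by
        apply Finset.eq_univ_of_card
        exact le_antisymm (Finset.card_le_univ _) (by simpa using h.card)
      have hv' := Finset.mem_univ v
      rw [← hall] at hv'
      simp only [Finset.mem_filter, Finset.mem_univ, true_and] at hv'
      exact ((h.out v).mp hv').resolve_left (fun h' => h' hv)
    · exact h.cover p hp v hv
  inj p p' hpp hp' heq := by
    rcases hp'.eq_or_lt with rfl | hp'
    · exact hlast
    · exact h.inj p p' hpp hp' heq
  last := hlast

end Extract

/-- The index of the entry `p` of the list of the current state. -/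
def listIndex (o : ℕ) (p : NExp) : NExp := .var (o + 40) * (.var (o + 4) + 1) + p

/-- Extract the sorted list from the tree. -/
def extract (o : ℕ) : Prog :=
  forN (o + 44) (.var (o + 4))
    (Prog.setNat (o + 16) 0 (.get (o + 20) 1) ;;
    Prog.cond (.natLT (.var (o + 16)) (.var (o + 4)))
      (Prog.setNat (o + 24) (listIndex o (.var (o + 44)))
          (nextLayer o * .var (o + 4) + .var (o + 16)) ;;
        Prog.setReal (o + 8) (listIndex o (.var (o + 44))) (.get (o + 6) (.var (o + 16))) ;;
        Prog.setReal (o + 10) (listIndex o (.var (o + 44))) (.get (o + 2) (edgeIndex o)) ;;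
        setLeaf o (.var (o + 4)))
      (Prog.setNat (o + 24) (listIndex o (.var (o + 44))) (.var (o + 8))))

@[simp] theorem natWrites_extract (o : ℕ) : (extract o).natWrites =
    [o + 44, o + 16, o + 24, o + 20, o + 22, o + 20, o + 20, o + 22, o + 24, o + 44] := rfl
@[simp] theorem realWrites_extract (o : ℕ) : (extract o).realWrites = [o + 8, o + 10] := rfl

theorem run_extract {W n o H j L : ℕ} {X : FrozenGraph n} {u : Fin n} {s : Mem}
    (hs : AtState o X H j u s) (hj : j ≤ H) (hW : (H + 1) * n * (n + 2) + 2 * n ≤ W)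
    (hL : n ≤ 2 ^ L) (hle : ∀ i < 2 * n, s.nat (o + 20) i ≤ n)
    (hT : IsTree n (s.real (o + 6)) (s.nat (o + 20)) (fun _ => False))
    (hv : ∀ v : Fin n, IsTarget X H j u v → s.nat (o + 20) (n + v.val) = v.val)
    (hv' : ∀ v : Fin n, ¬ IsTarget X H j u v → s.nat (o + 20) (n + v.val) = n) :
    Run W (extract o) s (fun t s' => t ≤ n * (100 * L + 250) + 20 ∧
      ExtractInv X H j u (s.real (o + 6)) n (s'.nat (o + 20))
        (fun p => s'.nat (o + 24) ((j * n + u.val) * (n + 1) + p))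
        (fun p => s'.real (o + 8) ((j * n + u.val) * (n + 1) + p))
        (fun p => s'.real (o + 10) ((j * n + u.val) * (n + 1) + p)) ∧
      ∀ i, i < (j * n + u.val) * (n + 1) →
        s'.nat (o + 24) i = s.nat (o + 24) i ∧ s'.real (o + 8) i = s.real (o + 8) i ∧
        s'.real (o + 10) i = s.real (o + 10) i) := by
  have hn := hs.graph.size
  have hc : j * n + u.val < (H + 1) * n := FrozenGraph.code_lt hj u
  set c := j * n + u.val with hcdef
  have hcn : (c + 1) * (n + 1) ≤ (H + 1) * n * (n + 1) := Nat.mul_le_mul_right _ hc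
  have hcW : c * (n + 1) + n ≤ W := by nlinarith
  have hnn : n ≤ (H + 1) * n := by nlinarith
  unfold extract
  refine (run_forN_const (N := n) (T := 100 * L + 220) (fun k s' =>
      (∀ i < 2 * n, s'.nat (o + 20) i ≤ n) ∧
      IsTree n (s.real (o + 6)) (s'.nat (o + 20)) (fun _ => False) ∧
      ExtractInv X H j u (s.real (o + 6)) k (s'.nat (o + 20))
        (fun p => s'.nat (o + 24) (c * (n + 1) + p)) (fun p => s'.real (o + 8) (c * (n + 1) + p))
        (fun p => s'.real (o + 10) (c * (n + 1) + p)) ∧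
      ∀ i, i < c * (n + 1) →
        s'.nat (o + 24) i = s.nat (o + 24) i ∧ s'.real (o + 8) i = s.real (o + 8) i ∧
        s'.real (o + 10) i = s.real (o + 10) i)
    (by omega) ?_ ?_ ?_ ?_).mono ?_
  · intro s' hF
    have := hF.nat (o + 4) (by simp [Prog.natWrites])
    simp [this, hn]
  · simp [Prog.natWrites]
  · simp
    refine ⟨hle, hT, ?_⟩
    constructor
    · intro v
      by_cases h : IsTarget X H j u v
      · exact Or.inl (hv v h)
      · exact Or.inr (hv' v h)
    · intro v
      by_cases h : IsTarget X H j u v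
      · simp [h, hv v h, v.isLt.ne]
      · simp [h, hv' v h]
    · simp
    · intros; omega
    · intros; omega
    · intros; omega
  · rintro k s' hk ⟨I1, I2, I3, I4⟩ hk' hF
    have hs' : AtState o X H j u s' := hs.congr (hF.nat _ (by simp [Prog.natWrites]))
        (hF.nat _ (by simp [Prog.natWrites])) (hF.real _ (by simp [Prog.realWrites]))
        (hF.nat _ (by simp [Prog.natWrites])) (hF.nat _ (by simp [Prog.natWrites]))
        (hF.nat _ (by simp [Prog.natWrites])) (hF.nat _ (by simp [Prog.natWrites]))
        (hF.nat _ (by simp [Prog.natWrites]))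
    have hr6 := hF.real (o + 6) (by simp [Prog.realWrites])
    obtain ⟨v0, hv0, hv0'⟩ := I2.exists_leaf (x := 1) le_rfl (by omega)
    have hb1 : c * (n + 1) + k ≤ W := by omega
    have ht1 : s'.nat (o + 20) 1 ≤ W := (I1 1 (by omega)).trans (by omega)
    simp only [run_seq, run_setNat, run_cond]
    simp only [BExp.eval_natLT, NExp.eval_var, Mem.nat_setNat, Nat.add_left_cancel_iff,
      Nat.reduceEqDiff, if_true, if_false, NExp.eval_ofNat, NExp.eval_get, Function.update_self,
      hs'.graph.size, Nat.zero_le, true_and]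
    refine ⟨ht1, ?_, ?_⟩
    · intro hlt
      obtain ⟨r, hr⟩ : ∃ r : Fin n, s'.nat (o + 20) 1 = r.val := ⟨⟨_, hlt⟩, rfl⟩
      -- A nonempty leaf holds its own number, so the leaf from which the root value comes is that
      -- of `r`.
      have hvr : v0 = r.val := by
        rcases I3.leaf ⟨v0, hv0⟩ with h | h
        · simp only at h; omega
        · simp only at h; omega
      subst hvr
      rw [hr] at hv0' ht1
      have hadj := hs'.graph.adj u r
      have hrt : IsTarget X H j u r := by
        by_contra h
        have := (I3.out r).mpr (Or.inl h)
        omega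
      have htc := hrt.code_lt
      have hweq := hs'.graph.weight u r hrt.1
      have hcode := hs'.code
      rw [← hcdef] at hcode
      have hcode' : (j + edgeCode X u r / 2) * n + r.val = targetCode X j u r := rfl
      have htW : targetCode X j u r ≤ W := by nlinarith
      simp [listIndex, nextLayer, edgeIndex, hs'.graph.size, hs'.vertex, hs'.layer, hcode, hk',
        hr, hadj, hweq, hr6, hb1, hcode', htW]
      refine (run_setLeaf (n := n) (L := L) (v := r.val) (x := n) (by simp [hs'.graph.size])
        (by omega) hL (by simp) hv0 (by simp [hs'.graph.size]) le_rfl (by simp) (by simpa)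
        (by simpa [hr6] using I2)).frame.mono ?_
      rintro t s2 ⟨⟨ht, J1, J2, J3, J4⟩, hF2⟩
      have h24 := hF2.nat (o + 24) (by simp)
      have h8 := hF2.real (o + 8) (by simp)
      have h10 := hF2.real (o + 10) (by simp)
      simp at h24 h8 h10 J4 J1
      rw [hr6] at J1
      refine ⟨by omega, J2, J1, ?_, ?_⟩
      · refine I3.found (r := r) hv0' ?_ J3 ?_ ?_ ?_ ?_ ?_
        · intro v hv
          have h1 := (I2.root_le (x := n + v.val) (by omega) (by omega) hv).2
          rcases I3.leaf v with h | h
          · rwa [hr, h] at h1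
          · omega
        · intro v hvr
          exact J4 _ (by omega) (by have := Fin.val_ne_of_ne hvr; omega)
        · intro p hp
          rw [h24, h8, h10]
          simp [hp.ne]
        · simp [h24]
        · simp [h8]
        · simp [h10]
      · intro i hi
        rw [h24, h8, h10]
        have : i ≠ c * (n + 1) + k := by omega
        simp [this]
        exact I4 i hi
    · intro hge
      have hnone : ∀ v : Fin n, s'.nat (o + 20) (n + v.val) = n := by
        intro v
        rcases I3.leaf v with h | h
        · have := I2.root_le (x := n + v.val) (by omega) (by omega) (by omega)
          exact absurd this.1 hge
        · exact h
      have hcode := hs'.code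
      rw [← hcdef] at hcode
      have hSW : (H + 1) * n ≤ W := by nlinarith
      simp [listIndex, hs'.graph.size, hcode, hk', hb1, hs'.states, hSW]
      refine ⟨I1, I2, ?_, ?_⟩
      · refine I3.none hk hnone ?_ ?_
        · intro p hp
          simp [hp.ne]
        · simp
      · intro i hi
        have : i ≠ c * (n + 1) + k := by omega
        simp [this]
        exact I4 i hi
  · rintro t s' ⟨⟨I1, I2, I3, I4⟩, ht⟩
    simp only [NExp.cost_var] at ht
    exact ⟨by nlinarith, I3, I4⟩

end RealRAM

/-! ### Sorting the targets of one state and of all states. -/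

namespace RealRAM

open FrozenGraph

/-- Sort the targets of the current state. -/
def sortState (o : ℕ) : Prog :=
  initKeys o ;; insertLeaves o ;; extract o ;;
    Prog.setNat (o + 24) (listIndex o (.var (o + 4))) (.var (o + 8))

@[simp] theorem natWrites_sortState (o : ℕ) : (sortState o).natWrites =
    [o + 16, o + 20, o + 16, o + 16, o + 16] ++
    ([o + 16, o + 20, o + 22, o + 20, o + 20, o + 22, o + 16] ++
    ([o + 44, o + 16, o + 24, o + 20, o + 22, o + 20, o + 20, o + 22, o + 24, o + 44] ++
      [o + 24])) := rfl
@[simp] theorem realWrites_sortState (o : ℕ) :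
    (sortState o).realWrites = [o + 6, o + 8, o + 10] := rfl

theorem run_sortState {W n o H j L : ℕ} {X : FrozenGraph n} {u : Fin n} {s : Mem} {q : ℕ → ℝ}
    (hs : AtState o X H j u s) (hj : j ≤ H) (hW : (H + 1) * n * (n + 2) + 2 * n ≤ W)
    (hL : n ≤ 2 ^ L)
    (hq : ∀ j ≤ H, ∀ v : Fin n, s.real (o + 4) ((H - j) * n + v.val) = q (j * n + v.val)) :
    Run W (sortState o) s (fun t s' => t ≤ n * (200 * L + 500) + 150 ∧
      SortedTargets X H q (j * n + u.val)
        (fun p => s'.nat (o + 24) ((j * n + u.val) * (n + 1) + p))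
        (fun p => s'.real (o + 8) ((j * n + u.val) * (n + 1) + p))
        (fun p => s'.real (o + 10) ((j * n + u.val) * (n + 1) + p)) ∧
      ∀ i, i < (j * n + u.val) * (n + 1) →
        s'.nat (o + 24) i = s.nat (o + 24) i ∧ s'.real (o + 8) i = s.real (o + 8) i ∧
        s'.real (o + 10) i = s.real (o + 10) i) := by
  unfold sortState
  refine (run_initKeys hs (by omega)).frame.seq ?_
  rintro t1 s1 ⟨⟨ht1, hn1, hk1⟩, hF1⟩
  have hs1 : AtState o X H j u s1 := hs.congr (hF1.nat _ (by simp))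
    (hF1.nat _ (by simp)) (hF1.real _ (by simp)) (hF1.nat _ (by simp)) (hF1.nat _ (by simp))
    (hF1.nat _ (by simp)) (hF1.nat _ (by simp)) (hF1.nat _ (by simp))
  have a24 := hF1.nat (o + 24) (by simp)
  have a8 := hF1.real (o + 8) (by simp)
  have a10 := hF1.real (o + 10) (by simp)
  refine (run_insertLeaves hs1 (by omega) hL hn1).frame.seq ?_
  rintro t2 s2 ⟨⟨ht2, hle2, hT2, hv2, hv2'⟩, hF2⟩
  have hs2 : AtState o X H j u s2 := hs1.congr (hF2.nat _ (by simp))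
    (hF2.nat _ (by simp)) (hF2.real _ (by simp)) (hF2.nat _ (by simp)) (hF2.nat _ (by simp))
    (hF2.nat _ (by simp)) (hF2.nat _ (by simp)) (hF2.nat _ (by simp))
  have b24 := hF2.nat (o + 24) (by simp)
  have b8 := hF2.real (o + 8) (by simp)
  have b10 := hF2.real (o + 10) (by simp)
  have b6 := hF2.real (o + 6) (by simp)
  refine (run_extract hs2 hj hW hL hle2 (by rw [b6]; exact hT2) hv2 hv2').frame.seq ?_
  rintro t3 s3 ⟨⟨ht3, hE, ho⟩, hF3⟩
  have hs3 : AtState o X H j u s3 := hs2.congr (hF3.nat _ (by simp))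
    (hF3.nat _ (by simp)) (hF3.real _ (by simp)) (hF3.nat _ (by simp)) (hF3.nat _ (by simp))
    (hF3.nat _ (by simp)) (hF3.nat _ (by simp)) (hF3.nat _ (by simp))
  have hc : j * n + u.val < (H + 1) * n := FrozenGraph.code_lt hj u
  have hcode := hs3.code
  set c := j * n + u.val with hcdef
  have hcn : (c + 1) * (n + 1) ≤ (H + 1) * n * (n + 1) := Nat.mul_le_mul_right _ hc
  have hcW : c * (n + 1) + n ≤ W := by nlinarith
  have hSW : (H + 1) * n ≤ W := by nlinarith
  simp only [run_setNat, listIndex, NExp.eval_add, NExp.eval_mul, NExp.eval_var, hcode,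
    hs3.graph.size, hs3.states, NExp.eval_ofNat, Mem.nat_setNat, Mem.real_setNat, if_true]
  refine ⟨hcW, hSW, ?_, ?_, ?_⟩
  · simp only [NExp.cost_add, NExp.cost_mul, NExp.cost_var, NExp.cost_ofNat]
    have e : n * (200 * L + 500) = n * (100 * L + 120) + n * (100 * L + 250) + 130 * n := by ring
    omega
  · rw [hcdef] at hE ⊢
    -- The final sentinel is written at position `n`, outside the `n` entries that the extraction
    -- invariant mentions.
    have hE' : ExtractInv X H j u (s2.real (o + 6)) n (s3.nat (o + 20))
        (fun p => Function.update (s3.nat (o + 24)) ((j * n + u.val) * (n + 1) + n) ((H + 1) * n)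
          ((j * n + u.val) * (n + 1) + p))
        (fun p => s3.real (o + 8) ((j * n + u.val) * (n + 1) + p))
        (fun p => s3.real (o + 10) ((j * n + u.val) * (n + 1) + p)) := by
      have hupd : ∀ p < n, Function.update (s3.nat (o + 24)) ((j * n + u.val) * (n + 1) + n)
          ((H + 1) * n) ((j * n + u.val) * (n + 1) + p) =
          s3.nat (o + 24) ((j * n + u.val) * (n + 1) + p) := by
        intro p hp
        rw [Function.update_of_ne (by omega)]
      constructor
      · exact hE.leaf
      · intro v
        rw [hE.out v]
        refine or_congr_right (exists_congr fun p => and_congr_right fun hp => ?_)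
        simp only [hupd p hp]
      · exact hE.card
      · intro p hp
        simp only [hupd p hp]
        exact hE.valid p hp
      · intro p hp v hv
        simp only [hupd p hp]
        rcases hE.cover p hp v hv with ⟨p', hp', h⟩ | h
        · exact Or.inl ⟨p', hp', by rw [hupd p' (by omega)]; exact h⟩
        · exact Or.inr h
      · intro p p' hpp hp'
        simp only [hupd p (by omega), hupd p' hp']
        exact hE.inj p p' hpp hp'
    refine hE'.sorted ?_ (by simp)
    intro v hv
    rw [b6, hk1 v hv.1, hq _ hv.2 v]
    rfl
  · intro i hi
    rw [Function.update_of_ne (by omega), (ho i hi).1, (ho i hi).2.1, (ho i hi).2.2, b24, b8, b10,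
      a24, a8, a10]
    exact ⟨rfl, rfl, rfl⟩

/-- Sort the targets of all states. -/
def sortAll (o : ℕ) : Prog :=
  forN (o + 40) (.var (o + 8))
    (Prog.setNat (o + 42) 0 (.var (o + 40) / .var (o + 4)) ;;
    Prog.setNat (o + 14) 0 (.var (o + 40) - .var (o + 42) * .var (o + 4)) ;;
    sortState o)

@[simp] theorem natWrites_sortAll (o : ℕ) : (sortAll o).natWrites =
    (o + 40) :: (([o + 42] ++ ([o + 14] ++ (sortState o).natWrites)) ++ [o + 40]) := rfl
@[simp] theorem realWrites_sortAll (o : ℕ) :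
    (sortAll o).realWrites = [o + 6, o + 8, o + 10] := rfl

theorem exists_code {n H c : ℕ} (hc : c < (H + 1) * n) :
    ∃ j ≤ H, ∃ u : Fin n, c = j * n + u.val ∧ c / n = j ∧ c - j * n = u.val := by
  have hn : 0 < n := Nat.pos_of_ne_zero (by rintro rfl; simp at hc)
  refine ⟨c / n, Nat.lt_succ_iff.mp (Nat.div_lt_of_lt_mul (by rwa [mul_comm])),
    ⟨c % n, Nat.mod_lt _ hn⟩, ?_, rfl, ?_⟩
  · have := Nat.div_add_mod c n
    rw [mul_comm]; exact this.symm
  · have := Nat.div_add_mod c n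
    rw [mul_comm] at this
    simp only
    omega

/-- States are treated in increasing order of their codes. The list of `c` begins at `c * (n + 1)`
and sorting leaves all smaller cells alone, so finished lists survive. -/
theorem run_sortAll {W n o H L : ℕ} {X : FrozenGraph n} {s : Mem} {q : ℕ → ℝ}
    (hG : HasGraph o X s) (hH : s.nat (o + 6) 0 = H) (hS : s.nat (o + 8) 0 = (H + 1) * n)
    (hW : (H + 1) * n * (n + 2) + 2 * n ≤ W) (hL : n ≤ 2 ^ L)
    (hq : ∀ j ≤ H, ∀ v : Fin n, s.real (o + 4) ((H - j) * n + v.val) = q (j * n + v.val)) :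
    Run W (sortAll o) s (fun t s' => t ≤ (H + 1) * n * (n * (200 * L + 500) + 250) + 20 ∧
      ∀ c < (H + 1) * n, SortedTargets X H q c (fun p => s'.nat (o + 24) (c * (n + 1) + p))
        (fun p => s'.real (o + 8) (c * (n + 1) + p))
        (fun p => s'.real (o + 10) (c * (n + 1) + p))) := by
  have hn := hG.size
  have hSW : (H + 1) * n ≤ W := by nlinarith
  unfold sortAll
  refine (run_forN_const (N := (H + 1) * n) (T := n * (200 * L + 500) + 200) (fun k s' =>
      ∀ c < k, SortedTargets X H q c (fun p => s'.nat (o + 24) (c * (n + 1) + p))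
        (fun p => s'.real (o + 8) (c * (n + 1) + p))
        (fun p => s'.real (o + 10) (c * (n + 1) + p)))
    hSW ?_ ?_ ?_ ?_).mono ?_
  · intro s' hF
    have := hF.nat (o + 8) (by simp [Prog.natWrites])
    simp [this, hS]
  · simp [Prog.natWrites]
  · simp
  · rintro k s' hk hI hk' hF
    obtain ⟨j, hj, u, hc, hdiv, hsub⟩ := exists_code hk
    have h4 := hF.nat (o + 4) (by simp [Prog.natWrites])
    have h2 := hF.nat (o + 2) (by simp [Prog.natWrites])
    have h6 := hF.nat (o + 6) (by simp [Prog.natWrites])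
    have h8 := hF.nat (o + 8) (by simp [Prog.natWrites])
    have hr2 := hF.real (o + 2) (by simp [Prog.realWrites])
    have hr4 := hF.real (o + 4) (by simp [Prog.realWrites])
    have hG' := hG.congr h4 h2 hr2
    have hn' := hG'.size
    have hjW : j ≤ W := by nlinarith [u.isLt]
    have huW : u.val ≤ W := by have := u.isLt; omega
    simp only [run_seq, run_setNat]
    simp [hk', hn', hdiv, hsub, hjW, huW]
    refine (run_sortState (X := X) (H := H) (j := j) (u := u) (q := q) (L := L) ?_ hj hW hL ?_).mono
      ?_
    · refine ⟨hG'.congr (by simp) (by simp) (by simp), ?_, ?_, ?_, ?_, ?_⟩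
      · simp [h6, hH]
      · simp [h8, hS]
      · simp
      · simp
      · simp [hk', hc]
    · simpa [hr4] using hq
    · rintro t s2 ⟨ht, hs2, ho⟩
      rw [← hc] at hs2 ho
      refine ⟨by omega, ?_⟩
      intro c hck
      rcases hck.eq_or_lt with rfl | hck
      · exact hs2
      · have hlt : ∀ p ≤ n, c * (n + 1) + p < k * (n + 1) := by
          intro p hp
          have : (c + 1) * (n + 1) ≤ k * (n + 1) := Nat.mul_le_mul_right _ hck
          nlinarith
        have e : ∀ p ≤ n, s2.nat (o + 24) (c * (n + 1) + p) = s'.nat (o + 24) (c * (n + 1) + p) ∧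
            s2.real (o + 8) (c * (n + 1) + p) = s'.real (o + 8) (c * (n + 1) + p) ∧
            s2.real (o + 10) (c * (n + 1) + p) = s'.real (o + 10) (c * (n + 1) + p) := by
          intro p hp
          simpa using ho _ (hlt p hp)
        have h := hI c hck
        constructor
        · intro p hp
          simp only [(e p hp).1, (e p hp).2.1, (e p hp).2.2]
          exact h.valid p hp
        · intro p hp t w he
          simp only [(e p hp).1, (e p hp).2.1]
          rcases h.cover p hp t w he with ⟨p', hp', h'⟩ | h'
          · exact Or.inl ⟨p', hp', by rw [(e p' (by omega)).1]; exact h'⟩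
          · exact Or.inr h'
        · intro p p' hpp hp'
          simp only [(e p (by omega)).1, (e p' hp').1]
          exact h.inj p p' hpp hp'
        · simp only [(e n le_rfl).1]
          exact h.last
  · rintro t s' ⟨hI, ht⟩
    simp only [NExp.cost_var] at ht
    exact ⟨by nlinarith, hI⟩

end RealRAM

/-! ### The search of one side -/

namespace RealRAM

open FrozenGraph

/-- The result of the preprocessing of side `o`, as far as the searches use it. -/
structure SearchData {n : ℕ} (o : ℕ) (X : FrozenGraph n) (H : ℕ) (q : ℕ → ℝ) (s : Mem) :
    Prop where
  size : s.nat (o + 4) 0 = n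
  states : s.nat (o + 8) 0 = (H + 1) * n
  start : ∀ v : Fin n, s.real (o + 20) v.val = q v.val
  lists : ∀ c < (H + 1) * n, SortedTargets X H q c (fun p => s.nat (o + 24) (c * (n + 1) + p))
    (fun p => s.real (o + 8) (c * (n + 1) + p)) (fun p => s.real (o + 10) (c * (n + 1) + p))

theorem SearchData.congr {n o H : ℕ} {X : FrozenGraph n} {q : ℕ → ℝ} {s s' : Mem}
    (h : SearchData o X H q s) (h4 : s'.nat (o + 4) = s.nat (o + 4))
    (h8 : s'.nat (o + 8) = s.nat (o + 8)) (h24 : s'.nat (o + 24) = s.nat (o + 24))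
    (r20 : s'.real (o + 20) = s.real (o + 20)) (r8 : s'.real (o + 8) = s.real (o + 8))
    (r10 : s'.real (o + 10) = s.real (o + 10)) : SearchData o X H q s' :=
  ⟨by rw [h4, h.size], by rw [h8, h.states], by rw [r20]; exact h.start,
    by rw [h24, r8, r10]; exact h.lists⟩

/-- The marks `ex` are set exactly at the explored states. -/
def Marked (S cnt : ℕ) (sc ex : ℕ → ℕ) : Prop :=
  ∀ t ≤ S, ex t ≠ 0 ↔ ∃ k < cnt, sc k = t

/-- The pointers have passed explored targets only. -/
def PointersOk (n cnt : ℕ) (sc ptr ord : ℕ → ℕ) : Prop :=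
  ∀ i < cnt, ptr i ≤ n ∧ ∀ p < ptr i, ∃ k < cnt, sc k = ord (sc i * (n + 1) + p)

/-- Move the pointer of the state in array `o + 38` to the next target without mark. -/
def advance (o : ℕ) : Prog :=
  Prog.loop (.natLE 1 (.get (o + 26) (.get (o + 24) (listIndex o
      (.get (o + 32) (.var (o + 38)))))))
    (Prog.setNat (o + 32) (.var (o + 38)) (.get (o + 32) (.var (o + 38)) + 1))

/-- The list ends with a sentinel that is never marked, so the loop stops at some `p ≤ n` without a
bounds check. Its time is charged to the distance that the pointer moves. -/
theorem run_advance {W n o i c : ℕ} {s : Mem} (hn : s.nat (o + 4) 0 = n)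
    (hi : s.nat (o + 38) 0 = i) (hc : s.nat (o + 40) 0 = c) (hW : n ≤ W) (hiW : i ≤ W)
    (hp : s.nat (o + 32) i ≤ n) (hlast : s.nat (o + 26) (s.nat (o + 24) (c * (n + 1) + n)) = 0) :
    Run W (advance o) s (fun t s' => ∃ p, s' = s.setNat (o + 32) i p ∧ s.nat (o + 32) i ≤ p ∧
      p ≤ n ∧ t + 40 * s.nat (o + 32) i ≤ 40 * p + 40 ∧
      (∀ p', s.nat (o + 32) i ≤ p' → p' < p →
        s.nat (o + 26) (s.nat (o + 24) (c * (n + 1) + p')) ≠ 0) ∧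
      s.nat (o + 26) (s.nat (o + 24) (c * (n + 1) + p)) = 0) := by
  unfold advance
  refine (run_loop (fun τ s' => ∃ p, s' = s.setNat (o + 32) i p ∧ s.nat (o + 32) i ≤ p ∧
      p ≤ n ∧ τ + 40 * s.nat (o + 32) i ≤ 40 * p ∧
      (∀ p', s.nat (o + 32) i ≤ p' → p' < p →
        s.nat (o + 26) (s.nat (o + 24) (c * (n + 1) + p')) ≠ 0))
    (fun s' => n - s'.nat (o + 32) i) ⟨s.nat (o + 32) i, ?_, le_rfl, hp, by omega, by omega⟩
    ?_).mono ?_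
  · rw [Mem.setNat_self]
  · rintro τ s' ⟨p, rfl, h1, h2, h3, h4⟩ hF hb
    have hb' : s.nat (o + 26) (s.nat (o + 24) (c * (n + 1) + p)) ≠ 0 := by
      simp [listIndex, hn, hi, hc] at hb
      omega
    have hpn : p ≠ n := by rintro rfl; exact hb' hlast
    have hpW : p + 1 ≤ W := by omega
    simp [hi, hiW, hpW, listIndex]
    refine ⟨⟨p + 1, rfl, by omega, by omega, by omega, ?_⟩, by omega⟩
    intro p' hp1 hp2
    rcases Nat.lt_succ_iff_lt_or_eq.mp hp2 with h | rfl
    · exact h4 p' hp1 h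
    · exact hb'
  · rintro t s' ⟨τ, ⟨p, rfl, h1, h2, h3, h4⟩, hb, ht⟩
    simp [listIndex, hn, hi, hc] at hb ht
    exact ⟨p, rfl, h1, h2, by omega, h4, hb⟩

/-- Find the next state to be explored. -/
def peek (o : ℕ) : Prog :=
  Prog.setNat (o + 36) 0 (.var (o + 8)) ;;
  forN (o + 38) (.var (o + 34))
    (Prog.setNat (o + 40) 0 (.get (o + 30) (.var (o + 38))) ;;
    advance o ;;
    Prog.setNat (o + 44) 0 (listIndex o (.get (o + 32) (.var (o + 38)))) ;;
    Prog.cond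
      (.conj (.natLT (.get (o + 24) (.var (o + 44))) (.var (o + 8)))
        (.disj (.natLE (.var (o + 8)) (.var (o + 36)))
          (.realLT (.get (o + 12) (.var (o + 38)) + .get (o + 8) (.var (o + 44)))
            (.var (o + 14)))))
      (Prog.setNat (o + 36) 0 (.get (o + 24) (.var (o + 44))) ;;
        Prog.setReal (o + 14) 0 (.get (o + 12) (.var (o + 38)) + .get (o + 8) (.var (o + 44))) ;;
        Prog.setReal (o + 16) 0 (.get (o + 12) (.var (o + 38)) + .get (o + 10) (.var (o + 44))))
      Prog.skip)

@[simp] theorem natWrites_peek (o : ℕ) : (peek o).natWrites =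
    [o + 36, o + 38, o + 40, o + 32, o + 44, o + 36, o + 38] := rfl
@[simp] theorem realWrites_peek (o : ℕ) : (peek o).realWrites = [o + 14, o + 16] := rfl

theorem sum_range_update {m i x : ℕ} {f : ℕ → ℕ} (hi : i < m) :
    ∑ k ∈ Finset.range m, Function.update f i x k + f i = ∑ k ∈ Finset.range m, f k + x := by
  rw [Finset.sum_update_of_mem (Finset.mem_range.mpr hi),
    ← Finset.sum_sdiff (Finset.singleton_subset_iff.mpr (Finset.mem_range.mpr hi)),
    Finset.sum_singleton]
  omega

/-- In the list of an explored state, the first unexplored entry minimizes `w + q t` over its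
unexplored targets. One candidate per explored state therefore suffices to find the next value, and
the pointer movements are paid by the increase of the sum of the pointers. -/
theorem run_peek {W n o H cnt : ℕ} {X : FrozenGraph n} {q : ℕ → ℝ} {r : Fin n} {s : Mem}
    (hD : SearchData o X H q s) (hcnt : s.nat (o + 34) 0 = cnt) (h0 : 0 < cnt)
    (hW : (H + 1) * n * (n + 2) ≤ W)
    (hS : X.SearchInv H r q cnt (s.nat (o + 30)) (s.real (o + 12)))
    (hM : Marked ((H + 1) * n) cnt (s.nat (o + 30)) (s.nat (o + 26)))
    (hP : PointersOk n cnt (s.nat (o + 30)) (s.nat (o + 32)) (s.nat (o + 24))) :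
    Run W (peek o) s (fun t s' =>
      t + 100 * ∑ i ∈ Finset.range cnt, s.nat (o + 32) i ≤
        100 * ∑ i ∈ Finset.range cnt, s'.nat (o + 32) i + 200 * cnt + 30 ∧
      PointersOk n cnt (s.nat (o + 30)) (s'.nat (o + 32)) (s.nat (o + 24)) ∧
      X.NextInv H r q cnt (s.nat (o + 30)) (s.real (o + 12)) (s'.nat (o + 36) 0)
        (s'.real (o + 14) 0) (s'.real (o + 16) 0)) := by
  have hn := hD.size
  have hcS := hS.card_le
  have hnS : n ≤ (H + 1) * n := by nlinarith
  have hSW : (H + 1) * n ≤ W := by nlinarith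
  have hlW : ∀ c < (H + 1) * n, ∀ p ≤ n, c * (n + 1) + p ≤ W := by
    intro c hc p hp
    have : (c + 1) * (n + 1) ≤ (H + 1) * n * (n + 1) := Nat.mul_le_mul_right _ hc
    nlinarith
  unfold peek
  rw [run_seq, run_setNat]
  refine ⟨by simp, by simpa [hD.states] using hSW, ?_⟩
  refine (run_forN (N := cnt) (fun k τ s' =>
      τ + 100 * ∑ i ∈ Finset.range cnt, s.nat (o + 32) i ≤
        100 * ∑ i ∈ Finset.range cnt, s'.nat (o + 32) i + 200 * k ∧
      PointersOk n cnt (s.nat (o + 30)) (s'.nat (o + 32)) (s.nat (o + 24)) ∧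
      (s'.nat (o + 36) 0 < (H + 1) * n →
        (∀ k' < cnt, s.nat (o + 30) k' ≠ s'.nat (o + 36) 0) ∧
        ∃ i < cnt, ∃ w, X.LayerEdge H (s.nat (o + 30) i) (s'.nat (o + 36) 0) w ∧
          s'.real (o + 16) 0 = s.real (o + 12) i + w ∧
          s'.real (o + 14) 0 = s.real (o + 12) i + (w + q (s'.nat (o + 36) 0))) ∧
      ∀ i < k, ∀ t w, X.LayerEdge H (s.nat (o + 30) i) t w →
        (∃ k' < cnt, s.nat (o + 30) k' = t) ∨ (s'.nat (o + 36) 0 < (H + 1) * n ∧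
          s'.real (o + 14) 0 ≤ s.real (o + 12) i + (w + q t)))
    (by omega) ?_ ?_ ?_ ?_).mono ?_
  · intro s' hF
    have := hF.nat (o + 34) (by simp [Prog.natWrites, advance])
    simp [this, hcnt]
  · simp [Prog.natWrites, advance]
  · simp [hD.states]
    exact hP
  · rintro k τ s' hk ⟨I1, I2, I3, I4⟩ hk' hF
    have h4 := hF.nat (o + 4) (by simp [Prog.natWrites, advance])
    have h8 := hF.nat (o + 8) (by simp [Prog.natWrites, advance])
    have h24 := hF.nat (o + 24) (by simp [Prog.natWrites, advance])
    have h26 := hF.nat (o + 26) (by simp [Prog.natWrites, advance])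
    have h30 := hF.nat (o + 30) (by simp [Prog.natWrites, advance])
    have r8 := hF.real (o + 8) (by simp [Prog.realWrites, advance])
    have r10 := hF.real (o + 10) (by simp [Prog.realWrites, advance])
    have r12 := hF.real (o + 12) (by simp [Prog.realWrites, advance])
    simp at h4 h8 h24 h26 h30 r8 r10 r12
    set c := s.nat (o + 30) k with hc
    have hcS' : c < (H + 1) * n := hS.lt k hk
    have hL := hD.lists c hcS'
    -- The sentinel equals the number of states, so it is not an explored state and carries no mark.
    have hunm : s.nat (o + 26) ((H + 1) * n) = 0 := by
      by_contra h
      obtain ⟨k', hk', h'⟩ := (hM _ le_rfl).mp h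
      exact absurd h' (hS.lt k' hk').ne
    have hcW : c ≤ W := by omega
    simp only [run_seq, run_setNat]
    simp [h30, hk', ← hc, hcW]
    refine (run_advance (n := n) (i := k) (c := c) (by simp [h4, hn]) (by simp [hk']) (by simp)
      (by omega) (by omega) (by simpa using (I2 k hk).1) ?_).mono ?_
    · simp [h24, h26]
      rw [hL.last]
      exact hunm
    rintro t s2 ⟨p, rfl, hp1, hp2, hp3, hp4, hp5⟩
    simp [h24, h26] at hp1 hp3 hp4 hp5
    have hiW := hlW c hcS' p hp2
    have hptr : PointersOk n cnt (s.nat (o + 30)) (Function.update (s'.nat (o + 32)) k p)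
        (s.nat (o + 24)) := by
      intro i hi
      by_cases hik : i = k
      · subst hik
        simp only [Function.update_self]
        refine ⟨hp2, fun p' hp' => ?_⟩
        by_cases hlt : p' < s'.nat (o + 32) i
        · exact (I2 i hi).2 p' hlt
        -- An entry newly passed is marked, and marks sit only at explored states.
        · have hne := hp4 p' (by omega) hp'
          refine (hM _ ?_).mp hne
          rcases hL.valid p' (by omega) with h | h
          · exact h.le
          · exact h.1.le
      · simp only [Function.update_of_ne hik]
        exact I2 i hi
    have hsum := sum_range_update (x := p) (f := s'.nat (o + 32)) hk
    have hcov : ∀ t' w, X.LayerEdge H c t' w → (∃ k' < cnt, s.nat (o + 30) k' = t') ∨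
        (s.nat (o + 24) (c * (n + 1) + p) < (H + 1) * n ∧
          s.real (o + 8) (c * (n + 1) + p) ≤ w + q t') := by
      intro t' w he
      rcases hL.cover p hp2 t' w he with ⟨p', hp', h⟩ | h
      · left
        have := (hptr k hk).2 p' (by simpa using hp')
        rwa [← hc, h] at this
      · exact Or.inr h
    simp [listIndex, h4, hn, h8, hD.states, h24, hk', hiW, r8, r10, r12]
    constructor
    · intro hlt hor
      have hvalid : X.LayerEdge H c (s.nat (o + 24) (c * (n + 1) + p))
          (s.real (o + 10) (c * (n + 1) + p)) ∧ s.real (o + 8) (c * (n + 1) + p) =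
          s.real (o + 10) (c * (n + 1) + p) + q (s.nat (o + 24) (c * (n + 1) + p)) := by
        rcases hL.valid p hp2 with h | h
        · omega
        · exact h.2
      have hfresh : ∀ k' < cnt, s.nat (o + 30) k' ≠ s.nat (o + 24) (c * (n + 1) + p) := by
        intro k' hk' h'
        exact (hM _ hlt.le).mpr ⟨k', hk', h'⟩ hp5
      refine ⟨by omega, by omega, hptr, fun _ => ⟨hfresh, k, hk, _, hvalid.1, rfl, ?_⟩, ?_⟩
      · rw [← hvalid.2]
      · intro i hi t' w he
        rcases hi.eq_or_lt with rfl | hi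
        · rcases hcov t' w he with h | h
          · exact Or.inl h
          · exact Or.inr ⟨hlt, by linarith [h.2]⟩
        · rcases I4 i hi t' w he with h | ⟨h1, h2⟩
          · exact Or.inl h
          · refine Or.inr ⟨hlt, ?_⟩
            rcases hor with h3 | h3
            · omega
            · linarith
    · intro hno
      refine ⟨by omega, hptr, I3, ?_⟩
      intro i hi t' w he
      rcases hi.eq_or_lt with rfl | hi
      · rcases hcov t' w he with h | h
        · exact Or.inl h
        · obtain ⟨h1, h2⟩ := hno h.1
          exact Or.inr ⟨h1, by linarith [h.2]⟩
      · exact I4 i hi t' w he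
  · rintro t s' ⟨τ, ⟨I1, I2, I3, I4⟩, -, ht⟩
    simp only [NExp.cost_var, NExp.cost_ofNat] at ht ⊢
    exact ⟨by omega, I2, hS.next h0 I3 I4⟩

end RealRAM

/-! ### Discovered vertices, recorded distances and the cost of an exploration. -/

namespace RealRAM

open FrozenGraph

/-- The entries before the pointer are explored states, hence not sentinels, hence pairwise
distinct; there are only `cnt` explored states. This is why the search time depends on `cnt` and not
on `n`. -/
theorem PointersOk.le_cnt {n o H cnt : ℕ} {X : FrozenGraph n} {q : ℕ → ℝ} {r : Fin n} {s : Mem}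
    {sc ptr : ℕ → ℕ} {D : ℕ → ℝ} (hD : SearchData o X H q s) (hS : X.SearchInv H r q cnt sc D)
    (hP : PointersOk n cnt sc ptr (s.nat (o + 24))) {i : ℕ} (hi : i < cnt) : ptr i ≤ cnt := by
  obtain ⟨hn, hp⟩ := hP i hi
  have hL := hD.lists _ (hS.lt i hi)
  have hlt : ∀ p < ptr i, s.nat (o + 24) (sc i * (n + 1) + p) ≠ (H + 1) * n := by
    intro p hpi h
    obtain ⟨k, hk, hk'⟩ := hp p hpi
    exact (hS.lt k hk).ne (hk'.trans h)
  have := Finset.card_le_card_of_injOn (s := Finset.range (ptr i))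
    (t := (Finset.range cnt).image sc) (fun p => s.nat (o + 24) (sc i * (n + 1) + p)) ?_ ?_
  · exact (by simpa using this : ptr i ≤ ((Finset.range cnt).image sc).card).trans
      (Finset.card_image_le.trans (by simp))
  · intro p hp'
    obtain ⟨k, hk, hk'⟩ := hp p (by simpa using hp')
    simp only [Finset.coe_image, Set.mem_image]
    exact ⟨k, by simpa using hk, hk'⟩
  · intro p hp1 p' hp2 heq
    have h1 : p < ptr i := by simpa using hp1
    have h2 : p' < ptr i := by simpa using hp2
    rcases lt_trichotomy p p' with h | h | h
    · exact absurd (hL.inj p p' h (by omega) heq) (hlt p' h2)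
    · exact h
    · exact absurd (hL.inj p' p h (by omega) heq.symm) (hlt p h1)

/-- The set `V` of vertices with an explored state, as recorded in the memory. -/
structure VertexInv {n : ℕ} (cnt : ℕ) (sc : ℕ → ℕ) (D : ℕ → ℝ) (V : Finset (Fin n))
    (list vs : ℕ → ℕ) (dist : ℕ → ℝ) : Prop where
  size : list 0 = V.card
  elems : (Finset.range V.card).image (fun j => list (j + 1)) = V.image fun v => v.val
  mark : ∀ v : Fin n, vs v.val ≠ 0 ↔ v ∈ V
  mem : ∀ v : Fin n, v ∈ V ↔ ∃ k < cnt, sc k % n = v.val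
  attained : ∀ v ∈ V, ∃ k < cnt, sc k % n = v.val ∧ D k = dist v.val
  label_le : ∀ k < cnt, ∀ v : Fin n, sc k % n = v.val → dist v.val ≤ D k

section VertexInv

variable {n cnt : ℕ} {sc list list' vs vs' : ℕ → ℕ} {D dist dist' : ℕ → ℝ} {V : Finset (Fin n)}

theorem VertexInv.insert_new (h : VertexInv cnt sc D V list vs dist) {c : ℕ} {x : ℝ} {v : Fin n}
    (hc : c % n = v.val) (hv : vs v.val = 0) :
    VertexInv (cnt + 1) (Function.update sc cnt c) (Function.update D cnt x) (insert v V)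
      (Function.update (Function.update list 0 (list 0 + 1)) (list 0 + 1) v.val)
      (Function.update vs v.val 1) (Function.update dist v.val x) := by
  have hvV : v ∉ V := fun hvV => (h.mark v).mpr hvV hv
  have hcard : (insert v V).card = V.card + 1 := Finset.card_insert_of_notMem hvV
  have old : ∀ i < cnt, Function.update sc cnt c i = sc i ∧ Function.update D cnt x i = D i :=
    fun i hi => by simp [hi.ne]
  have hex : ∀ P : ℕ → Prop, (∃ k < cnt + 1, P k) ↔ (∃ k < cnt, P k) ∨ P cnt := by
    intro P
    constructor
    · rintro ⟨k, hk, hp⟩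
      rcases Nat.lt_succ_iff_lt_or_eq.mp hk with hk | rfl
      · exact Or.inl ⟨k, hk, hp⟩
      · exact Or.inr hp
    · rintro (⟨k, hk, hp⟩ | hp)
      · exact ⟨k, by omega, hp⟩
      · exact ⟨cnt, by omega, hp⟩
  have hvne : ∀ k < cnt, sc k % n ≠ v.val := fun k hk h' => hvV ((h.mem v).mpr ⟨k, hk, h'⟩)
  constructor
  · simp [hcard, h.size]
  · rw [hcard, Finset.range_add_one, Finset.image_insert, Finset.image_insert, ← h.elems, h.size]
    congr 1
    · simp
    · apply Finset.image_congr
      intro j hj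
      have hj' : j < V.card := by simpa using hj
      simp [hj'.ne]
  · intro w
    by_cases hw : w = v
    · subst hw; simp
    · have := Fin.val_ne_of_ne hw
      simp [hw, this, h.mark w]
  · intro w
    rw [hex, Finset.mem_insert, h.mem w, or_comm]
    refine or_congr (exists_congr fun k => and_congr_right fun hk => by rw [(old k hk).1]) ?_
    simp [hc, Fin.ext_iff, eq_comm]
  · intro w hw
    by_cases hwv : w = v
    · subst hwv
      exact ⟨cnt, by omega, by simp [hc]⟩
    · have := Fin.val_ne_of_ne hwv
      obtain ⟨k, hk, h1, h2⟩ := h.attained w (Finset.mem_of_mem_insert_of_ne hw hwv)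
      refine ⟨k, by omega, ?_⟩
      rw [(old k hk).1, (old k hk).2, Function.update_of_ne this]
      exact ⟨h1, h2⟩
  · intro k hk w hw
    rcases Nat.lt_succ_iff_lt_or_eq.mp hk with hk | rfl
    · rw [(old k hk).1] at hw
      rw [(old k hk).2]
      have : w.val ≠ v.val := fun h' => hvne k hk (hw.trans h')
      rw [Function.update_of_ne this]
      exact h.label_le k hk w hw
    · simp only [Function.update_self, hc] at hw
      obtain rfl := Fin.ext hw
      simp

/-- States of the same vertex with different hop counts are explored in the order of `D + q`, not of
`D`, so a later state may still lower the recorded distance of its vertex. -/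
theorem VertexInv.insert_old (h : VertexInv cnt sc D V list vs dist) {c : ℕ} {x : ℝ} {v : Fin n}
    (hc : c % n = v.val) (hv : vs v.val ≠ 0)
    (hd : (x < dist v.val ∧ dist' = Function.update dist v.val x) ∨
      (dist v.val ≤ x ∧ dist' = dist)) :
    VertexInv (cnt + 1) (Function.update sc cnt c) (Function.update D cnt x) (insert v V)
      list vs dist' := by
  have hvV : v ∈ V := (h.mark v).mp hv
  rw [Finset.insert_eq_of_mem hvV]
  have old : ∀ i < cnt, Function.update sc cnt c i = sc i ∧ Function.update D cnt x i = D i :=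
    fun i hi => by simp [hi.ne]
  have hdle : ∀ w : Fin n, dist' w.val ≤ dist w.val := by
    intro w
    rcases hd with ⟨h1, rfl⟩ | ⟨-, rfl⟩
    · by_cases hwv : w = v
      · subst hwv; simpa using h1.le
      · simp [Fin.val_ne_of_ne hwv]
    · exact le_rfl
  refine ⟨h.size, h.elems, h.mark, ?_, ?_, ?_⟩
  · intro w
    rw [h.mem w]
    constructor
    · rintro ⟨k, hk, h'⟩
      exact ⟨k, by omega, by rw [(old k hk).1, h']⟩
    · rintro ⟨k, hk, h'⟩
      rcases Nat.lt_succ_iff_lt_or_eq.mp hk with hk | rfl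
      · exact ⟨k, hk, by rw [← (old k hk).1, h']⟩
      · simp only [Function.update_self, hc] at h'
        obtain rfl := Fin.ext h'
        exact (h.mem v).mp hvV
  · intro w hw
    obtain ⟨k, hk, h1, h2⟩ := h.attained w hw
    rcases hd with ⟨h3, rfl⟩ | ⟨-, rfl⟩
    · by_cases hwv : w = v
      · subst hwv
        exact ⟨cnt, by omega, by simp [hc]⟩
      · refine ⟨k, by omega, ?_⟩
        rw [(old k hk).1, (old k hk).2, Function.update_of_ne (Fin.val_ne_of_ne hwv)]
        exact ⟨h1, h2⟩
    · refine ⟨k, by omega, ?_⟩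
      rw [(old k hk).1, (old k hk).2]
      exact ⟨h1, h2⟩
  · intro k hk w hw
    rcases Nat.lt_succ_iff_lt_or_eq.mp hk with hk | rfl
    · rw [(old k hk).1] at hw
      rw [(old k hk).2]
      exact (hdle w).trans (h.label_le k hk w hw)
    · simp only [Function.update_self, hc] at hw ⊢
      obtain rfl := Fin.ext hw
      rcases hd with ⟨h3, rfl⟩ | ⟨h3, rfl⟩
      · simp
      · exact h3

end VertexInv

/-- The invariant of the search of side `o` with root `r`, where `V` is the set of vertices with
an explored state. -/
structure SideInv {n : ℕ} (o : ℕ) (X : FrozenGraph n) (H : ℕ) (q : ℕ → ℝ) (r : Fin n)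
    (V : Finset (Fin n)) (s : Mem) : Prop where
  data : SearchData o X H q s
  search : X.SearchInv H r q (s.nat (o + 34) 0) (s.nat (o + 30)) (s.real (o + 12))
  next : X.NextInv H r q (s.nat (o + 34) 0) (s.nat (o + 30)) (s.real (o + 12)) (s.nat (o + 36) 0)
    (s.real (o + 14) 0) (s.real (o + 16) 0)
  marked : Marked ((H + 1) * n) (s.nat (o + 34) 0) (s.nat (o + 30)) (s.nat (o + 26))
  pointers : PointersOk n (s.nat (o + 34) 0) (s.nat (o + 30)) (s.nat (o + 32)) (s.nat (o + 24))
  vertices : VertexInv (s.nat (o + 34) 0) (s.nat (o + 30)) (s.real (o + 12)) V (s.nat o)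
    (s.nat (o + 28)) (s.real o)

/-- A bound for the time that the search of side `o` has used. -/
def spent (o : ℕ) (s : Mem) : ℕ :=
  1000 * (s.nat (o + 34) 0) ^ 2 + 100 * ∑ i ∈ Finset.range (s.nat (o + 34) 0), s.nat (o + 32) i

/-- Explore the next state, up to the choice of its successor. -/
def record (o : ℕ) : Prog :=
  Prog.setNat (o + 40) 0 (.var (o + 36)) ;;
  Prog.setNat (o + 16) 0 (.var (o + 40) - .var (o + 40) / .var (o + 4) * .var (o + 4)) ;;
  Prog.setNat (o + 30) (.var (o + 34)) (.var (o + 40)) ;;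
  Prog.setReal (o + 12) (.var (o + 34)) (.var (o + 16)) ;;
  Prog.setNat (o + 32) (.var (o + 34)) 0 ;;
  Prog.setNat (o + 26) (.var (o + 40)) 1 ;;
  Prog.setNat (o + 34) 0 (.var (o + 34) + 1) ;;
  Prog.cond (.natEq (.get (o + 28) (.var (o + 16))) 0)
    (Prog.setNat (o + 28) (.var (o + 16)) 1 ;;
      Prog.setNat o 0 (.var o + 1) ;;
      Prog.setNat o (.var o) (.var (o + 16)) ;;
      Prog.setReal o (.var (o + 16)) (.var (o + 16)))
    (Prog.cond (.realLT (.var (o + 16)) (.get o (.var (o + 16))))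
      (Prog.setReal o (.var (o + 16)) (.var (o + 16))) Prog.skip)

@[simp] theorem natWrites_record (o : ℕ) : (record o).natWrites =
    [o + 40, o + 16, o + 30, o + 32, o + 26, o + 34, o + 28, o, o] := rfl
@[simp] theorem realWrites_record (o : ℕ) : (record o).realWrites = [o + 12, o, o] := rfl

theorem run_record {W n o H : ℕ} {X : FrozenGraph n} {q : ℕ → ℝ} {r : Fin n}
    {V : Finset (Fin n)} {s : Mem} (h : SideInv o X H q r V s) (hq : X.IsPotential H q)
    (hW : (H + 1) * n * (n + 2) ≤ W) (hb : s.nat (o + 36) 0 < (H + 1) * n) :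
    Run W (record o) s (fun t s' => t ≤ 150 ∧
      s'.nat (o + 34) 0 = s.nat (o + 34) 0 + 1 ∧
      s'.nat (o + 30) = Function.update (s.nat (o + 30)) (s.nat (o + 34) 0) (s.nat (o + 36) 0) ∧
      s'.real (o + 12) = Function.update (s.real (o + 12)) (s.nat (o + 34) 0)
        (s.real (o + 16) 0) ∧
      s'.nat (o + 32) = Function.update (s.nat (o + 32)) (s.nat (o + 34) 0) 0 ∧
      s'.nat (o + 26) = Function.update (s.nat (o + 26)) (s.nat (o + 36) 0) 1 ∧
      ∃ v : Fin n, s.nat (o + 36) 0 % n = v.val ∧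
        VertexInv (s'.nat (o + 34) 0) (s'.nat (o + 30)) (s'.real (o + 12)) (insert v V) (s'.nat o)
          (s'.nat (o + 28)) (s'.real o)) := by
  obtain ⟨j, hj, v, hc, hdiv, hsub⟩ := exists_code hb
  have hv : s.nat (o + 36) 0 % n = v.val := by rw [hc, code_mod]
  have hn := h.data.size
  have hcS := h.search.card_le
  have hVn : V.card ≤ n := by simpa using Finset.card_le_univ V
  have hl := h.vertices.size
  have hv0 := v.isLt
  have hnS : n ≤ (H + 1) * n := by nlinarith
  have hSW : (H + 1) * n + n ≤ W := by nlinarith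
  -- Extending the search by the fresh state and counting distinct codes shows that there is room
  -- for it, so the new index fits in a word.
  have hcntlt : s.nat (o + 34) 0 < (H + 1) * n := by
    have := (h.search.extend h.next hq hb).card_le
    omega
  have w1 : s.nat (o + 36) 0 ≤ W := by omega
  have w2 : v.val ≤ W := by omega
  have w3 : s.nat (o + 34) 0 ≤ W := by omega
  have w4 : s.nat (o + 34) 0 < W := by omega
  have w5 : s.nat o 0 < W := by omega
  have w6 : 1 ≤ W := by omega
  have w7 : s.nat (o + 36) 0 ≤ W + j * n := by omega
  unfold record
  simp [hn, hdiv, hsub, w1, w3, w4, w5, w6, w7]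
  refine ⟨fun h0 => ⟨v, hv, h.vertices.insert_new hv h0⟩, fun h0 =>
    ⟨fun hlt => ⟨v, hv, ?_⟩, fun hle => ⟨v, hv, ?_⟩⟩⟩
  · exact h.vertices.insert_old hv h0 (Or.inl ⟨hlt, rfl⟩)
  · exact h.vertices.insert_old hv h0 (Or.inr ⟨hle, rfl⟩)

/-- Explore the next state. -/
def explore (o : ℕ) : Prog := record o ;; peek o

@[simp] theorem natWrites_explore (o : ℕ) : (explore o).natWrites =
    [o + 40, o + 16, o + 30, o + 32, o + 26, o + 34, o + 28, o, o] ++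
      [o + 36, o + 38, o + 40, o + 32, o + 44, o + 36, o + 38] := rfl
@[simp] theorem realWrites_explore (o : ℕ) :
    (explore o).realWrites = [o + 12, o, o, o + 14, o + 16] := rfl

/-- Amortized bound: the growth of `1000 * cnt ^ 2` in `spent` pays for recording the state and
scanning all explored states, and the sum of the pointers pays for their movements. The slack of
`300` covers the guards and assignments of the callers. -/
theorem run_explore {W n o H : ℕ} {X : FrozenGraph n} {q : ℕ → ℝ} {r : Fin n}
    {V : Finset (Fin n)} {s : Mem} (h : SideInv o X H q r V s) (hq : X.IsPotential H q)
    (hW : (H + 1) * n * (n + 2) ≤ W) (hb : s.nat (o + 36) 0 < (H + 1) * n) :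
    Run W (explore o) s (fun t s' => t + spent o s + 300 ≤ spent o s' ∧
      s'.nat (o + 34) 0 = s.nat (o + 34) 0 + 1 ∧
      (s'.nat (o + 36) 0 < (H + 1) * n → s.real (o + 14) 0 ≤ s'.real (o + 14) 0) ∧
      ∃ v : Fin n, s.nat (o + 36) 0 % n = v.val ∧ SideInv o X H q r (insert v V) s') := by
  unfold explore
  refine (run_record h hq hW hb).frame.seq ?_
  rintro t s1 ⟨⟨ht, h34, h30, r12, h32, h26, v, hv, hV⟩, hF⟩
  have h24 := hF.nat (o + 24) (by simp)
  have hD1 : SearchData o X H q s1 := h.data.congr (hF.nat _ (by simp)) (hF.nat _ (by simp)) h24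
    (hF.real _ (by simp)) (hF.real _ (by simp)) (hF.real _ (by simp))
  have hext := h.search.extend h.next hq hb
  have hS1 : X.SearchInv H r q (s1.nat (o + 34) 0) (s1.nat (o + 30)) (s1.real (o + 12)) := by
    rw [h34, h30, r12]; exact hext
  set cnt := s.nat (o + 34) 0 with hcnt
  have hold : ∀ i < cnt, s1.nat (o + 30) i = s.nat (o + 30) i := by
    intro i hi; rw [h30, Function.update_of_ne hi.ne]
  have hnew : s1.nat (o + 30) cnt = s.nat (o + 36) 0 := by rw [h30, Function.update_self]
  have hex : ∀ P : ℕ → Prop, (∃ k < cnt + 1, P (s1.nat (o + 30) k)) ↔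
      (∃ k < cnt, P (s.nat (o + 30) k)) ∨ P (s.nat (o + 36) 0) := by
    intro P
    constructor
    · rintro ⟨k, hk, hp⟩
      rcases Nat.lt_succ_iff_lt_or_eq.mp hk with hk | rfl
      · exact Or.inl ⟨k, hk, by rwa [hold k hk] at hp⟩
      · exact Or.inr (by rwa [hnew] at hp)
    · rintro (⟨k, hk, hp⟩ | hp)
      · exact ⟨k, by omega, by rwa [hold k hk]⟩
      · exact ⟨cnt, by omega, by rwa [hnew]⟩
  have hM1 : Marked ((H + 1) * n) (s1.nat (o + 34) 0) (s1.nat (o + 30)) (s1.nat (o + 26)) := by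
    intro t ht
    rw [h34, hex fun x => x = t, h26, ← h.marked t ht]
    by_cases hts : t = s.nat (o + 36) 0
    · subst hts; simp
    · rw [Function.update_of_ne hts]
      simp [Ne.symm hts]
  have hP1 : PointersOk n (s1.nat (o + 34) 0) (s1.nat (o + 30)) (s1.nat (o + 32))
      (s1.nat (o + 24)) := by
    intro i hi
    rw [h34] at hi ⊢
    rw [h32, h24]
    rcases Nat.lt_succ_iff_lt_or_eq.mp hi with hi | rfl
    · rw [Function.update_of_ne hi.ne, hold i hi]
      obtain ⟨h1, h2⟩ := h.pointers i hi
      exact ⟨h1, fun p hp => (hex fun x => x = _).mpr (Or.inl (h2 p hp))⟩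
    · simp
  refine (run_peek hD1 rfl (by omega) hW hS1 hM1 hP1).frame.mono ?_
  rintro t' s2 ⟨⟨ht', hP2, hN2⟩, hF2⟩
  have e34 := hF2.nat (o + 34) (by simp)
  have e30 := hF2.nat (o + 30) (by simp)
  have e26 := hF2.nat (o + 26) (by simp)
  have e24 := hF2.nat (o + 24) (by simp)
  have e28 := hF2.nat (o + 28) (by simp)
  have e0 := hF2.nat o (by simp)
  have e12 := hF2.real (o + 12) (by simp)
  have er0 := hF2.real o (by simp)
  have hsum : ∑ i ∈ Finset.range (cnt + 1), s1.nat (o + 32) i =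
      ∑ i ∈ Finset.range cnt, s.nat (o + 32) i := by
    -- The pointer of the new state starts at `0` and adds nothing to the sum.
    rw [Finset.sum_range_succ, h32, Function.update_self, add_zero]
    refine Finset.sum_congr rfl fun i hi => ?_
    rw [Function.update_of_ne (by simpa using (Finset.mem_range.mp hi).ne)]
  rw [← e34, ← e30, ← e12] at hN2
  refine ⟨?_, by rw [e34, h34], ?_, v, hv, ?_⟩
  · unfold spent
    rw [e34, h34, ← hcnt]
    rw [h34, hsum] at ht'
    nlinarith
  · intro hlt
    have := hN2.ge hlt cnt (by rw [e34, h34]; omega)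
    rw [e30, e12, hnew, r12, Function.update_self] at this
    rw [h.next.value hb]
    exact this
  · refine ⟨hD1.congr (hF2.nat _ (by simp)) (hF2.nat _ (by simp)) e24 (hF2.real _ (by simp))
      (hF2.real _ (by simp)) (hF2.real _ (by simp)), ?_, hN2, ?_, ?_, ?_⟩
    · rw [e34, e30, e12]; exact hS1
    · rw [e34, e30, e26]; exact hM1
    · rw [e34, e30, e24]; exact hP2
    · rw [e34, e30, e12, e0, e28, er0]; exact hV

end RealRAM

/-! ### Searching vertex by vertex, and erasing the marks. -/

namespace RealRAM

open FrozenGraph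

section

variable {W n o H : ℕ} {X : FrozenGraph n} {q : ℕ → ℝ} {r : Fin n} {V : Finset (Fin n)} {s : Mem}

theorem SideInv.congr {s' : Mem} (h : SideInv o X H q r V s)
    (hn : ∀ k ∈ [0, 4, 8, 24, 26, 28, 30, 32, 34, 36], s'.nat (o + k) = s.nat (o + k))
    (hr : ∀ k ∈ [0, 8, 10, 12, 14, 16, 20], s'.real (o + k) = s.real (o + k)) :
    SideInv o X H q r V s' := by
  simp only [List.forall_mem_cons, add_zero] at hn hr
  obtain ⟨n0, n4, n8, n24, n26, n28, n30, n32, n34, n36, -⟩ := hn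
  obtain ⟨r0, r8, r10, r12, r14, r16, r20, -⟩ := hr
  refine ⟨h.data.congr n4 n8 n24 r20 r8 r10, ?_, ?_, ?_, ?_, ?_⟩
  · rw [n34, n30, r12]; exact h.search
  · rw [n34, n30, n36, r12, r14, r16]; exact h.next
  · rw [n34, n30, n26]; exact h.marked
  · rw [n34, n30, n32, n24]; exact h.pointers
  · rw [n34, n30, n28, n0, r12, r0]; exact h.vertices

/-- The invariant of the search of side `o` between two additions of a vertex: the next state has
a new vertex, and the real variable `o + 18` holds the value at which the last vertex was added. -/
structure SideState {n : ℕ} (o : ℕ) (X : FrozenGraph n) (H : ℕ) (q : ℕ → ℝ) (r : Fin n)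
    (V : Finset (Fin n)) (s : Mem) : Prop where
  inv : SideInv o X H q r V s
  fresh : s.nat (o + 36) 0 < (H + 1) * n → ∀ v ∈ V, s.nat (o + 36) 0 % n ≠ v.val
  bound : ∀ v ∈ V, ∃ x ∈ X.outWeights H r v, x ≤ s.real (o + 18) 0
  last_le : V.Nonempty → s.nat (o + 36) 0 < (H + 1) * n → s.real (o + 18) 0 ≤ s.real (o + 14) 0

theorem SideState.congr {s' : Mem} (h : SideState o X H q r V s)
    (hn : ∀ k ∈ [0, 4, 8, 24, 26, 28, 30, 32, 34, 36], s'.nat (o + k) = s.nat (o + k))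
    (hr : ∀ k ∈ [0, 8, 10, 12, 14, 16, 18, 20], s'.real (o + k) = s.real (o + k)) :
    SideState o X H q r V s' := by
  have n36 := hn 36 (by simp)
  have r14 := hr 14 (by simp)
  have r18 := hr 18 (by simp)
  refine ⟨h.inv.congr hn fun k hk => hr k ?_, ?_, ?_, ?_⟩
  · simp only [List.mem_cons] at hk ⊢; tauto
  · rw [n36]; exact h.fresh
  · rw [r18]; exact h.bound
  · rw [n36, r14, r18]; exact h.last_le

/-- Explore states until the next one has a new vertex. -/
def drain (o : ℕ) : Prog :=
  Prog.loop (.conj (.natLT (.var (o + 36)) (.var (o + 8)))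
    (.natLE 1 (.get (o + 28) (.var (o + 36) - .var (o + 36) / .var (o + 4) * .var (o + 4)))))
    (explore o)

/-- Add the next vertex. -/
def addVertex (o : ℕ) : Prog :=
  Prog.setReal (o + 18) 0 (.var (o + 14)) ;; explore o ;; drain o

@[simp] theorem natWrites_drain (o : ℕ) : (drain o).natWrites =
    [o + 40, o + 16, o + 30, o + 32, o + 26, o + 34, o + 28, o, o] ++
      [o + 36, o + 38, o + 40, o + 32, o + 44, o + 36, o + 38] := rfl
@[simp] theorem realWrites_drain (o : ℕ) :
    (drain o).realWrites = [o + 12, o, o, o + 14, o + 16] := rfl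
-- The next state over a known vertex adds no vertex, so exploring it leaves `V` unchanged. The loop
-- ends because explored states are distinct, and the next value stays above the stored one because
-- values are monotone.
theorem run_drain (h : SideInv o X H q r V s) (hq : X.IsPotential H q)
    (hW : (H + 1) * n * (n + 2) ≤ W)
    (hl : s.nat (o + 36) 0 < (H + 1) * n → s.real (o + 18) 0 ≤ s.real (o + 14) 0) :
    Run W (drain o) s (fun t s' => t + spent o s ≤ spent o s' + 40 ∧ SideInv o X H q r V s' ∧
      (s'.nat (o + 36) 0 < (H + 1) * n → s.real (o + 18) 0 ≤ s'.real (o + 14) 0) ∧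
      (s'.nat (o + 36) 0 < (H + 1) * n → ∀ v ∈ V, s'.nat (o + 36) 0 % n ≠ v.val)) := by
  unfold drain
  refine (run_loop (fun τ s' => τ + spent o s ≤ spent o s' ∧ SideInv o X H q r V s' ∧
      (s'.nat (o + 36) 0 < (H + 1) * n → s.real (o + 18) 0 ≤ s'.real (o + 14) 0))
    (fun s' => (H + 1) * n - s'.nat (o + 34) 0) ⟨by omega, h, hl⟩ ?_).mono ?_
  · rintro τ s' ⟨hτ, hI, hl'⟩ hF hb
    simp only [BExp.eval_conj, BExp.eval_natLT, BExp.eval_natLE, NExp.eval_var, NExp.eval_get,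
      NExp.eval_sub, NExp.eval_mul, NExp.eval_div, NExp.eval_ofNat, hI.data.states,
      hI.data.size] at hb
    obtain ⟨hb1, hb2⟩ := hb
    obtain ⟨j, hj, u, hc, hdiv, hsub⟩ := exists_code hb1
    rw [hdiv, hsub] at hb2
    have hu : u ∈ V := (hI.vertices.mark u).mp (by omega)
    refine (run_explore hI hq hW hb1).mono ?_
    rintro t s2 ⟨ht, hcnt, hbf, v, hv, hI2⟩
    obtain rfl : u = v := Fin.ext (by rw [← hv, hc, code_mod])
    rw [Finset.insert_eq_of_mem hu] at hI2
    have := hI2.search.card_le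
    refine ⟨⟨?_, hI2, fun h2 => (hl' hb1).trans (hbf h2)⟩, by omega⟩
    simp only [BExp.cost_conj, BExp.cost_natLT, BExp.cost_natLE, NExp.cost_var, NExp.cost_get,
      NExp.cost_sub, NExp.cost_mul, NExp.cost_div, NExp.cost_ofNat]
    omega
  · rintro t s' ⟨τ, ⟨hτ, hI, hl'⟩, hb, rfl⟩
    simp only [BExp.eval_conj, BExp.eval_natLT, BExp.eval_natLE, NExp.eval_var, NExp.eval_get,
      NExp.eval_sub, NExp.eval_mul, NExp.eval_div, NExp.eval_ofNat, hI.data.states,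
      hI.data.size] at hb
    refine ⟨?_, hI, hl', ?_⟩
    · simp only [BExp.cost_conj, BExp.cost_natLT, BExp.cost_natLE, NExp.cost_var, NExp.cost_get,
        NExp.cost_sub, NExp.cost_mul, NExp.cost_div, NExp.cost_ofNat]
      omega
    · intro hlt v hv heq
      obtain ⟨j, hj, u, hc, hdiv, hsub⟩ := exists_code hlt
      obtain rfl : u = v := Fin.ext (by rw [← heq, hc, code_mod])
      have := (hI.vertices.mark u).mpr hv
      exact hb ⟨hlt, by rw [hdiv, hsub]; omega⟩

/-- The new vertex lies on a walk whose weight is the value at which it is added, and by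
monotonicity this value also bounds the walks of the vertices added earlier. After draining, the
next value belongs to a vertex outside the set. -/
theorem run_addVertex (h : SideState o X H q r V s) (hq : X.IsPotential H q)
    (hW : (H + 1) * n * (n + 2) ≤ W) (hb : s.nat (o + 36) 0 < (H + 1) * n) :
    Run W (addVertex o) s (fun t s' => t + spent o s + 200 ≤ spent o s' ∧
      s'.real (o + 18) 0 = s.real (o + 14) 0 ∧
      ∃ v ∉ V, SideState o X H q r (insert v V) s') := by
  unfold addVertex
  rw [run_seq, run_setReal]
  refine ⟨Nat.zero_le _, ?_⟩
  set s1 := s.setReal (o + 18) ((0 : NExp).eval s) ((RExp.var (o + 14)).eval s) with hs1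
  have h1 : SideInv o X H q r V s1 := h.inv.congr (fun k _ => rfl) (by simp [hs1])
  have h18 : s1.real (o + 18) 0 = s.real (o + 14) 0 := by simp [hs1]
  have h14 : s1.real (o + 14) 0 = s.real (o + 14) 0 := by simp [hs1]
  refine (run_explore h1 hq hW hb).frame.seq ?_
  rintro t s2 ⟨⟨ht, -, hbf, v, hv, hI⟩, hF⟩
  have e18 := hF.real (o + 18) (by simp)
  refine (run_drain hI hq hW fun h2 => ?_).frame.mono ?_
  · rw [e18, h18, ← h14]; exact hbf h2
  rintro t' s3 ⟨⟨ht', hI3, hl3, hf3⟩, hF3⟩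
  have e18' := hF3.real (o + 18) (by simp)
  have hlast : s3.real (o + 18) 0 = s.real (o + 14) 0 := by rw [e18', e18, h18]
  have hsp : spent o s1 = spent o s := rfl
  refine ⟨?_, hlast, v, fun hvV => h.fresh hb v hvV hv, hI3, hf3, ?_, ?_⟩
  · rw [hsp] at ht
    simp only [NExp.cost_ofNat, RExp.cost_var]
    omega
  · intro w hw
    rw [hlast]
    rcases Finset.mem_insert.mp hw with rfl | hw
    · obtain ⟨u, hu, hx, -⟩ := (h.inv.next.reaches hb).mem_outWeights hq hb
      obtain rfl : u = w := Fin.ext (by rw [← hu]; exact hv)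
      exact ⟨_, hx, (h.inv.next.value hb).ge⟩
    · obtain ⟨x, hx, hle⟩ := h.bound w hw
      exact ⟨x, hx, hle.trans (h.last_le ⟨w, hw⟩ hb)⟩
  · intro _ h2
    rw [e18']; exact hl3 h2

/-- No state is marked. -/
structure Clean (o n S : ℕ) (s : Mem) : Prop where
  states : ∀ t ≤ S, s.nat (o + 26) t = 0
  vertices : ∀ v < n, s.nat (o + 28) v = 0

/-- Start a search of side `o` from the vertex in cell `2` of array `0`. -/
def startSearch (o : ℕ) : Prog :=
  Prog.setNat (o + 34) 0 0 ;;
  Prog.setNat o 0 0 ;;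
  Prog.setNat (o + 36) 0 (.get 0 2) ;;
  Prog.setReal (o + 14) 0 (.get (o + 20) (.get 0 2)) ;;
  Prog.setReal (o + 16) 0 0

theorem run_startSearch (ho : o ≠ 0) (h : SearchData o X H q s) (hC : Clean o n ((H + 1) * n) s)
    (hr : s.nat 0 2 = r.val) (hW : n ≤ W) :
    Run W (startSearch o) s (fun t s' => t ≤ 30 ∧ spent o s' = 0 ∧
      SideState o X H q r ∅ s') := by
  have hrW : r.val ≤ W := by have := r.isLt; omega
  unfold startSearch
  simp [hr, hrW, Ne.symm ho, spent]
  refine ⟨⟨h.congr (by simp) (by simp) (by simp) (by simp) (by simp) (by simp), ?_, ?_, ?_, ?_, ?_⟩,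
    by simp, by simp, by simp⟩
  · simpa using SearchInv.zero
  · simpa using NextInv.zero (h.start r)
  · intro t ht
    simpa using hC.states t ht
  · intro i hi
    simp at hi
  · refine ⟨by simp, by simp, fun v => ?_, fun v => by simp, by simp, by simp⟩
    simpa using hC.vertices v v.isLt

/-- Remove the marks of the search of side `o`. -/
def clear (o : ℕ) : Prog :=
  forN (o + 38) (.var (o + 34))
    (Prog.setNat (o + 40) 0 (.get (o + 30) (.var (o + 38))) ;;
    Prog.setNat (o + 26) (.var (o + 40)) 0 ;;
    Prog.setNat (o + 28) (.var (o + 40) - .var (o + 40) / .var (o + 4) * .var (o + 4)) 0)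

@[simp] theorem realWrites_clear (o : ℕ) : (clear o).realWrites = [] := rfl

/-- All marks belong to explored states or their vertices, so running through the list of explored
states removes them in time proportional to its length. The invariant locates the remaining marks at
indices `i ≥ k`. -/
theorem run_clear (h : SideInv o X H q r V s) (hW : (H + 1) * n * (n + 2) ≤ W) :
    Run W (clear o) s (fun t s' => t ≤ 60 * s.nat (o + 34) 0 + 20 ∧
      Clean o n ((H + 1) * n) s') := by
  have hcS := h.search.card_le
  have hSW : (H + 1) * n + n ≤ W := by
    have : (H + 1) * n * (n + 2) = (H + 1) * n * n + 2 * ((H + 1) * n) := by ring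
    have : n ≤ (H + 1) * n := by nlinarith
    omega
  unfold clear
  refine (run_forN_const (T := 40) (N := s.nat (o + 34) 0)
    (fun k s' => (∀ t ≤ (H + 1) * n, s'.nat (o + 26) t ≠ 0 →
        ∃ i, k ≤ i ∧ i < s.nat (o + 34) 0 ∧ s.nat (o + 30) i = t) ∧
      ∀ v : Fin n, s'.nat (o + 28) v.val ≠ 0 →
        ∃ i, k ≤ i ∧ i < s.nat (o + 34) 0 ∧ s.nat (o + 30) i % n = v.val)
    (by omega) ?_ (by simp [Prog.natWrites]) ?_ ?_).mono ?_
  · intro s' hF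
    simp [hF.nat (o + 34) (by simp [Prog.natWrites])]
  · constructor
    · intro t ht h0
      obtain ⟨k, hk, hk'⟩ := (h.marked t ht).mp (by simpa using h0)
      exact ⟨k, Nat.zero_le _, hk, hk'⟩
    · intro v h0
      obtain ⟨k, hk, hk'⟩ := (h.vertices.mem v).mp ((h.vertices.mark v).mp (by simpa using h0))
      exact ⟨k, Nat.zero_le _, hk, hk'⟩
  · rintro k s' hk ⟨h1, h2⟩ hs hF
    have e30 := hF.nat (o + 30) (by simp [Prog.natWrites])
    have e4 : s'.nat (o + 4) 0 = n := by
      rw [hF.nat (o + 4) (by simp [Prog.natWrites])]; exact h.data.size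
    have hlt := h.search.lt k hk
    obtain ⟨j, hj, u, hc, hdiv, hsub⟩ := exists_code hlt
    have hu := u.isLt
    have hmod : s.nat (o + 30) k % n = u.val := by rw [hc, code_mod]
    have w1 : s.nat (o + 30) k ≤ W := by omega
    have w2 : s.nat (o + 30) k ≤ W + j * n := by omega
    simp [hs, e30, e4, hdiv, hsub, w1, w2]
    refine ⟨fun t ht h0 => ?_, fun v h0 => ?_⟩
    · by_cases htc : t = s.nat (o + 30) k
      · rw [htc] at h0; simp at h0
      · rw [Function.update_of_ne htc] at h0
        obtain ⟨i, hi, hi2, hi3⟩ := h1 t ht h0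
        refine ⟨i, ?_, hi2, hi3⟩
        rcases hi.lt_or_eq with hi | rfl
        · omega
        · exact absurd hi3.symm htc
    · by_cases hvu : v = u
      · subst hvu; simp at h0
      · rw [Function.update_of_ne (Fin.val_ne_of_ne hvu)] at h0
        obtain ⟨i, hi, hi2, hi3⟩ := h2 v h0
        refine ⟨i, ?_, hi2, hi3⟩
        rcases hi.lt_or_eq with hi | rfl
        · omega
        · exact absurd (Fin.ext (hi3.symm.trans hmod)) hvu
  · rintro t s' ⟨⟨h1, h2⟩, ht⟩
    refine ⟨by simp at ht; omega, fun t ht => ?_, fun v hv => ?_⟩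
    · by_contra h0
      obtain ⟨i, hi, hi2, -⟩ := h1 t ht h0
      omega
    · by_contra h0
      obtain ⟨i, hi, hi2, -⟩ := h2 ⟨v, hv⟩ h0
      omega

/-- Every explored state consists of a discovered vertex and one of `H + 1` layers. -/
theorem SideInv.cnt_le (h : SideInv o X H q r V s) :
    s.nat (o + 34) 0 ≤ V.card * (H + 1) := by
  have := Finset.card_le_card_of_injOn (s := Finset.range (s.nat (o + 34) 0))
    (t := (V ×ˢ Finset.range (H + 1)).image fun p => p.2 * n + p.1.val) (s.nat (o + 30)) ?_ ?_
  · have h2 := this.trans Finset.card_image_le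
    simpa using h2
  · intro i hi
    have hi' : i < s.nat (o + 34) 0 := by simpa using hi
    obtain ⟨j, hj, u, hc, -, -⟩ := exists_code (h.search.lt i hi')
    have hu : u ∈ V := (h.vertices.mem u).mpr ⟨i, hi', by rw [hc, code_mod]⟩
    exact Finset.mem_coe.mpr (Finset.mem_image.mpr
      ⟨(u, j), Finset.mem_product.mpr ⟨hu, by simp; omega⟩, hc.symm⟩)
  · intro i hi k hk
    exact h.search.inj i (by simpa using hi) k (by simpa using hk)

/-- Each of the `cnt` pointers is at most `cnt`, so the pointer part of the budget is also quadratic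
in `cnt`. -/
theorem SideInv.spent_le (h : SideInv o X H q r V s) :
    spent o s ≤ 1100 * (s.nat (o + 34) 0) ^ 2 := by
  have : ∑ i ∈ Finset.range (s.nat (o + 34) 0), s.nat (o + 32) i ≤
      ∑ i ∈ Finset.range (s.nat (o + 34) 0), s.nat (o + 34) 0 :=
    Finset.sum_le_sum fun i hi => h.pointers.le_cnt h.data h.search (by simpa using hi)
  simp only [Finset.sum_const, Finset.card_range, smul_eq_mul] at this
  unfold spent
  nlinarith

end

end RealRAM

/-! ### Alternation of the forward and the backward search. -/

namespace RealRAM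

open FrozenGraph

section

variable {W n H₂ H₃ : ℕ} {X Y : FrozenGraph n} {q₂ q₃ : ℕ → ℝ} {r : Fin n} {V₂ V₃ : Finset (Fin n)}
  {s : Mem}

theorem SideState.frame {o H : ℕ} {q : ℕ → ℝ} {V : Finset (Fin n)} {s' : Mem} {p : Prog}
    (h : SideState o X H q r V s) (hF : Frame p s s')
    (hn : ∀ k ∈ [0, 4, 8, 24, 26, 28, 30, 32, 34, 36], o + k ∉ p.natWrites)
    (hr : ∀ k ∈ [0, 8, 10, 12, 14, 16, 18, 20], o + k ∉ p.realWrites) :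
    SideState o X H q r V s' :=
  h.congr (fun k hk => hF.nat _ (hn k hk)) fun k hk => hF.real _ (hr k hk)

theorem spent_congr {o : ℕ} {s' : Mem} (h34 : s'.nat (o + 34) = s.nat (o + 34))
    (h32 : s'.nat (o + 32) = s.nat (o + 32)) : spent o s' = spent o s := by
  unfold spent; rw [h34, h32]

/-- The two searches have been stopped at the value in cell `0` of the real array `1`. -/
structure Balanced (S₂ S₃ : ℕ) (V₂ V₃ : Finset (Fin n)) (s : Mem) : Prop where
  out_le : s.real 20 0 ≤ -s.real 1 0
  in_le : V₃.Nonempty → s.real 21 0 ≤ s.real 1 0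
  strict : s.real 20 0 < -s.real 1 0 ∨ (V₃.Nonempty → s.real 21 0 < s.real 1 0)
  out_next : s.nat 38 0 < S₂ → -s.real 1 0 ≤ s.real 16 0
  in_next : s.nat 39 0 < S₃ → s.real 1 0 ≤ s.real 17 0
  card_out_le : V₂.card ≤ V₃.card + 1
  card_in_le : V₃.card ≤ V₂.card

/-- Stop both searches. -/
def stopAt (e : RExp) : Prog := Prog.setReal 1 0 e ;; Prog.setNat 60 0 0

/-- Add a vertex to the backward search and one to the forward search, or stop. -/
def alternate : Prog :=
  Prog.cond (.conj (.natLT (.var 39) (.var 11)) (.realLT (.var 17 + .var 20) 0))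
    (addVertex 3 ;;
      Prog.cond (.conj (.natLT (.var 38) (.var 10)) (.realLT (.var 16 + .var 21) 0))
        (addVertex 2) (stopAt (.var 21)))
    (stopAt (0 - .var 20))

/-- The invariant of the alternation of the two searches. -/
def Alternating (X Y : FrozenGraph n) (H₂ H₃ : ℕ) (q₂ q₃ : ℕ → ℝ) (r : Fin n) (T τ : ℕ)
    (s : Mem) : Prop :=
  ∃ V₂ V₃ : Finset (Fin n), SideState 2 X H₂ q₂ r V₂ s ∧ SideState 3 Y H₃ q₃ r V₃ s ∧
    V₂.Nonempty ∧
    ((s.nat 60 0 = 1 ∧ V₂.card = V₃.card + 1 ∧ (V₃.Nonempty → s.real 20 0 + s.real 21 0 < 0) ∧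
        τ + T ≤ spent 2 s + spent 3 s) ∨
      (s.nat 60 0 = 0 ∧ Balanced ((H₂ + 1) * n) ((H₃ + 1) * n) V₂ V₃ s ∧
        τ + T ≤ spent 2 s + spent 3 s + 100))

/-- Before a round the forward search is one vertex ahead and the last values of the two sides have
negative sum, if both exist. If the next backward value, added to the last forward value, is not
negative, then minus the last forward value is a threshold that is strict on the backward side.
Otherwise a backward vertex is added. If the next forward value is then too large, the last backward
value is a threshold that is strict on the forward side. Otherwise the forward search moves ahead
again. An exhausted side counts as having no next value. -/
theorem run_alternate {T τ : ℕ} (h : Alternating X Y H₂ H₃ q₂ q₃ r T τ s)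
    (hq₂ : X.IsPotential H₂ q₂) (hq₃ : Y.IsPotential H₃ q₃) (hW₂ : (H₂ + 1) * n * (n + 2) ≤ W)
    (hW₃ : (H₃ + 1) * n * (n + 2) ≤ W) (hb : s.nat 60 0 = 1) :
    Run W alternate s (fun t s' => Alternating X Y H₂ H₃ q₂ q₃ r T (τ + (5 + t)) s' ∧
      s'.nat 60 0 + (n - s'.nat 3 0) < s.nat 60 0 + (n - s.nat 3 0)) := by
  obtain ⟨V₂, V₃, h2, h3, hne, ⟨-, hcard, hneg, hτ⟩ | ⟨hb', -⟩⟩ := h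
  swap
  · omega
  have S2 := h2.inv.data.states
  have S3 := h3.inv.data.states
  have z3 := h3.inv.vertices.size
  norm_num at S2 S3 z3
  unfold alternate
  rw [run_cond]
  simp only [BExp.eval_conj, BExp.eval_natLT, BExp.eval_realLT, NExp.eval_var, RExp.eval_add,
    RExp.eval_var, RExp.eval_zero, S3]
  constructor
  · rintro ⟨hlt, hf⟩
    refine (run_addVertex h3 hq₃ hW₃ hlt).frame.seq ?_
    rintro t s1 ⟨⟨ht, hlast, v, hv, h3'⟩, hF⟩
    have h2' : SideState 2 X H₂ q₂ r V₂ s1 := h2.frame hF (by decide) (by decide)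
    have hsp : spent 2 s1 = spent 2 s :=
      spent_congr (hF.nat _ (by decide)) (hF.nat _ (by decide))
    have e60 := hF.nat 60 (by decide)
    have e20 := hF.real 20 (by decide)
    have z3' := h3'.inv.vertices.size
    have S2' := h2'.inv.data.states
    have hc3 : (insert v V₃).card = V₃.card + 1 := Finset.card_insert_of_notMem hv
    have hle : (insert v V₃).card ≤ n := by simpa using Finset.card_le_univ (insert v V₃)
    norm_num at hlast S2' z3'
    have hneg' : s1.real 20 0 + s1.real 21 0 < 0 := by rw [e20, hlast]; linarith
    rw [run_cond]
    simp only [BExp.eval_conj, BExp.eval_natLT, BExp.eval_realLT, NExp.eval_var, RExp.eval_add,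
      RExp.eval_var, RExp.eval_zero, S2']
    constructor
    · rintro ⟨hlt2, hf2⟩
      refine (run_addVertex h2' hq₂ hW₂ hlt2).frame.mono ?_
      rintro t' s2 ⟨⟨ht', hlast', w, hw, h2''⟩, hF'⟩
      have hsp' : spent 3 s2 = spent 3 s1 :=
        spent_congr (hF'.nat _ (by decide)) (hF'.nat _ (by decide))
      have e60' := hF'.nat 60 (by decide)
      have e21 := hF'.real 21 (by decide)
      have e3 := hF'.nat 3 (by decide)
      norm_num at hlast'
      refine ⟨⟨insert w V₂, insert v V₃, h2'', h3'.frame hF' (by decide) (by decide),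
        Finset.insert_nonempty _ _, Or.inl ⟨by rw [e60', e60, hb], ?_, ?_, ?_⟩⟩, ?_⟩
      · rw [Finset.card_insert_of_notMem hw, hc3, hcard]
      · intro _
        rw [hlast', e21]; linarith
      · simp
        omega
      · rw [e60', e60, e3, z3', z3]; omega
    · intro hno
      -- Stop after a backward addition: the sets have equal size, and the negative sum gives
      -- strictness for the forward side.
      simp [stopAt]
      refine ⟨⟨V₂, insert v V₃, h2'.congr (by simp) (by simp), h3'.congr (by simp) (by simp), hne,
        Or.inr ⟨by simp, ?_, ?_⟩⟩, ?_⟩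
      · constructor <;> try simp
        · linarith
        · linarith
        · intro hlt2
          by_contra hcon
          exact hno ⟨hlt2, by linarith⟩
        · intro hlt3
          exact h3'.last_le (Finset.insert_nonempty _ _) hlt3
        · omega
        · omega
      · simp [spent] at hsp hτ ht ⊢
        omega
      · omega
  · intro hno
    -- Stop before a backward addition: the forward set has one more vertex and attains the
    -- threshold. Strictness holds on the backward side, vacuously if it is still empty.
    simp [stopAt]
    refine ⟨⟨V₂, V₃, h2.congr (by simp) (by simp), h3.congr (by simp) (by simp), hne,
        Or.inr ⟨by simp, ?_, ?_⟩⟩, by omega⟩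
    · constructor <;> try simp
      · intro hne3; linarith [hneg hne3]
      · intro hne3; linarith [hneg hne3]
      · intro hlt2
        exact h2.last_le hne hlt2
      · intro hlt3
        by_contra hcon
        exact hno ⟨hlt3, by linarith⟩
      · omega
      · omega
    · simp [spent] at hτ ⊢
      omega

/-- The query for the vertex in cell `2` of array `0`. -/
def queryProg : Prog :=
  startSearch 2 ;; startSearch 3 ;; addVertex 2 ;; Prog.setNat 60 0 1 ;;
  Prog.loop (.natLE 1 (.var 60)) alternate ;; clear 2 ;; clear 3

/-- The first forward vertex is added unconditionally, so that a last forward value exists from then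
on. The memory `s₁` is the one before the marks are erased; erasing touches none of the arrays that
hold the results. -/
theorem run_queryProg (h2 : SearchData 2 X H₂ q₂ s) (h3 : SearchData 3 Y H₃ q₃ s)
    (hC2 : Clean 2 n ((H₂ + 1) * n) s) (hC3 : Clean 3 n ((H₃ + 1) * n) s)
    (hr : s.nat 0 2 = r.val)
    (hq₂ : X.IsPotential H₂ q₂) (hq₃ : Y.IsPotential H₃ q₃) (hW₂ : (H₂ + 1) * n * (n + 2) ≤ W)
    (hW₃ : (H₃ + 1) * n * (n + 2) ≤ W) :
    Run W queryProg s (fun t s' => ∃ (V₂ V₃ : Finset (Fin n)) (s₁ : Mem),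
      t ≤ spent 2 s₁ + spent 3 s₁ + 60 * (s₁.nat 36 0 + s₁.nat 37 0) + 300 ∧
      SideState 2 X H₂ q₂ r V₂ s₁ ∧ SideState 3 Y H₃ q₃ r V₃ s₁ ∧ V₂.Nonempty ∧
      Balanced ((H₂ + 1) * n) ((H₃ + 1) * n) V₂ V₃ s₁ ∧
      Frame (clear 2 ;; clear 3) s₁ s' ∧
      Clean 2 n ((H₂ + 1) * n) s' ∧ Clean 3 n ((H₃ + 1) * n) s') := by
  have hr0 := r.isLt
  have hnW : n ≤ (H₂ + 1) * n * (n + 2) := by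
    have : n * 1 ≤ (H₂ + 1) * n * (n + 2) := by
      rw [mul_comm (H₂ + 1), mul_assoc]
      exact Nat.mul_le_mul_left _ (Nat.mul_pos (by omega) (by omega))
    omega
  unfold queryProg
  refine (run_startSearch (by decide) h2 hC2 hr (by omega)).frame.seq ?_
  rintro t1 s1 ⟨⟨ht1, hsp1, g2⟩, hF1⟩
  have h3' : SearchData 3 Y H₃ q₃ s1 := h3.congr (hF1.nat _ (by decide)) (hF1.nat _ (by decide))
    (hF1.nat _ (by decide)) (hF1.real _ (by decide)) (hF1.real _ (by decide))
    (hF1.real _ (by decide))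
  have hC3' : Clean 3 n ((H₃ + 1) * n) s1 := by
    constructor
    · rw [hF1.nat (3 + 26) (by decide)]; exact hC3.states
    · rw [hF1.nat (3 + 28) (by decide)]; exact hC3.vertices
  refine (run_startSearch (r := r) (by decide) h3' hC3' ?_ (by omega)).frame.seq ?_
  · rw [hF1.nat 0 (by decide), hr]
  rintro t2 s2 ⟨⟨ht2, hsp2, g3⟩, hF2⟩
  replace g2 := g2.frame hF2 (by decide) (by decide)
  -- With no discovered vertex there is no explored state, so the next state is the root itself.
  have hb : s2.nat (2 + 36) 0 < (H₂ + 1) * n := by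
    have h0 : s2.nat (2 + 34) 0 = 0 := by
      by_contra hne
      have := (g2.inv.vertices.mem ⟨s2.nat (2 + 30) 0 % n, Nat.mod_lt _ (by omega)⟩).mpr
        ⟨0, by omega, rfl⟩
      simp at this
    rw [(g2.inv.next.start h0).1]
    have := code_lt (Nat.zero_le H₂) r
    simpa using this
  refine (run_addVertex g2 hq₂ hW₂ hb).frame.seq ?_
  rintro t3 s3 ⟨⟨ht3, hlast, v, hv, k2⟩, hF3⟩
  have k3 := g3.frame hF3 (by decide) (by decide)
  have hsp3 : spent 3 s3 = spent 3 s2 :=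
    spent_congr (hF3.nat _ (by decide)) (hF3.nat _ (by decide))
  rw [run_seq, run_setNat]
  refine ⟨Nat.zero_le _, ?_, ?_⟩
  · simp only [NExp.eval_ofNat]; omega
  simp only [NExp.eval_ofNat, NExp.cost_ofNat]
  set s4 := s3.setNat 60 0 1 with hs4
  have hA : Alternating X Y H₂ H₃ q₂ q₃ r (spent 2 s4 + spent 3 s4) 0 s4 := by
    refine ⟨insert v ∅, ∅, k2.congr (by simp [hs4]) (by simp [hs4]),
      k3.congr (by simp [hs4]) (by simp [hs4]), Finset.insert_nonempty _ _,
      Or.inl ⟨by simp [hs4], by simp, by simp, by omega⟩⟩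
  -- The variant is the continuation flag plus the number of vertices missing from the backward set:
  -- a round either clears the flag or enlarges that set.
  refine Run.seq (run_loop (Alternating X Y H₂ H₃ q₂ q₃ r (spent 2 s4 + spent 3 s4))
    (fun s => s.nat 60 0 + (n - s.nat 3 0)) hA ?_) ?_
  · intro τ s5 hA5 hF5 hb5
    have hb5' : s5.nat 60 0 = 1 := by
      simp at hb5
      obtain ⟨_, _, -, -, -, ⟨h, -⟩ | ⟨h, -⟩⟩ := hA5 <;> omega
    exact run_alternate hA5 hq₂ hq₃ hW₂ hW₃ hb5'
  rintro t4 s5 ⟨τ, ⟨V₂, V₃, m2, m3, hne, hor⟩, hb5, rfl⟩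
  simp at hb5
  obtain ⟨h, -⟩ | ⟨-, hB, hτ⟩ := hor
  · omega
  refine (run_clear m2.inv hW₂).frame.seq ?_
  rintro t5 s6 ⟨⟨ht5, c2⟩, hF6⟩
  have m3' := m3.frame hF6 (by decide) (by decide)
  refine (run_clear m3'.inv hW₃).frame.mono ?_
  rintro t6 s7 ⟨⟨ht6, c3⟩, hF7⟩
  have e37 := hF6.nat 37 (by decide)
  have hspA : spent 2 s4 = spent 2 s3 := by simp [spent, hs4]
  have hspB : spent 3 s4 = spent 3 s3 := by simp [spent, hs4]
  refine ⟨V₂, V₃, s5, ?_, m2, m3, hne, hB, (hF6.weaken ?_ ?_).trans (hF7.weaken ?_ ?_), ⟨?_, ?_⟩, c3⟩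
  · norm_num at ht5 ht6
    rw [e37] at ht6
    simp only [BExp.cost_natLE, NExp.cost_ofNat, NExp.cost_var]
    omega
  · simp [Prog.natWrites]
  · simp [Prog.realWrites]
  · simp [Prog.natWrites]
  · simp [Prog.realWrites]
  · rw [hF7.nat (2 + 26) (by decide)]; exact c2.states
  · rw [hF7.nat (2 + 28) (by decide)]; exact c2.vertices

end

end RealRAM

/-! ### Preprocessing and report -/

namespace RealRAM

open FrozenGraph

section

variable {W n o H L : ℕ} {X : FrozenGraph n} {s : Mem}

/-- Load the graph of side `o`; the entry with number `o + 14` is read from the cell `e`. -/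
def loadGraph (o : ℕ) (e : NExp) : Prog :=
  forN (o + 14) (.var (o + 4) * .var (o + 4))
    (Prog.setNat (o + 2) (.var (o + 14)) (.get 1 e) ;;
    Prog.setReal (o + 2) (.var (o + 14)) (.get 0 e))

@[simp] theorem natWrites_loadGraph (o : ℕ) (e : NExp) :
    (loadGraph o e).natWrites = [o + 14, o + 2, o + 14] := rfl
@[simp] theorem realWrites_loadGraph (o : ℕ) (e : NExp) :
    (loadGraph o e).realWrites = [o + 2] := rfl

/-- The address expression `e` and the index map `g` are free, so the same loop loads the matrix for
the forward side and its transpose for the backward side. -/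
theorem run_loadGraph {e : NExp} {g : Fin n → Fin n → ℕ} (hn : s.nat (o + 4) 0 = n)
    (hadj : ∀ u v, s.nat 1 (g u v) = edgeCode X u v)
    (hw : ∀ u v, X.Adj u v → s.real 0 (g u v) = X.weight u v)
    (he : ∀ (s' : Mem) (u v : Fin n), s'.nat (o + 4) 0 = n →
      s'.nat (o + 14) 0 = u.val * n + v.val → e.eval s' = g u v)
    (hc : e.cost ≤ 30) (hW : n * n ≤ W) (hW2 : 2 ≤ W) :
    Run W (loadGraph o e) s (fun t s' => t ≤ 200 * n ^ 2 + 20 ∧ HasGraph o X s') := by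
  unfold loadGraph
  refine (run_forN_const (N := n * n) (T := 100) (fun k s' => ∀ u v : Fin n,
      u.val * n + v.val < k → s'.nat (o + 2) (u.val * n + v.val) = edgeCode X u v ∧
      (X.Adj u v → s'.real (o + 2) (u.val * n + v.val) = X.weight u v))
    hW ?_ (by simp [Prog.natWrites]) (by simp) ?_).frame.mono ?_
  · intro s' hF
    simp [hF.nat (o + 4) (by simp [Prog.natWrites]), hn]
  · rintro k s' hk hI hk' hF
    have e4 := hF.nat (o + 4) (by simp [Prog.natWrites])
    have e1 := hF.nat 1 (by simp [Prog.natWrites])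
    have r0 := hF.real 0 (by simp [Prog.realWrites])
    have hn' : s'.nat (o + 4) 0 = n := by rw [e4, hn]
    obtain ⟨j, hj, v, hc', -, -⟩ := exists_code (n := n) (H := n - 1) (c := k)
      (by rwa [Nat.sub_add_cancel (Nat.pos_of_ne_zero (by rintro rfl; simp at hk))])
    obtain ⟨u, rfl⟩ : ∃ u : Fin n, u.val = j := ⟨⟨j, by have := v.isLt; omega⟩, rfl⟩
    have ev := he s' u v hn' (by rw [hk', hc'])
    have ev' := he (s'.setNat (o + 2) k (edgeCode X u v)) u v (by simpa using hn')
      (by simp [hk', hc'])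
    have hkW : k ≤ W := by omega
    have hcW : edgeCode X u v ≤ W := by
      refine le_trans ?_ hW2
      unfold edgeCode; split_ifs <;> omega
    simp [hk', ev, e1, hadj, hkW, hcW, ev', r0]
    refine ⟨by omega, ?_⟩
    intro u' v' hlt
    by_cases hk2 : u'.val * n + v'.val = k
    · obtain rfl : v' = v := Fin.ext (by rw [← code_mod u'.val v', hk2, hc', code_mod])
      obtain rfl : u' = u := Fin.ext (by rw [← code_div u'.val v', hk2, hc', code_div])
      simp only [hk2, Function.update_self, true_and]
      exact hw u' v'
    · simp only [Function.update_of_ne hk2]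
      exact hI u' v' (by omega)
  · rintro t s' ⟨⟨hI, ht⟩, hF⟩
    have e4 := hF.nat (o + 4) (by simp [Prog.natWrites])
    have hlt : ∀ u v : Fin n, u.val * n + v.val < n * n := by
      intro u v
      have h1 : (u.val + 1) * n ≤ n * n := Nat.mul_le_mul_right _ u.isLt
      have h2 := v.isLt
      rw [add_mul, one_mul] at h1
      omega
    refine ⟨?_, by rw [e4, hn], fun u v => (hI u v (hlt u v)).1, fun u v => (hI u v (hlt u v)).2⟩
    simp at ht
    nlinarith

/-- Initialize the labels of level `0`: the vertices that pass the test get the label `0`. -/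
def initLabels (o : ℕ) (b : BExp) : Prog :=
  forN (o + 14) (.var (o + 4))
    (Prog.cond b (Prog.setNat (o + 10) (.var (o + 14)) 1) (Prog.setNat (o + 10) (.var (o + 14)) 0) ;;
    Prog.setReal (o + 4) (.var (o + 14)) 0)

@[simp] theorem natWrites_initLabels (o : ℕ) (b : BExp) :
    (initLabels o b).natWrites = [o + 14, o + 10, o + 10, o + 14] := rfl
@[simp] theorem realWrites_initLabels (o : ℕ) (b : BExp) :
    (initLabels o b).realWrites = [o + 4] := rfl

theorem run_initLabels {b : BExp} {T : Fin n → Prop} (hn : s.nat (o + 4) 0 = n)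
    (hb : ∀ (s' : Mem) (v : Fin n), s'.nat 0 = s.nat 0 → s'.nat (o + 14) 0 = v.val →
      (b.eval s' ↔ T v)) (hc : b.cost ≤ 30) (hW : n ≤ W) :
    Run W (initLabels o b) s (fun t s' => t ≤ 100 * n + 20 ∧
      (∀ v : Fin n, IsLab {x : ℝ | T v ∧ x = 0} (s'.nat (o + 10) v.val) (s'.real (o + 4) v.val)) ∧
      ∀ v : Fin n, s'.nat (o + 10) v.val ≤ 1) := by
  have hlab : ∀ v : Fin n, T v → IsLab {x : ℝ | T v ∧ x = 0} 1 0 := fun v hv =>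
    ⟨fun _ => ⟨⟨hv, rfl⟩, fun x hx => hx.2.ge⟩, fun h => absurd h one_ne_zero⟩
  have hlab' : ∀ v : Fin n, ¬ T v → IsLab {x : ℝ | T v ∧ x = 0} 0 0 := fun v hv =>
    ⟨fun h => absurd rfl h, fun _ => Set.eq_empty_of_forall_notMem fun x hx => hv hx.1⟩
  unfold initLabels
  refine (run_forN_const (N := n) (T := 60) (fun k s' => ∀ v : Fin n, v.val < k →
      IsLab {x : ℝ | T v ∧ x = 0} (s'.nat (o + 10) v.val) (s'.real (o + 4) v.val) ∧
      s'.nat (o + 10) v.val ≤ 1)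
    hW ?_ (by simp [Prog.natWrites]) (by simp) ?_).mono ?_
  · intro s' hF
    simp [hF.nat (o + 4) (by simp [Prog.natWrites]), hn]
  · rintro k s' hk hI hk' hF
    have e0 := hF.nat 0 (by simp [Prog.natWrites])
    obtain ⟨v, rfl⟩ : ∃ v : Fin n, v.val = k := ⟨⟨k, hk⟩, rfl⟩
    have hv := hb s' v e0 hk'
    have hvW : v.val ≤ W := by omega
    have hpos : ∀ (x : ℕ) (y : ℝ), IsLab {x : ℝ | T v ∧ x = 0} x y → x ≤ 1 → ∀ w : Fin n, w ≤ v →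
        IsLab {x : ℝ | T w ∧ x = 0} (Function.update (s'.nat (o + 10)) v.val x w.val)
          (Function.update (s'.real (o + 4)) v.val y w.val) ∧
        Function.update (s'.nat (o + 10)) v.val x w.val ≤ 1 := by
      intro x y hxy hx w hw
      by_cases hwv : w = v
      · subst hwv; simpa using ⟨hxy, hx⟩
      · have hne := Fin.val_ne_of_ne hwv
        simp only [Function.update_of_ne hne]
        exact hI w (lt_of_le_of_ne hw hne)
    simp [hk', hvW, hv]
    refine ⟨fun h1 => ⟨by omega, by omega, hpos 1 0 (hlab v h1) le_rfl⟩,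
      fun h1 => ⟨by omega, hpos 0 0 (hlab' v h1) zero_le_one⟩⟩
  · rintro t s' ⟨hI, ht⟩
    simp at ht
    exact ⟨by omega, fun v => (hI v v.isLt).1, fun v => (hI v v.isLt).2⟩

/-- Copy the labels of the last level to the real array `a`. -/
def copyLevel (o a : ℕ) : Prog :=
  forN (o + 14) (.var (o + 4))
    (Prog.setReal a (.var (o + 14)) (.get (o + 4) (.var (o + 48) * .var (o + 4) + .var (o + 14))))

@[simp] theorem natWrites_copyLevel (o a : ℕ) :
    (copyLevel o a).natWrites = [o + 14, o + 14] := rfl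
@[simp] theorem realWrites_copyLevel (o a : ℕ) : (copyLevel o a).realWrites = [a] := rfl

theorem run_copyLevel {a K : ℕ} (hn : s.nat (o + 4) 0 = n) (hK : s.nat (o + 48) 0 = K)
    (ha : a ≠ o + 4) (hW : n ≤ W) :
    Run W (copyLevel o a) s (fun t s' => t ≤ 100 * n + 20 ∧
      ∀ v < n, s'.real a v = s.real (o + 4) (K * n + v)) := by
  unfold copyLevel
  refine (run_forN_const (N := n) (T := 40) (fun k s' =>
      ∀ v < k, s'.real a v = s.real (o + 4) (K * n + v))
    hW ?_ (by simp [Prog.natWrites]) (by simp) ?_).mono ?_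
  · intro s' hF
    simp [hF.nat (o + 4) (by simp [Prog.natWrites]), hn]
  · rintro k s' hk hI hk' hF
    have e4 := hF.nat (o + 4) (by simp [Prog.natWrites])
    have e48 := hF.nat (o + 48) (by simp [Prog.natWrites])
    have r4 := hF.real (o + 4) (by simp [Prog.realWrites, ha.symm])
    have hkW : k ≤ W := by omega
    simp [hk', hkW, e4, e48, hn, hK, r4]
    intro v hv
    rcases hv.lt_or_eq with hv | rfl
    · rw [Function.update_of_ne hv.ne]; exact hI v hv
    · simp
  · rintro t s' ⟨hI, ht⟩
    simp at ht
    exact ⟨by omega, hI⟩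

/-- Remove all marks. -/
def clearAll (o : ℕ) : Prog :=
  forN (o + 38) (.var (o + 4)) (Prog.setNat (o + 28) (.var (o + 38)) 0) ;;
  forN (o + 38) (.var (o + 8) + 1) (Prog.setNat (o + 26) (.var (o + 38)) 0)

@[simp] theorem natWrites_clearAll (o : ℕ) :
    (clearAll o).natWrites = [o + 38, o + 28, o + 38, o + 38, o + 26, o + 38] := rfl
@[simp] theorem realWrites_clearAll (o : ℕ) : (clearAll o).realWrites = [] := rfl

theorem run_setZero {a i N : ℕ} {m : NExp} (hai : a ≠ i)
    (hm : ∀ s', Frame (forN i m (Prog.setNat a (.var i) 0)) s s' → m.eval s' = N)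
    (hW : N ≤ W) :
    Run W (forN i m (Prog.setNat a (.var i) 0)) s (fun t s' =>
      t ≤ N * (m.cost + 20) + m.cost + 9 ∧ ∀ k < N, s'.nat a k = 0) := by
  refine (run_forN_const (N := N) (T := 8) (fun k s' => ∀ j < k, s'.nat a j = 0)
    hW hm (by simp [Prog.natWrites, hai.symm]) (by simp) ?_).mono ?_
  · rintro k s' hk hI hk' hF
    have hkW : k ≤ W := by omega
    simp [hk', hkW, hai]
    intro j hj
    rcases hj.lt_or_eq with hj | rfl
    · rw [Function.update_of_ne hj.ne]; exact hI j hj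
    · simp
  · rintro t s' ⟨hI, ht⟩
    refine ⟨?_, hI⟩
    have : N * (8 + (m.cost + 12)) = N * (m.cost + 20) := by ring
    omega

theorem run_clearAll {S : ℕ} (hn : s.nat (o + 4) 0 = n) (hS : s.nat (o + 8) 0 = S)
    (hW : n ≤ W) (hW' : S + 1 ≤ W) :
    Run W (clearAll o) s (fun t s' => t ≤ 30 * (n + S) + 80 ∧ Clean o n S s') := by
  unfold clearAll
  refine (run_setZero (N := n) (by simp) ?_ hW).frame.seq ?_
  · intro s' hF
    simp [hF.nat (o + 4) (by simp [Prog.natWrites]), hn]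
  rintro t s1 ⟨⟨ht, h28⟩, hF⟩
  have e8 := hF.nat (o + 8) (by simp [Prog.natWrites])
  refine (run_setZero (N := S + 1) (by simp) ?_ hW').frame.mono ?_
  · intro s' hF'
    simp [hF'.nat (o + 8) (by simp [Prog.natWrites]), e8, hS]
  rintro t' s2 ⟨⟨ht', h26⟩, hF'⟩
  have e28 := hF'.nat (o + 28) (by simp [Prog.natWrites])
  simp at ht ht'
  exact ⟨by omega, fun t ht => h26 t (by omega), by rw [e28]; exact h28⟩

/-- The preprocessing of side `o`, with hop bound `hop`. -/
def prepareSide (o : ℕ) (e hop : NExp) : Prog :=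
  Prog.setNat (o + 4) 0 (.get 0 0) ;;
  Prog.setNat (o + 6) 0 hop ;;
  Prog.setNat (o + 48) 0 hop ;;
  Prog.setNat (o + 8) 0 ((.var (o + 6) + 1) * .var (o + 4)) ;;
  loadGraph o e ;; initLabels o (.natLE 0 0) ;; levels o ;; copyLevel o (o + 20) ;; sortAll o ;;
  clearAll o

/-- Every phase is bounded by a multiple of `A = (H + 1) * n ^ 2`, except for sorting, which
contributes `A * L`. -/
theorem prepare_time {t₂ t₃ t₄ t₅ t₆ t₇ : ℕ} (hn : 0 < n) (hL : 0 < L)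
    (h2 : t₂ ≤ 200 * n ^ 2 + 20) (h3 : t₃ ≤ 100 * n + 20)
    (h4 : t₄ ≤ 1000 * ((H + 1) * (n + 1) ^ 2)) (h5 : t₅ ≤ 100 * n + 20)
    (h6 : t₆ ≤ (H + 1) * n * (n * (200 * L + 500) + 250) + 20)
    (h7 : t₇ ≤ 30 * (n + (H + 1) * n) + 80) :
    t₂ + t₃ + t₄ + t₅ + t₆ + t₇ + 100 ≤ 10000 * ((H + 1) * n ^ 2 * L) := by
  obtain ⟨A, hA⟩ : ∃ A, A = (H + 1) * n ^ 2 := ⟨_, rfl⟩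
  have e1 : (H + 1) * n ≤ A := by rw [hA]; exact Nat.mul_le_mul_left _ (by nlinarith)
  have e0 : n ≤ (H + 1) * n := Nat.le_mul_of_pos_left _ (by omega)
  have e2 : n ^ 2 ≤ A := by rw [hA]; exact Nat.le_mul_of_pos_left _ (by omega)
  have e3 : (H + 1) * (n + 1) ^ 2 ≤ 4 * A := by
    have : (n + 1) ^ 2 ≤ 4 * n ^ 2 := by nlinarith
    calc (H + 1) * (n + 1) ^ 2 ≤ (H + 1) * (4 * n ^ 2) := Nat.mul_le_mul_left _ this
      _ = 4 * A := by rw [hA]; ring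
  have e4 : (H + 1) * n * (n * (200 * L + 500) + 250) =
      200 * (A * L) + 500 * A + 250 * ((H + 1) * n) := by rw [hA]; ring
  have e5 : A ≤ A * L := Nat.le_mul_of_pos_right _ hL
  rw [← hA]
  rw [e4] at h6
  omega

/-- With all vertices terminal, level `H - j` holds the least weights of continuations after `j`
hops, that is, the potential on layer `j`. The trivial walk guarantees that these labels exist. -/
theorem run_prepareSide {e hop : NExp} {g : Fin n → Fin n → ℕ} (hn : s.nat 0 0 = n) (hn0 : 0 < n)
    (hL0 : 0 < L)
    (hadj : ∀ u v, s.nat 1 (g u v) = edgeCode X u v)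
    (hw : ∀ u v, X.Adj u v → s.real 0 (g u v) = X.weight u v)
    (he : ∀ (s' : Mem) (u v : Fin n), s'.nat (o + 4) 0 = n →
      s'.nat (o + 14) 0 = u.val * n + v.val → e.eval s' = g u v)
    (hc : e.cost ≤ 30) (hhop : ∀ s' : Mem, s'.nat 0 = s.nat 0 → hop.eval s' = H)
    (hc' : hop.cost ≤ 5) (hW : (H + 1) * n * (n + 2) + 4 * n + 2 * H ≤ W) (hL : n ≤ 2 ^ L) :
    Run W (prepareSide o e hop) s (fun t s' => t ≤ 10000 * ((H + 1) * n ^ 2 * L) ∧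
      HasGraph o X s' ∧ Clean o n ((H + 1) * n) s' ∧
      ∃ q, X.IsPotential H q ∧ SearchData o X H q s') := by
  have hHn : n ≤ (H + 1) * n := by nlinarith
  have hHW : (H + 1) * n + 2 * n + 2 * H ≤ W := by nlinarith
  have hnn : n * n ≤ W := by nlinarith
  have w1 : n ≤ W := by omega
  have w2 : H ≤ W := by omega
  have w3 : (H + 1) * n ≤ W := by omega
  have hop1 := hhop (s.setNat (o + 4) 0 n) (by simp)
  have hop2 := hhop ((s.setNat (o + 4) 0 n).setNat (o + 6) 0 H) (by simp)
  unfold prepareSide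
  simp only [run_seq, run_setNat, NExp.eval_ofNat, NExp.eval_get, hn, hop1, hop2, Nat.zero_le,
    true_and, w1, w2]
  refine ⟨by simpa using w3, ?_⟩
  set s1 := (((s.setNat (o + 4) 0 n).setNat (o + 6) 0 H).setNat (o + 48) 0 H).setNat (o + 8) 0
    (((NExp.var (o + 6) + 1) * NExp.var (o + 4)).eval
      (((s.setNat (o + 4) 0 n).setNat (o + 6) 0 H).setNat (o + 48) 0 H)) with hs1
  have s4 : s1.nat (o + 4) 0 = n := by simp [hs1]
  have s6 : s1.nat (o + 6) 0 = H := by simp [hs1]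
  have s48 : s1.nat (o + 48) 0 = H := by simp [hs1]
  have s8 : s1.nat (o + 8) 0 = (H + 1) * n := by simp [hs1]
  have s_1 : s1.nat 1 = s.nat 1 := by simp [hs1]
  have r_0 : s1.real 0 = s.real 0 := by simp [hs1]
  refine (run_loadGraph (X := X) (g := g) s4 (by rw [s_1]; exact hadj) (by rw [r_0]; exact hw) he hc
    hnn (by omega)).frame.mono ?_
  rintro t2 s2 ⟨⟨ht2, hG2⟩, hF2⟩
  refine (run_initLabels (T := fun _ => True) hG2.size (by simp) (by simp) w1).frame.mono ?_
  rintro t3 s3 ⟨⟨ht3, hl3, hl3'⟩, hF3⟩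
  have hG3 : HasGraph o X s3 := hG2.congr (hF3.nat _ (by simp)) (hF3.nat _ (by simp))
    (hF3.real _ (by simp))
  have a48 : s3.nat (o + 48) 0 = H := by
    rw [hF3.nat _ (by simp), hF2.nat _ (by simp), s48]
  refine (run_levels hG3 a48 (by nlinarith) (by omega) (fun _ => True) hl3 hl3').frame.mono ?_
  rintro t4 s4' ⟨⟨ht4, hl4⟩, hF4⟩
  have hG4 : HasGraph o X s4' := hG3.congr (hF4.nat _ (by simp)) (hF4.nat _ (by simp))
    (hF4.real _ (by simp))
  have b48 : s4'.nat (o + 48) 0 = H := by rw [hF4.nat _ (by simp), a48]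
  -- Decodes the state `c = j * n + v` and reads the label of `v` in level `H - j`.
  set q : ℕ → ℝ := fun c => s4'.real (o + 4) ((H - c / n) * n + c % n) with hq
  have hqv : ∀ j ≤ H, ∀ v : Fin n, s4'.real (o + 4) ((H - j) * n + v.val) = q (j * n + v.val) := by
    intro j hj v
    simp only [hq, code_div, code_mod]
  have hpot : X.IsPotential H q := by
    intro j hj v
    rw [← hqv j hj v]
    refine (hl4 (H - j) (by omega) v).least fun h0 => ?_
    have := (hl4 (H - j) (by omega) v).empty h0
    exact (X.termWeights_all_nonempty (H - j) v).ne_empty this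
  -- Level `H` is the potential of layer `0`, from which searches start. It needs a copy of its own
  -- because reports overwrite the array of labels.
  refine (run_copyLevel (a := o + 20) hG4.size b48 (by simp) w1).frame.mono ?_
  rintro t5 s5 ⟨⟨ht5, hst5⟩, hF5⟩
  have hG5 : HasGraph o X s5 := hG4.congr (hF5.nat _ (by simp)) (hF5.nat _ (by simp))
    (hF5.real _ (by simp))
  have b6 : s5.nat (o + 6) 0 = H := by
    rw [hF5.nat _ (by simp), hF4.nat _ (by simp), hF3.nat _ (by simp), hF2.nat _ (by simp), s6]
  have b8 : s5.nat (o + 8) 0 = (H + 1) * n := by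
    rw [hF5.nat _ (by simp), hF4.nat _ (by simp), hF3.nat _ (by simp), hF2.nat _ (by simp), s8]
  have c4 := hF5.real (o + 4) (by simp)
  refine (run_sortAll (q := q) (L := L) hG5 b6 b8 (by omega) hL
    (by rw [c4]; exact hqv)).frame.mono ?_
  rintro t6 s6' ⟨⟨ht6, hl6⟩, hF6⟩
  have hG6 : HasGraph o X s6' := hG5.congr (hF6.nat _ (by simp)) (hF6.nat _ (by simp))
    (hF6.real _ (by simp))
  have d8 : s6'.nat (o + 8) 0 = (H + 1) * n := by rw [hF6.nat _ (by simp), b8]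
  have d20 := hF6.real (o + 20) (by simp)
  refine (run_clearAll (S := (H + 1) * n) hG6.size d8 w1 (by omega)).frame.mono ?_
  rintro t7 s7 ⟨⟨ht7, hC⟩, hF7⟩
  have hG7 : HasGraph o X s7 := hG6.congr (hF7.nat _ (by simp)) (hF7.nat _ (by simp))
    (hF7.real _ (by simp))
  refine ⟨?_, hG7, hC, q, hpot, hG7.size, ?_, ?_, ?_⟩
  · simp only [NExp.cost_ofNat, NExp.cost_get, NExp.cost_var, NExp.cost_add, NExp.cost_mul]
    have := prepare_time hn0 hL0 ht2 ht3 ht4 ht5 ht6 ht7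
    omega
  · rw [hF7.nat _ (by simp), d8]
  · intro v
    rw [hF7.real _ (by simp), d20, hst5 v v.isLt]
    have := hqv 0 (Nat.zero_le _) v
    simpa using this
  · rw [hF7.nat (o + 24) (by simp), hF7.real (o + 8) (by simp), hF7.real (o + 10) (by simp)]
    exact hl6

/-- Compute the `hop`-hop distances to the vertex in cell `2` of array `0` in the graph of side
`o`, and store them in the real array `a`. -/
def distancesTo (o a : ℕ) (hop : NExp) : Prog :=
  Prog.setNat (o + 48) 0 hop ;; initLabels o (.natEq (.var (o + 14)) (.get 0 2)) ;; levels o ;;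
  copyLevel o a

/-- The level computation with `r` as the only terminal vertex; by `termWeights_eq` its last level
consists of the distances to `r`. -/
theorem run_distancesTo {a : ℕ} {hop : NExp} {r : Fin n} (hG : HasGraph o X s)
    (hr : s.nat 0 2 = r.val) (hhop : hop.eval s = H) (hc : hop.cost ≤ 5) (ha : a ≠ o + 4)
    (hW : (H + 2) * (n + 1) ≤ W) :
    Run W (distancesTo o a hop) s (fun t s' => t ≤ 2000 * ((H + 1) * (n + 1) ^ 2) ∧
      ∀ v : Fin n, (X.pathWeights H v r).Nonempty → X.IsHopDist H v r (s'.real a v.val)) := by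
  have hr0 := r.isLt
  have hHW : H ≤ W := by nlinarith
  have hnW : n ≤ W := by nlinarith
  have h2W : 2 ≤ W := by nlinarith
  unfold distancesTo
  rw [run_seq, run_setNat]
  refine ⟨Nat.zero_le _, by rw [hhop]; exact hHW, ?_⟩
  rw [hhop]
  simp only [NExp.eval_ofNat]
  set s1 := s.setNat (o + 48) 0 H with hs1
  have hG1 : HasGraph o X s1 := hG.congr (by simp [hs1]) (by simp [hs1]) (by simp [hs1])
  have h01 : s1.nat 0 2 = r.val := by simp [hs1, hr]
  refine (run_initLabels (T := fun v => v = r) hG1.size ?_ (by simp) hnW).frame.seq ?_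
  · intro s' v h0 h14
    simp [h0, h14, h01, Fin.ext_iff]
  rintro t2 s2 ⟨⟨ht2, hl2, hl2'⟩, hF2⟩
  have hG2 : HasGraph o X s2 := hG1.congr (hF2.nat _ (by simp)) (hF2.nat _ (by simp))
    (hF2.real _ (by simp))
  have a48 : s2.nat (o + 48) 0 = H := by rw [hF2.nat _ (by simp)]; simp [hs1]
  refine (run_levels hG2 a48 hW h2W (fun v => v = r) hl2 hl2').frame.seq ?_
  rintro t3 s3 ⟨⟨ht3, hl3⟩, hF3⟩
  have hG3 : HasGraph o X s3 := hG2.congr (hF3.nat _ (by simp)) (hF3.nat _ (by simp))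
    (hF3.real _ (by simp))
  have b48 : s3.nat (o + 48) 0 = H := by rw [hF3.nat _ (by simp), a48]
  refine (run_copyLevel hG3.size b48 ha hnW).mono ?_
  rintro t4 s4 ⟨ht4, h4⟩
  refine ⟨?_, fun v hv => ?_⟩
  · simp only [NExp.cost_ofNat]
    nlinarith
  · have h := hl3 H le_rfl v
    rw [termWeights_eq] at h
    rw [h4 v v.isLt]
    exact h.least fun h0 => hv.ne_empty (h.empty h0)

end

end RealRAM

/-! ### The algorithm -/

namespace RealRAM

open FrozenGraph

section

variable {W n o H L h : ℕ} {X G : FrozenGraph n} {q : ℕ → ℝ} {r : Fin n} {V V₂ V₃ : Finset (Fin n)}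
  {s s' : Mem}

theorem SideState.le_of_notMem (hs : SideState o X H q r V s) (hq : X.IsPotential H q) {v : Fin n}
    (hv : v ∉ V) {x : ℝ} (hx : x ∈ X.outWeights H r v) :
    s.nat (o + 36) 0 < (H + 1) * n ∧ s.real (o + 14) 0 ≤ x :=
  hs.inv.search.outWeights_ge hs.inv.next hq
    (fun k hk hkv => hv ((hs.inv.vertices.mem v).mpr ⟨k, hk, hkv⟩)) hx

theorem SideState.dist_eq (hs : SideState o X H q r V s) (hq : X.IsPotential H q) {v : Fin n}
    {x : ℝ} (hx : X.IsHopDist H r v x)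
    (hlt : s.nat (o + 36) 0 < (H + 1) * n → x < s.real (o + 14) 0) : s.real o v.val = x := by
  obtain ⟨⟨k, hk, hkv, hkx⟩, hmin⟩ := hs.inv.search.isHopDist hs.inv.next hq hx hlt
  have hV := hs.inv.vertices
  obtain ⟨i, hi, hiv, hix⟩ := hV.attained v ((hV.mem v).mpr ⟨k, hk, hkv⟩)
  exact le_antisymm ((hV.label_le k hk v hkv).trans hkx) (hix ▸ hmin i hi hiv)

/-- Vertices in the sets have walks bounded by the last value of their side. Walks through any other
vertex are at least the next value, and if a side has no next state, no such walk exists. -/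
theorem Balanced.isForwardBackward {q₂ q₃ : ℕ → ℝ}
    (hB : Balanced ((h + 1 + 1) * n) ((h + 1) * n) V₂ V₃ s)
    (h2 : SideState 2 G (h + 1) q₂ r V₂ s) (h3 : SideState 3 G.rev h q₃ r V₃ s)
    (hq₂ : G.IsPotential (h + 1) q₂) (hq₃ : G.rev.IsPotential h q₃) :
    IsForwardBackward G h r (s.real 1 0) V₂ V₃ where
  out_le v hv := by
    obtain ⟨x, hx, hle⟩ := h2.bound v hv
    exact ⟨x, hx, hle.trans hB.out_le⟩
  out_ge v hv x hx := by
    obtain ⟨hb, hf⟩ := h2.le_of_notMem hq₂ hv hx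
    exact (hB.out_next hb).trans hf
  in_le v hv := by
    rw [inWeights_eq_rev]
    obtain ⟨x, hx, hle⟩ := h3.bound v hv
    exact ⟨x, hx, hle.trans (hB.in_le ⟨v, hv⟩)⟩
  in_ge v hv x hx := by
    rw [inWeights_eq_rev] at hx
    obtain ⟨hb, hf⟩ := h3.le_of_notMem hq₃ hv hx
    exact (hB.in_next hb).trans hf
  strict := by
    rcases hB.strict with hlt | hlt
    · left
      intro v hv
      obtain ⟨x, hx, hle⟩ := h2.bound v hv
      exact ⟨x, hx, hle.trans_lt hlt⟩
    · right
      intro v hv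
      rw [inWeights_eq_rev]
      obtain ⟨x, hx, hle⟩ := h3.bound v hv
      exact ⟨x, hx, hle.trans_lt (hlt ⟨v, hv⟩)⟩
  card_out_le := hB.card_out_le
  card_in_le := hB.card_in_le.trans (Nat.le_succ _)

/-- The data of one side that queries and reports need. -/
structure SideReady {n : ℕ} (o : ℕ) (X : FrozenGraph n) (H : ℕ) (s : Mem) : Prop where
  graph : HasGraph o X s
  clean : Clean o n ((H + 1) * n) s
  search : ∃ q, X.IsPotential H q ∧ SearchData o X H q s

theorem SideReady.congr (hs : SideReady o X H s)
    (hn : ∀ k ∈ [2, 4, 8, 24, 26, 28], s'.nat (o + k) = s.nat (o + k))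
    (hr : ∀ k ∈ [2, 8, 10, 20], s'.real (o + k) = s.real (o + k)) : SideReady o X H s' := by
  simp only [List.forall_mem_cons] at hn hr
  obtain ⟨n2, n4, n8, n24, n26, n28, -⟩ := hn
  obtain ⟨r2, r8, r10, r20, -⟩ := hr
  obtain ⟨q, hq, hD⟩ := hs.search
  exact ⟨hs.graph.congr n4 n2 r2, ⟨by rw [n26]; exact hs.clean.states,
    by rw [n28]; exact hs.clean.vertices⟩, q, hq, hD.congr n4 n8 n24 r20 r8 r10⟩

theorem SideReady.frame {p : Prog} (hs : SideReady o X H s) (hF : Frame p s s')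
    (hn : ∀ k ∈ [2, 4, 8, 24, 26, 28], o + k ∉ p.natWrites)
    (hr : ∀ k ∈ [2, 8, 10, 20], o + k ∉ p.realWrites) : SideReady o X H s' :=
  hs.congr (fun k hk => hF.nat _ (hn k hk)) fun k hk => hF.real _ (hr k hk)

/-- The memory after the preprocessing, and between queries and reports. -/
structure Ready {n : ℕ} (G : FrozenGraph n) (h : ℕ) (s : Mem) : Prop where
  hops : s.nat 0 1 = h
  forward : SideReady 2 G (h + 1) s
  backward : SideReady 3 G.rev h s

theorem Ready.setRoot (hs : Ready G h s) (x : ℕ) : Ready G h (s.setNat 0 2 x) :=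
  ⟨by simp [hs.hops], hs.forward.congr (by simp) (by simp), hs.backward.congr (by simp) (by simp)⟩

/-- The preprocessing. -/
def preprocessProg : Prog :=
  prepareSide 2 (.var 16) (.get 0 1 + 1) ;;
  prepareSide 3 ((.var 17 - .var 17 / .var 7 * .var 7) * .var 7 + .var 17 / .var 7) (.get 0 1)

theorem run_preprocessProg (hn : 0 < n) (hL0 : 0 < L) (hL : n ≤ 2 ^ L) (hI : G.IsInput h s)
    (hW : (h + 2) * n * (n + 2) + 4 * n + 2 * (h + 1) ≤ W) :
    Run W preprocessProg s (fun t s' =>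
      t ≤ 10000 * ((h + 2) * n ^ 2 * L) + 10000 * ((h + 1) * n ^ 2 * L) ∧ Ready G h s') := by
  obtain ⟨i0, i1, i2, i3⟩ := hI
  unfold preprocessProg
  refine (run_prepareSide (X := G) (e := .var 16) (g := fun u v => u.val * n + v.val) (H := h + 1) i0 hn hL0
    i2 i3 (fun s' u v _ h' => h') (by simp) (fun s' h0 => ?_) (by simp) hW
    hL).frame.seq ?_
  · simp [h0, i1]
  rintro t s1 ⟨⟨ht, hG, hC, hq⟩, hF⟩
  have e0 := hF.nat 0 (by decide)
  have e1 := hF.nat 1 (by decide)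
  have r0 := hF.real 0 (by decide)
  have hW' : (h + 1) * n * (n + 2) + 4 * n + 2 * h ≤ W := by nlinarith
  -- The entry with number `u * n + v` is read from cell `v * n + u`; arrays `17` and `7` hold the
  -- counter and `n` on side `3`.
  refine (run_prepareSide (X := G.rev) (g := fun u v => v.val * n + u.val) (H := h)
    (by rw [e0, i0]) hn hL0 (fun u v => by rw [e1]; exact i2 v u)
    (fun u v hA => by rw [r0]; exact i3 v u hA) (fun s' u v h4 h14 => ?_) (by simp)
    (fun s' h0 => ?_) (by simp) hW' hL).frame.mono ?_
  · have h4' : s'.nat 7 0 = n := h4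
    have h14' : s'.nat 17 0 = u.val * n + v.val := h14
    simp [h4', h14', code_div]
  · simp [h0, e0, i1]
  rintro t' s2 ⟨⟨ht', hG', hC', hq'⟩, hF'⟩
  rw [show h + 1 + 1 = h + 2 from rfl] at ht
  refine ⟨by omega, ?_, SideReady.frame ⟨hG, hC, hq⟩ hF' (by decide) (by decide),
    hG', hC', hq'⟩
  rw [hF'.nat 0 (by decide), e0, i1]

/-- The report for the vertex in cell `2` of array `0`. -/
def reportProg : Prog := distancesTo 3 2 (.get 0 1 + 1) ;; distancesTo 2 3 (.get 0 1)

/-- Side `3` holds the reversed graph, where distances to `r` are the distances from `r` in `G`;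
side `2` gives the distances to `r`. The arrays written are not among those that `Ready` constrains,
so later queries are unaffected. -/
theorem run_reportProg (hs : Ready G h s) (hr : s.nat 0 2 = r.val)
    (hW : (h + 3) * (n + 1) ≤ W) :
    Run W reportProg s (fun t s' =>
      t ≤ 2000 * ((h + 2) * (n + 1) ^ 2) + 2000 * ((h + 1) * (n + 1) ^ 2) ∧ Ready G h s' ∧
      (∀ v : Fin n, (G.pathWeights (h + 1) r v).Nonempty →
        G.IsHopDist (h + 1) r v (s'.real 2 v.val)) ∧
      ∀ v : Fin n, (G.pathWeights h v r).Nonempty → G.IsHopDist h v r (s'.real 3 v.val)) := by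
  have hF : ∀ s', Frame reportProg s s' → Ready G h s' := fun s' hF =>
    ⟨by rw [hF.nat 0 (by decide), hs.hops], hs.forward.frame hF (by decide) (by decide),
      hs.backward.frame hF (by decide) (by decide)⟩
  suffices Run W reportProg s (fun t s' =>
      t ≤ 2000 * ((h + 2) * (n + 1) ^ 2) + 2000 * ((h + 1) * (n + 1) ^ 2) ∧
      (∀ v : Fin n, (G.pathWeights (h + 1) r v).Nonempty →
        G.IsHopDist (h + 1) r v (s'.real 2 v.val)) ∧
      ∀ v : Fin n, (G.pathWeights h v r).Nonempty → G.IsHopDist h v r (s'.real 3 v.val)) from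
    this.frame.mono fun t s' ht => ⟨ht.1.1, hF s' ht.2, ht.1.2⟩
  unfold reportProg
  refine (run_distancesTo (H := h + 1) hs.backward.graph hr (by simp [hs.hops])
    (by simp) (by decide) hW).frame.seq ?_
  rintro t s1 ⟨⟨ht, hd⟩, hF1⟩
  have e0 := hF1.nat 0 (by decide)
  refine (run_distancesTo (H := h) (hs.forward.frame hF1 (by decide) (by decide)).graph
    (by rw [e0, hr]) (by simp [e0, hs.hops]) (by simp) (by decide)
    (by nlinarith)).frame.mono ?_
  rintro t' s2 ⟨⟨ht', hd'⟩, hF2⟩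
  rw [show h + 1 + 1 = h + 2 from rfl] at ht
  refine ⟨by omega, fun v hv => ?_, hd'⟩
  rw [hF2.real 2 (by decide)]
  have := hd v (by rwa [pathWeights_rev])
  rwa [IsHopDist, pathWeights_rev] at this

theorem run_queryProg_ready (hs : Ready G h s) (hh : 0 < h) (hr : s.nat 0 2 = r.val)
    (hW : (h + 2) * n * (n + 2) ≤ W) :
    Run W queryProg s (fun t s' => ∃ V₂ V₃ : Finset (Fin n),
      t ≤ 15000 * ((V₂.card + V₃.card) * h) ^ 2 ∧ Ready G h s' ∧
      ListsSet s' 2 V₂ ∧ ListsSet s' 3 V₃ ∧ IsForwardBackward G h r (s'.real 1 0) V₂ V₃ ∧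
      (∀ (v : Fin n) (x : ℝ), G.IsHopDist (h + 1) r v x → x < -s'.real 1 0 →
        s'.real 2 v.val = x) ∧
      ∀ (v : Fin n) (x : ℝ), G.IsHopDist h v r x → x < s'.real 1 0 → s'.real 3 v.val = x) := by
  obtain ⟨q₂, hq₂, hD₂⟩ := hs.forward.search
  obtain ⟨q₃, hq₃, hD₃⟩ := hs.backward.search
  have hW' : (h + 1) * n * (n + 2) ≤ W := by nlinarith
  refine (run_queryProg hD₂ hD₃ hs.forward.clean hs.backward.clean hr hq₂ hq₃ hW hW').frame.mono ?_
  rintro t s' ⟨⟨V₂, V₃, s₁, ht, h2, h3, hne, hB, hF, hC₂, hC₃⟩, hF'⟩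
  have hreal : s'.real = s₁.real := funext fun a => hF.real a (by simp [Prog.realWrites])
  refine ⟨V₂, V₃, ?_, ⟨?_, ?_, ?_⟩, ?_, ?_, ?_, ?_, ?_⟩
  · have c2 := h2.inv.cnt_le
    have c3 := h3.inv.cnt_le
    have p2 := h2.inv.spent_le
    have p3 := h3.inv.spent_le
    norm_num at c2 c3 p2 p3
    have hV := hne.card_pos
    have hM : 1 ≤ (V₂.card + V₃.card) * h := Nat.mul_pos (by omega) hh
    -- There are at most `h + 2` layers, which is at most `3 * h` because `h` is positive. The
    -- quadratic cost is thus at most `1100 * 9 * M ^ 2`; the constant `15000` also covers the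
    -- clearing and the additive terms, as `M ≥ 1`.
    have hc : s₁.nat 36 0 + s₁.nat 37 0 ≤ 3 * ((V₂.card + V₃.card) * h) := by nlinarith
    generalize (V₂.card + V₃.card) * h = M at *
    generalize s₁.nat 36 0 = x at *
    generalize s₁.nat 37 0 = y at *
    have hxy : x ^ 2 + y ^ 2 ≤ (x + y) ^ 2 := by nlinarith
    have hxy' : (x + y) ^ 2 ≤ (3 * M) ^ 2 := Nat.pow_le_pow_left hc 2
    nlinarith
  · rw [hF'.nat 0 (by decide), hs.hops]
  · exact ⟨hs.forward.graph.congr (hF'.nat _ (by decide)) (hF'.nat _ (by decide))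
      (hF'.real _ (by decide)), hC₂, q₂, hq₂, hD₂.congr (hF'.nat _ (by decide))
      (hF'.nat _ (by decide)) (hF'.nat _ (by decide)) (hF'.real _ (by decide))
      (hF'.real _ (by decide)) (hF'.real _ (by decide))⟩
  · exact ⟨hs.backward.graph.congr (hF'.nat _ (by decide)) (hF'.nat _ (by decide))
      (hF'.real _ (by decide)), hC₃, q₃, hq₃, hD₃.congr (hF'.nat _ (by decide))
      (hF'.nat _ (by decide)) (hF'.nat _ (by decide)) (hF'.real _ (by decide))
      (hF'.real _ (by decide)) (hF'.real _ (by decide))⟩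
  · rw [ListsSet, hF.nat 2 (by decide)]
    exact ⟨h2.inv.vertices.size, h2.inv.vertices.elems⟩
  · rw [ListsSet, hF.nat 3 (by decide)]
    exact ⟨h3.inv.vertices.size, h3.inv.vertices.elems⟩
  · rw [hreal]
    exact hB.isForwardBackward h2 h3 hq₂ hq₃
  · intro v x hx hlt
    rw [hreal] at hlt ⊢
    exact h2.dist_eq hq₂ hx fun hb => hlt.trans_le (hB.out_next hb)
  · intro v x hx hlt
    rw [hreal] at hlt ⊢
    refine h3.dist_eq hq₃ (x := x) ?_ fun hb => hlt.trans_le (hB.in_next hb)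
    rwa [IsHopDist, pathWeights_rev]

end

/-! ### Numerical bounds and the final theorem. -/

/-- Compare `2 ^ Nat.log 2 n ≤ n` after taking logarithms, and use that `log 2` exceeds one half. -/
theorem natLog_succ_le {n : ℕ} (hn : 0 < n) :
    ((Nat.log 2 n + 1 : ℕ) : ℝ) ≤ 2 * (1 + Real.log n) := by
  have h2 := Real.log_two_gt_d9
  have h1 : ((2 : ℝ) ^ Nat.log 2 n) ≤ n := by
    exact_mod_cast Nat.pow_log_le_self 2 hn.ne'
  have h3 := Real.log_le_log (by positivity) h1
  rw [Real.log_pow] at h3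
  have h4 : (0 : ℝ) ≤ Nat.log 2 n := Nat.cast_nonneg _
  push_cast
  nlinarith

/-- The largest addresses are cubic in `m = n + h`, since each of the `O(h n)` states has a list of
length `n + 1`. As `m ≥ 2`, three further powers of `m` absorb the constants. -/
theorem word_bound {n h : ℕ} (hn : 0 < n) (hh : 0 < h) :
    (h + 2) * n * (n + 2) + 4 * n + 2 * (h + 1) ≤ (n + h) ^ 6 ∧
      (h + 3) * (n + 1) ≤ (n + h) ^ 6 := by
  obtain ⟨m, hm⟩ : ∃ m, m = n + h := ⟨_, rfl⟩
  rw [← hm]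
  have hm2 : 2 ≤ m := by omega
  have h3 : (h + 2) * n * (n + 2) ≤ 2 * m * m * (2 * m) :=
    Nat.mul_le_mul (Nat.mul_le_mul (by omega) (by omega)) (by omega)
  have h4 : (h + 3) * (n + 1) ≤ 2 * m * m := Nat.mul_le_mul (by omega) (by omega)
  have p2 : 2 * m ≤ m ^ 2 := by nlinarith
  have p3 : 4 * m ≤ m ^ 3 := by nlinarith
  have p5 : 4 * m ^ 3 ≤ m ^ 5 := by
    have : 4 ≤ m ^ 2 := by nlinarith
    calc 4 * m ^ 3 ≤ m ^ 2 * m ^ 3 := Nat.mul_le_mul_right _ this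
      _ = m ^ 5 := by ring
  have p6 : 2 * m ^ 5 ≤ m ^ 6 := by
    calc 2 * m ^ 5 ≤ m * m ^ 5 := Nat.mul_le_mul_right _ hm2
      _ = m ^ 6 := by ring
  constructor
  · nlinarith
  · nlinarith

end RealRAM

theorem mainTheorem5 :
    ∃ (preprocess query report : RealRAM.Prog) (C : ℝ) (K : ℕ),
      ∀ (n h : ℕ), 0 < n → 0 < h → ∀ G : FrozenGraph n,
        ∃ Ready : RealRAM.Mem → Prop,
          (∀ s : RealRAM.Mem, G.IsInput h s →
            ∃ (t : ℕ) (s' : RealRAM.Mem),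
              RealRAM.Exec ((n + h) ^ K) preprocess s t s' ∧
              (t : ℝ) ≤ C * ((h : ℝ) * (n : ℝ) ^ 2 * (1 + Real.log n) ^ K) ∧
              Ready s') ∧
          (∀ (s : RealRAM.Mem) (r : Fin n), Ready s → G.IsNegVertex r →
            ∃ (t : ℕ) (s' : RealRAM.Mem) (Δ : ℝ) (Vout Vin : Finset (Fin n)),
              RealRAM.Exec ((n + h) ^ K) query (s.setNat 0 2 r.val) t s' ∧
              (t : ℝ) ≤ C * (((Vout.card : ℝ) + (Vin.card : ℝ)) ^ 2 * (h : ℝ) ^ 2 +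
                ((Vout.card : ℝ) + (Vin.card : ℝ)) * (h : ℝ) * Real.log n) ∧
              Ready s' ∧
              s'.real 1 0 = Δ ∧ ListsSet s' 2 Vout ∧ ListsSet s' 3 Vin ∧
              IsForwardBackward G h r Δ Vout Vin ∧
              (∀ (v : Fin n) (x : ℝ), G.IsHopDist (h + 1) r v x → x < -Δ →
                s'.real 2 v.val = x) ∧
              (∀ (v : Fin n) (x : ℝ), G.IsHopDist h v r x → x < Δ →
                s'.real 3 v.val = x)) ∧
          (∀ (s : RealRAM.Mem) (r : Fin n), Ready s → G.IsNegVertex r →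
            ∃ (t : ℕ) (s' : RealRAM.Mem),
              RealRAM.Exec ((n + h) ^ K) report (s.setNat 0 2 r.val) t s' ∧
              (t : ℝ) ≤ C * ((h : ℝ) * (n : ℝ) ^ 2 * (1 + Real.log n) ^ K) ∧
              Ready s' ∧
              (∀ v : Fin n, (G.pathWeights (h + 1) r v).Nonempty →
                G.IsHopDist (h + 1) r v (s'.real 2 v.val)) ∧
              (∀ v : Fin n, (G.pathWeights h v r).Nonempty →
                G.IsHopDist h v r (s'.real 3 v.val))) := by
  -- The exponent `6` comes from the word size; for the logarithm the exponent `1` would do, and `1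
  -- + log n ≥ 1` allows the larger one. The constant `100000` is twice the `50000` of the
  -- preprocessing, the factor two coming from `natLog_succ_le`.
  refine ⟨RealRAM.preprocessProg, RealRAM.queryProg, RealRAM.reportProg, 100000, 6, fun n h hn hh G => ⟨RealRAM.Ready G h, ?_, ?_,
    ?_⟩⟩
  all_goals
    obtain ⟨hW, hW'⟩ := RealRAM.word_bound hn hh
    have hh' : (1 : ℝ) ≤ h := by exact_mod_cast hh
    have hn' : (1 : ℝ) ≤ n := by exact_mod_cast hn
    have hlog : 0 ≤ Real.log n := Real.log_nonneg hn'
    have hlog6 : 1 + Real.log n ≤ (1 + Real.log n) ^ 6 :=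
      le_self_pow₀ (by linarith) (by norm_num)
    have hhn : (0 : ℝ) ≤ h * n ^ 2 := by positivity
  · intro s hI
    obtain ⟨t, s', he, ht, hR⟩ := RealRAM.run_preprocessProg hn (Nat.succ_pos _)
      (Nat.lt_pow_succ_log_self one_lt_two n).le hI hW
    refine ⟨t, s', he, ?_, hR⟩
    have hL := RealRAM.natLog_succ_le hn
    have hnat : t ≤ 50000 * (h * n ^ 2 * (Nat.log 2 n + 1)) := by
      have : (h + 2) * n ^ 2 * (Nat.log 2 n + 1) + (h + 1) * n ^ 2 * (Nat.log 2 n + 1) ≤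
          5 * h * (n ^ 2 * (Nat.log 2 n + 1)) := by
        rw [mul_assoc, mul_assoc, ← add_mul]
        exact Nat.mul_le_mul_right _ (by omega)
      have e : 5 * h * (n ^ 2 * (Nat.log 2 n + 1)) = 5 * (h * n ^ 2 * (Nat.log 2 n + 1)) := by ring
      simp only [Nat.succ_eq_add_one] at ht
      omega
    calc (t : ℝ) ≤ 50000 * (h * n ^ 2 * ((Nat.log 2 n + 1 : ℕ) : ℝ)) := by exact_mod_cast hnat
      _ ≤ 50000 * (h * n ^ 2 * (2 * (1 + Real.log n) ^ 6)) := by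
        gcongr
        linarith
      _ = 100000 * (h * n ^ 2 * (1 + Real.log n) ^ 6) := by ring
  · intro s r hR _
    obtain ⟨t, s', he, V₂, V₃, ht, hR', hl2, hl3, hfb, hd2, hd3⟩ :=
      RealRAM.run_queryProg_ready (W := (n + h) ^ 6) (r := r) (hR.setRoot r.val) hh (by simp) (by omega)
    refine ⟨t, s', _, V₂, V₃, he, ?_, hR', rfl, hl2, hl3, hfb, hd2, hd3⟩
    have ht' : (t : ℝ) ≤ 15000 * (((V₂.card : ℝ) + V₃.card) * h) ^ 2 := by exact_mod_cast ht
    -- The quadratic term alone pays for the query; the logarithmic term only has to be nonnegative.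
    have : (0 : ℝ) ≤ ((V₂.card : ℝ) + V₃.card) * h * Real.log n := by positivity
    have h2 : (0 : ℝ) ≤ (((V₂.card : ℝ) + V₃.card) * h) ^ 2 := by positivity
    rw [← mul_pow]
    linarith
  · intro s r hR _
    obtain ⟨t, s', he, ht, hR', hd⟩ :=
      RealRAM.run_reportProg (W := (n + h) ^ 6) (r := r) (hR.setRoot r.val) (by simp) hW'
    refine ⟨t, s', he, ?_, hR', hd⟩
    have hnat : t ≤ 40000 * (h * n ^ 2) := by
      have h1 : (n + 1) ^ 2 ≤ 4 * n ^ 2 := by nlinarith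
      have h2 : (h + 2) * (n + 1) ^ 2 + (h + 1) * (n + 1) ^ 2 ≤ 5 * h * (4 * n ^ 2) := by
        rw [← add_mul]
        exact Nat.mul_le_mul (by omega) h1
      have e : 5 * h * (4 * n ^ 2) = 20 * (h * n ^ 2) := by ring
      omega
    calc (t : ℝ) ≤ 40000 * (h * n ^ 2) := by exact_mod_cast hnat
      _ ≤ 100000 * (h * n ^ 2 * 1) := by linarith
      _ ≤ 100000 * (h * n ^ 2 * (1 + Real.log n) ^ 6) := by
        gcongr
        linarith
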